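/- Notation. Let $\langle x\rangle=(1+|x|^2)^{1/2}$ and $P=-i\nabla$ on $\mathbb R^3$; $f\lesssim g$ means $f\le c\,g$ on $\mathbb R^3$ for some constant $c$. For $k,s\in\mathbb R$ let $H^{k,s}$ be the completion of the Schwartz space $\mathcal S(\mathbb R^3)$ in the norm $\|\langle x\rangle^s(1-\Delta)^{k/2}u\|_{L^2}$, i.e. the space of tempered distributions $u$ with $\langle x\rangle^s(1-\Delta)^{k/2}u\in L^2(\mathbb R^3)$, and let $H^{1,-\frac12-0}=\bigcap_{r<-1/2}H^{1,r}$. Let $G_0$ be the operator with integral kernel $\frac1{4\pi|x-y|}$, extended by duality to $H^{-1,s}$, $s>\frac12$. Let $\beta>2$. Let $V\colon\mathbb R^3\to\mathbb R$ be measurable with $|V(x)|\lesssim\langle x\rangle^{-\beta}$, and let $B\in C^1(\mathbb R^3;\mathbb R^3)$ satisfy $\nabla\cdot B=0$, $|B(x)|\lesssim\langle x\rangle^{-\beta-1}$ and $|\partial_{x_j}B(x)|\lesssim\langle x\rangle^{-\beta-1}$ for $j=1,2,3$. Suppose $V\ge0$. There exists $A\in C^1(\mathbb R^3;\mathbb R^3)$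 with $\operatorname{rot}A=B$ and $|A(x)|\lesssim\langle x\rangle^{-\beta}$. For every such $A$ the following hold. 1. Let $A_j=D_jC_j$ with real measurable functions $C_j,D_j$ such that $|C_j(x)|+|D_j(x)|\lesssim\langle x\rangle^{-\beta/2}$, $j=1,2,3$. On $\mathscr K=L^2(\mathbb R^3)\oplus L^2(\mathbb R^3;\mathbb C^3)\oplus L^2(\mathbb R^3;\mathbb C^3)\oplus L^2(\mathbb R^3;\mathbb C^3)$ put $$w\,u=\bigl(|V|^{1/2}u,\ (A_ju)_j,\ (C_ju)_j,\ (D_jP_ju)_j\bigr),\qquad \mathcal U(f_1,f_2,f_3,f_4)=(Uf_1,\,f_2,\,-f_4,\,-f_3),$$ where $U=-1$ where $V<0$ and $U=1$ elsewhere; $w$ maps $H^{1,-\beta/2}$ to $\mathscr K$ and $w^*$ maps $\mathscr K$ to $H^{-1,\beta/2}$. Then $M_0=\mathcal U+wG_0w^*$ is a well-defined bounded operator on $\mathscr K$, and $\ker M_0=\{0\}$. 2. Zero is a regular point of $H=(P-A)^2+V$: for every $s$ with $\frac12<s\le\frac32$, the only $u\in H^{1,-s}$ with $Hu=0$ in the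 sense of distributions is $u=0$. In particular, $\{u\in H^{1,-\frac12-0} : Hu=0\}=\{0\}$. For $V=0$ this says that the magnetic Laplacian $(P-A)^2$ has no non-zero zero-energy solutions in $H^{1,-\frac12-0}$. -/

import Mathlib

open MeasureTheory
open scoped SchwartzMap LineDeriv ContDiff

noncomputable section

namespace MagneticSchrodinger

/-- Three-dimensional Euclidean space. -/
abbrev E3 : Type := EuclideanSpace ℝ (Fin 3)

/-- The standard basis vectors. -/
abbrev basisVec (j : Fin 3) : E3 := EuclideanSpace.single j (1 : ℝ)

/-- The Japanese bracket `⟨x⟩ = (1 + |x|²)^{1/2}`. -/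
def bracket (x : E3) : ℝ := Real.sqrt (1 + ‖x‖ ^ 2)

/-- `|f(x)| ≲ ⟨x⟩^r` on the whole space. -/
def DecaysLike {F : Type*} [Norm F] (r : ℝ) (f : E3 → F) : Prop :=
  ∃ c : ℝ, ∀ x : E3, ‖f x‖ ≤ c * bracket x ^ r

/-! ## Vector calculus -/

/-- The partial derivative `∂_i X_k` of a vector field. -/
def partialD (X : E3 → E3) (i k : Fin 3) (x : E3) : ℝ := (fderiv ℝ X x (basisVec i)) k

/-- The divergence of a vector field. -/
def divergence (X : E3 → E3) (x : E3) : ℝ := ∑ j, partialD X j j x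

/-- The rotation (curl) of a vector field. -/
def curl (X : E3 → E3) (x : E3) : E3 :=
  !₂[partialD X 1 2 x - partialD X 2 1 x,
     partialD X 2 0 x - partialD X 0 2 x,
     partialD X 0 1 x - partialD X 1 0 x]

/-- The assumption on the magnetic field: `B` is continuously differentiable and divergence free,
and `B` and its first partial derivatives are `O(⟨x⟩^{-β-1})`. -/
structure IsMagneticField (β : ℝ) (B : E3 → E3) : Prop where
  contDiff : ContDiff ℝ 1 B
  divergence_eq_zero : ∀ x, divergence B x = 0
  decay : DecaysLike (-β - 1) B
  decay_deriv : ∀ j, DecaysLike (-β - 1) (fun x => fderiv ℝ B x (basisVec j))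

/-- The assumption on the electric potential: `V = O(⟨x⟩^{-β})`. -/
structure IsElectricPotential (β : ℝ) (V : E3 → ℝ) : Prop where
  aemeasurable : AEMeasurable V
  decay : DecaysLike (-β) V

/-- `A` is a short-range `C¹` vector potential of `B`: `rot A = B` and `A = O(⟨x⟩^{-β})`. -/
structure IsVectorPotential (β : ℝ) (B A : E3 → E3) : Prop where
  contDiff : ContDiff ℝ 1 A
  curl_eq : ∀ x, curl A x = B x
  decay : DecaysLike (-β) A

/-- A factorization `A_j = D_j C_j` into real functions that are `O(⟨x⟩^{-β/2})`. -/
structure IsFactorization (β : ℝ) (A : E3 → E3) (C D : Fin 3 → E3 → ℝ) : Prop where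
  aemeasurable_left : ∀ j, AEMeasurable (C j)
  aemeasurable_right : ∀ j, AEMeasurable (D j)
  decay_left : ∀ j, DecaysLike (-β / 2) (C j)
  decay_right : ∀ j, DecaysLike (-β / 2) (D j)
  eq_mul : ∀ j x, A x j = D j x * C j x

/-! ## Weighted Sobolev spaces -/

/-- The complex space `L²(ℝ³)`. -/
abbrev L2 : Type := Lp ℂ 2 (volume : Measure E3)

/-- The symbol `(1 + |2πξ|²)^{k/2}` of `(1 - Δ)^{k/2}`; Mathlib's Fourier transform has the
phase `exp (-2πi x·ξ)`. -/
def besselSymbol (k : ℝ) (ξ : E3) : ℂ :=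
  (((1 + ‖(2 * Real.pi) • ξ‖ ^ 2) ^ (k / 2) : ℝ) : ℂ)

/-- The weight `⟨x⟩^s`. -/
def weight (s : ℝ) (x : E3) : ℂ := ((bracket x ^ s : ℝ) : ℂ)

theorem weight_eq (s : ℝ) :
    weight s = fun x : E3 => (((1 + ‖x‖ ^ 2) ^ (s / 2) : ℝ) : ℂ) := by
  funext x
  have h : (0 : ℝ) ≤ 1 + ‖x‖ ^ 2 := by positivity
  rw [weight, bracket, Real.sqrt_eq_rpow, ← Real.rpow_mul h]
  congr 2
  ring

theorem weight_hasTemperateGrowth (s : ℝ) : (weight s).HasTemperateGrowth := by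
  rw [weight_eq]
  fun_prop

theorem besselSymbol_hasTemperateGrowth (k : ℝ) : (besselSymbol k).HasTemperateGrowth := by
  have h : (fun x : E3 => (((1 + ‖x‖ ^ 2) ^ (k / 2) : ℝ) : ℂ)).HasTemperateGrowth := by
    fun_prop
  have h2 : (fun ξ : E3 => (2 * Real.pi) • ξ).HasTemperateGrowth := by
    fun_prop
  exact h.comp h2

/-- The operator `⟨x⟩^s (1 - Δ)^{k/2}` on tempered distributions. -/
def weightedBessel (k s : ℝ) : 𝓢'(E3, ℂ) →L[ℂ] 𝓢'(E3, ℂ) :=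
  (TemperedDistribution.smulLeftCLM ℂ (weight s)) ∘L
    (TemperedDistribution.fourierMultiplierCLM ℂ (besselSymbol k))

/-- The weighted Sobolev space `H^{k,s}`: the completion of the Schwartz space in the norm
`‖⟨x⟩^s (1 - Δ)^{k/2} u‖_{L²}`, realized as the space of all tempered distributions `u` such that
`⟨x⟩^s (1 - Δ)^{k/2} u` is in `L²`. -/
def weightedSobolev (k s : ℝ) : Submodule ℂ 𝓢'(E3, ℂ) :=
  (LinearMap.range (Lp.toTemperedDistributionCLM ℂ (volume : Measure E3) 2).toLinearMap).comap
    (weightedBessel k s).toLinearMap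

/-- The `L²` function `⟨x⟩^s (1 - Δ)^{k/2} u`, for `u` in `H^{k,s}`. -/
def toL2 {k s : ℝ} (u : weightedSobolev k s) : L2 := Classical.choose u.2

theorem toL2_spec {k s : ℝ} (u : weightedSobolev k s) :
    (Lp.toTemperedDistribution (toL2 u) : 𝓢'(E3, ℂ)) = weightedBessel k s u :=
  Classical.choose_spec u.2

/-- The (bilinear) duality between `H^{-k,s}` and `H^{k,-s}` that extends `∫ g ψ dx`. -/
def dualPairing {k s : ℝ} (g : weightedSobolev (-k) s) (ψ : weightedSobolev k (-s)) : ℂ :=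
  ∫ x, toL2 g x * toL2 ψ x

/-- The tempered distribution `T` is given by the function `F`. -/
def RepresentedBy (T : 𝓢'(E3, ℂ)) (F : E3 → ℂ) : Prop :=
  ∀ φ : 𝓢(E3, ℂ), Integrable (fun x => F x * φ x) ∧ T φ = ∫ x, F x * φ x

/-- The momentum operator `P_j = -i ∂_j` on tempered distributions. -/
def momentum (j : Fin 3) (T : 𝓢'(E3, ℂ)) : 𝓢'(E3, ℂ) := (-Complex.I) • ∂_{basisVec j} T

/-! ## The operator `G₀` -/

/-- The function `G₀ φ`, where `G₀` has the integral kernel `1 / (4π|x - y|)`. -/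
def newtonPotential (φ : 𝓢(E3, ℂ)) (x : E3) : ℂ :=
  ∫ y, ((1 / (4 * Real.pi * ‖x - y‖) : ℝ) : ℂ) * φ y

/-- `u = G₀ g` for `g` in `H^{-1,s}`. The operator with the symmetric kernel `1 / (4π|x - y|)` is
extended from functions to `H^{-1,s}` by duality: `(G₀ g)(φ) = ⟨g, G₀ φ⟩` for Schwartz functions
`φ`, with the duality between `H^{-1,s}` and `H^{1,-s}`. -/
def IsFreeGreen {s : ℝ} (g : weightedSobolev (-1) s) (u : 𝓢'(E3, ℂ)) : Prop :=
  ∀ φ : 𝓢(E3, ℂ), ∃ ψ : weightedSobolev 1 (-s),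
    RepresentedBy ψ (newtonPotential φ) ∧ u φ = dualPairing g ψ

/-! ## The factored perturbation and the operator `M₀` -/

/-- Indices of the components of `𝒦`: one component belonging to `V`, and three each
belonging to the `A_j`, the `C_j` and the `D_j P_j`. -/
abbrev KIndex : Type := Unit ⊕ (Fin 3 ⊕ (Fin 3 ⊕ Fin 3))

/-- The Hilbert space `𝒦 = L²(ℝ³) ⊕ L²(ℝ³; ℂ³) ⊕ L²(ℝ³; ℂ³) ⊕ L²(ℝ³; ℂ³)`. -/
abbrev KSpace : Type := PiLp 2 (fun _ : KIndex => L2)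

/-- The components of `w u = (v u, A_j u, C_j u, D_j P_j u)`, with `v = √|V|`, where `F` is the
function `u` and `G j` is the function `P_j u`. -/
def wComponents (V : E3 → ℝ) (A : E3 → E3) (C D : Fin 3 → E3 → ℝ) (F : E3 → ℂ)
    (G : Fin 3 → E3 → ℂ) : KIndex → E3 → ℂ
  | .inl _ => fun x => (Real.sqrt |V x| : ℂ) * F x
  | .inr (.inl j) => fun x => (A x j : ℂ) * F x
  | .inr (.inr (.inl j)) => fun x => (C j x : ℂ) * F x
  | .inr (.inr (.inr j)) => fun x => (D j x : ℂ) * G j x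

open Classical in
/-- The function `U`, equal to `-1` where `V < 0` and to `1` elsewhere. -/
def signU (V : E3 → ℝ) (x : E3) : ℂ := if V x < 0 then -1 else 1

/-- The components of `𝒰 f`: the matrix `𝒰` multiplies the first component by `U`, fixes the
second block, and exchanges the last two blocks with a minus sign. -/
def uComponents (V : E3 → ℝ) (f : KIndex → E3 → ℂ) : KIndex → E3 → ℂ
  | .inl i => fun x => signU V x * f (.inl i) x
  | .inr (.inl j) => f (.inr (.inl j))
  | .inr (.inr (.inl j)) => fun x => -f (.inr (.inr (.inr j))) x
  | .inr (.inr (.inr j)) => fun x => -f (.inr (.inr (.inl j))) x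

/-- `g = w* f`, that is,
`g = v f₁ + ∑_j A_j f_{2,j} + ∑_j C_j f_{3,j} + ∑_j P_j (D_j f_{4,j})` as a distribution. -/
def IsWAdjoint (V : E3 → ℝ) (A : E3 → E3) (C D : Fin 3 → E3 → ℝ) (f : KSpace)
    (g : 𝓢'(E3, ℂ)) : Prop :=
  ∃ (T : 𝓢'(E3, ℂ)) (S : Fin 3 → 𝓢'(E3, ℂ)),
    RepresentedBy T (fun x => (Real.sqrt |V x| : ℂ) * f (.inl ()) x
      + ∑ j, (A x j : ℂ) * f (.inr (.inl j)) x
      + ∑ j, (C j x : ℂ) * f (.inr (.inr (.inl j))) x) ∧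
    (∀ j, RepresentedBy (S j) (fun x => (D j x : ℂ) * f (.inr (.inr (.inr j))) x)) ∧
    g = T + ∑ j, momentum j (S j)

/-- `M₀ = 𝒰 + w G₀ w*`, as an everywhere defined bounded operator on `𝒦`. For every `f` in `𝒦` one
has `w* f ∈ H^{-1,β/2}` and `u = G₀ w* f ∈ H^{1,-β/2}`, and `M₀ f = 𝒰 f + w u`. -/
def IsMZero (β : ℝ) (V : E3 → ℝ) (A : E3 → E3) (C D : Fin 3 → E3 → ℝ)
    (M : KSpace →L[ℂ] KSpace) : Prop :=
  ∀ f : KSpace, ∃ (g : weightedSobolev (-1) (β / 2)) (u : weightedSobolev 1 (-(β / 2)))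
    (F : E3 → ℂ) (G : Fin 3 → E3 → ℂ),
    IsWAdjoint V A C D f g ∧ IsFreeGreen g u ∧
    RepresentedBy u F ∧ (∀ j, RepresentedBy (momentum j u) (G j)) ∧
    ∀ i, (M f i : E3 → ℂ) =ᵐ[volume]
      fun x => uComponents V (fun i' => (f i' : E3 → ℂ)) i x + wComponents V A C D F G i x

/-! ## Zero-energy solutions -/

/-- `(P - A)² u + V u = 0` in the sense of distributions, for `u` given, together with its first
order derivatives, by functions: with `F = u` and `G j = P_j u`, the function
`G j - A_j F` is `(P_j - A_j) u`, and the outer `P_j - A_j` acts on the test function as its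
transpose `-P_j - A_j = i ∂_j - A_j`. -/
def SolvesZeroEnergy (A : E3 → E3) (V : E3 → ℝ) (u : 𝓢'(E3, ℂ)) : Prop :=
  ∃ (F : E3 → ℂ) (G : Fin 3 → E3 → ℂ),
    RepresentedBy u F ∧ (∀ j, RepresentedBy (momentum j u) (G j)) ∧
    ∀ φ : E3 → ℂ, ContDiff ℝ ∞ φ → HasCompactSupport φ →
      ∫ x, (∑ j, (G j x - (A x j : ℂ) * F x)
          * (Complex.I * fderiv ℝ φ x (basisVec j) - (A x j : ℂ) * φ x)
        + (V x : ℂ) * F x * φ x) = 0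

/-- The zero-energy solutions of `H = (P - A)² + V` in `H^{1,-s}`. -/
def zeroEnergySolutions (A : E3 → E3) (V : E3 → ℝ) (s : ℝ) : Set 𝓢'(E3, ℂ) :=
  {u | u ∈ weightedSobolev 1 (-s) ∧ SolvesZeroEnergy A V u}

/-- The generalized null space of `H = (P - A)² + V`: the zero-energy solutions in
`H^{1,-1/2-0} = ⋂_{r < -1/2} H^{1,r}`. -/
def nullSpace (A : E3 → E3) (V : E3 → ℝ) : Set 𝓢'(E3, ℂ) :=
  {u | (∀ r : ℝ, r < -(1 / 2) → u ∈ weightedSobolev 1 r) ∧ SolvesZeroEnergy A V u}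

end MagneticSchrodinger

end

/-! Uniqueness rests on subharmonicity. For `Hu = 0` with `V ≥ 0` one has, weakly, `Δ|u|² =
2|(P-A)u|² + 2V|u|² ≥ 0`: the potential `A` is real, so it drops out of the real part of the cross
terms. In dimension three `⟨x⟩⁻¹` is strictly superharmonic, `Δ⟨x⟩⁻¹ = -3⟨x⟩⁻⁵`. Testing the
subharmonic density with cutoffs of `⟨x⟩⁻¹` and removing the cutoff gives `0 ≤ -3 ∫ ⟨x⟩⁻⁵|u|²`,
hence `u = 0`. The Laplacians of the cutoffs are `O(⟨x⟩⁻³)` uniformly, and `⟨x⟩⁻³|u|²` is integrable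
for `u` in `H^{1,-s}` once `s ≤ 3/2`. This is `integral_lap_mul_nonneg`, `exists_cutoff` and
`eq_zero_of_solvesZeroEnergy`.

The kernel of `M₀` reduces to this. If `M₀ f = 0`, then `u = G₀ w* f` satisfies `f = -𝒰 w u` (since
`𝒰² = 1`) and `-Δu = w* f = -w* 𝒰 w u`, where `w* 𝒰 w = V + A² - (A·P + P·A)`. So `Hu = 0`. Moreover
`u` lies in `H^{1,-1}` whatever `β` is, so `u = 0` and then `f = -𝒰 w u = 0`; see
`solvesZeroEnergy_stateD` and `eq_zero_of_mZero_eq_zero`.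

To construct `M₀`, the Green operator is factored on the Fourier side as `(-Δ)^{-1/2} (-Δ)^{-1/2}`.
Hardy's inequality, applied in momentum space, makes `(-Δ)^{-1/2} ⟨x⟩^{-s}` bounded on `L²` for `s ≥
1` (`memLp_rootSymbol_mul`), and the symbols of `P_j (-Δ)^{-1/2}` are bounded. The link with the
kernel `1/(4π|x-y|)` is the time integral of the heat semigroup (`integral_newtonPotential_mul`).

The spaces `H^{±1,s}` are handled through the `L²` boundedness of `⟨x⟩^s (1-Δ)^{-1/2} ⟨x⟩^{-s}` and
of the same operator with a factor `P_j`. Both are superpositions of heat kernels, and conjugation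
by the weight perturbs them by an operator dominated by convolution with an integrable function
(`KernelRep.isL2Bounded_conjWeight`).

The vector potential is an average, over base points `a` in the unit ball, of the radial gauge that
integrates `B` along the ray from `x` to infinity pointing away from `a`. A single base point would
create a singularity at `a`; the average is `C¹`. Its curl is `B` because, at each fixed time on the
rays, the error is the divergence of a compactly supported field (`curl_rayPotential`). -/

noncomputable section

namespace MagneticSchrodinger

open FourierTransform Set

/-! ## Young's inequality and weights -/

/-- Young's inequality `L¹ * L² ⊆ L²` for nonnegative functions. -/
theorem lintegral_conv_sq_le (k g : E3 → ENNReal) (hk : Measurable k) (hg : Measurable g) :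
    ∫⁻ x, (∫⁻ y, k (x - y) * g y) ^ 2 ≤ (∫⁻ z, k z) ^ 2 * ∫⁻ y, g y ^ 2 := by
  have hkm : ∀ x : E3, Measurable fun y => k (x - y) := fun x => by fun_prop
  have h1 : ∀ x : E3, (∫⁻ y, k (x - y) * g y) ^ 2 ≤
      (∫⁻ z, k z) * ∫⁻ y, k (x - y) * g y ^ 2 := by
    intro x
    have hpq : (2 : ℝ).HolderConjugate 2 := Real.HolderConjugate.two_two
    -- Cauchy–Schwarz with the kernel split as `k = k^{1/2} · k^{1/2}`, so that `g` carries only one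
    -- of the two halves.
    have h := ENNReal.lintegral_mul_le_Lp_mul_Lq (μ := (volume : Measure E3)) hpq
      (f := fun y => k (x - y) ^ (1 / 2 : ℝ)) (g := fun y => k (x - y) ^ (1 / 2 : ℝ) * g y)
      ((hkm x).pow_const _).aemeasurable (((hkm x).pow_const _).mul hg).aemeasurable
    have e1 : ∀ y, k (x - y) ^ (1 / 2 : ℝ) * (k (x - y) ^ (1 / 2 : ℝ) * g y) = k (x - y) * g y := by
      intro y
      rw [← mul_assoc, ← ENNReal.rpow_add_of_nonneg _ _ (by norm_num) (by norm_num)]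
      norm_num
    have e2 : ∀ y, (k (x - y) ^ (1 / 2 : ℝ)) ^ (2 : ℝ) = k (x - y) := by
      intro y
      rw [← ENNReal.rpow_mul]; norm_num
    have e3 : ∀ y, (k (x - y) ^ (1 / 2 : ℝ) * g y) ^ (2 : ℝ) = k (x - y) * g y ^ 2 := by
      intro y
      rw [ENNReal.mul_rpow_of_nonneg _ _ (by norm_num), e2]; norm_num
    simp only [Pi.mul_apply, e1, e2, e3] at h
    calc (∫⁻ y, k (x - y) * g y) ^ 2 ≤ ((∫⁻ y, k (x - y)) ^ (1 / 2 : ℝ) *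
          (∫⁻ y, k (x - y) * g y ^ 2) ^ (1 / 2 : ℝ)) ^ 2 := by gcongr
      _ = (∫⁻ y, k (x - y)) * ∫⁻ y, k (x - y) * g y ^ 2 := by
          rw [mul_pow, ← ENNReal.rpow_natCast, ← ENNReal.rpow_natCast, ← ENNReal.rpow_mul,
            ← ENNReal.rpow_mul]
          norm_num
      _ = _ := by rw [lintegral_sub_left_eq_self (fun z => k z)]
  calc ∫⁻ x, (∫⁻ y, k (x - y) * g y) ^ 2
      ≤ ∫⁻ x, (∫⁻ z, k z) * ∫⁻ y, k (x - y) * g y ^ 2 := lintegral_mono h1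
    _ = (∫⁻ z, k z) * ∫⁻ x, ∫⁻ y, k (x - y) * g y ^ 2 := by
        rw [lintegral_const_mul]
        exact Measurable.lintegral_prod_right' (f := fun p : E3 × E3 => k (p.1 - p.2) * g p.2 ^ 2)
          (by fun_prop)
    _ = (∫⁻ z, k z) * ∫⁻ y, ∫⁻ x, k (x - y) * g y ^ 2 := by
        rw [lintegral_lintegral_swap]
        exact Measurable.aemeasurable (by fun_prop)
    _ = (∫⁻ z, k z) * ∫⁻ y, (∫⁻ z, k z) * g y ^ 2 := by
        congr 2; ext y
        rw [lintegral_mul_const _ (by fun_prop), lintegral_sub_right_eq_self (fun z => k z)]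
    _ = _ := by
        rw [lintegral_const_mul _ (by fun_prop), sq, mul_assoc]

theorem one_le_bracket (x : E3) : 1 ≤ bracket x := by
  rw [bracket, Real.one_le_sqrt]
  nlinarith [sq_nonneg ‖x‖]

theorem bracket_pos (x : E3) : 0 < bracket x := lt_of_lt_of_le one_pos (one_le_bracket x)

theorem norm_le_bracket (x : E3) : ‖x‖ ≤ bracket x :=
  Real.le_sqrt_of_sq_le (by linarith)

theorem bracket_sq (x : E3) : bracket x ^ 2 = 1 + ‖x‖ ^ 2 :=
  Real.sq_sqrt (by positivity)

theorem bracket_sub_le (x y : E3) : bracket x ≤ bracket y + ‖x - y‖ := by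
  have h := norm_le_bracket y
  have h2 : ‖x‖ ≤ ‖y‖ + ‖x - y‖ := by
    have := norm_add_le y (x - y); simpa using this
  refine Real.sqrt_le_iff.2 ⟨by have := bracket_pos y; positivity, ?_⟩
  have h3 : ‖x‖ ^ 2 ≤ (‖y‖ + ‖x - y‖) ^ 2 := by gcongr
  nlinarith [bracket_sq y, norm_nonneg (x - y), norm_nonneg y]

/-- Peetre's inequality in logarithmic form. The absolute value covers both signs of the exponent
when a power of the ratio is written as an exponential. -/
theorem abs_log_bracket_div (x y : E3) :
    |Real.log (bracket x / bracket y)| ≤ Real.log (1 + ‖x - y‖) := by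
  have key : ∀ a b : E3, Real.log (bracket a / bracket b) ≤ Real.log (1 + ‖a - b‖) := by
    intro a b
    apply Real.log_le_log (div_pos (bracket_pos a) (bracket_pos b))
    rw [div_le_iff₀ (bracket_pos b)]
    have := bracket_sub_le a b
    nlinarith [one_le_bracket b, norm_nonneg (a - b)]
  rw [abs_le]
  refine ⟨?_, key x y⟩
  have := key y x
  rw [norm_sub_rev, ← inv_div, Real.log_inv] at this
  linarith

theorem abs_exp_sub_one_le_mul_exp (u : ℝ) : |Real.exp u - 1| ≤ |u| * Real.exp |u| := by
  rcases le_total 0 u with h | h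
  · rw [abs_of_nonneg h, abs_of_nonneg (by linarith [Real.one_le_exp h])]
    have := Real.one_sub_le_exp_neg u
    rw [Real.exp_neg] at this
    have h2 := Real.exp_pos u
    have h3 : (1 - u) * Real.exp u ≤ 1 := by
      calc (1 - u) * Real.exp u ≤ (Real.exp u)⁻¹ * Real.exp u := by gcongr
        _ = 1 := inv_mul_cancel₀ h2.ne'
    linarith
  · rw [abs_of_nonpos h, abs_of_nonpos (by linarith [Real.exp_le_one_iff.2 h])]
    have h1 := Real.add_one_le_exp u
    have h2 := Real.one_le_exp (neg_nonneg.2 h)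
    nlinarith

/-- The commutator of the weight `⟨x⟩^s` with a convolution gains a factor `|x - y|`. -/
theorem abs_weight_ratio_sub_one_le (s : ℝ) (x y : E3) :
    |bracket x ^ s * bracket y ^ (-s) - 1| ≤
      |s| * ‖x - y‖ * (1 + ‖x - y‖) ^ ⌈|s|⌉₊ := by
  have hx := bracket_pos x
  have hy := bracket_pos y
  have e : bracket x ^ s * bracket y ^ (-s) = Real.exp (s * Real.log (bracket x / bracket y)) := by
    rw [Real.rpow_neg hy.le, ← div_eq_mul_inv, ← Real.div_rpow hx.le hy.le,
      Real.rpow_def_of_pos (div_pos hx hy), mul_comm]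
  have hl := abs_log_bracket_div x y
  have hd : 0 ≤ ‖x - y‖ := norm_nonneg _
  have hl2 : Real.log (1 + ‖x - y‖) ≤ ‖x - y‖ := by
    have := Real.log_le_sub_one_of_pos (show 0 < 1 + ‖x - y‖ by positivity)
    linarith
  rw [e]
  refine (abs_exp_sub_one_le_mul_exp _).trans ?_
  rw [abs_mul]
  have h1 : |s| * |Real.log (bracket x / bracket y)| ≤ |s| * ‖x - y‖ := by
    gcongr; linarith
  have h2 : Real.exp (|s| * |Real.log (bracket x / bracket y)|) ≤ (1 + ‖x - y‖) ^ ⌈|s|⌉₊ := by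
    calc Real.exp (|s| * |Real.log (bracket x / bracket y)|)
        ≤ Real.exp (⌈|s|⌉₊ * Real.log (1 + ‖x - y‖)) := by
          gcongr
          exact Nat.le_ceil _
      _ = _ := by
          rw [mul_comm, Real.exp_mul, Real.exp_log (by positivity), Real.rpow_natCast]
  gcongr

theorem continuous_bracket : Continuous bracket := by
  unfold bracket; fun_prop

theorem weight_mul_weight_neg (s : ℝ) (x : E3) : weight s x * weight (-s) x = 1 := by
  rw [weight, weight, ← Complex.ofReal_mul, ← Real.rpow_add (bracket_pos x)]
  simp

theorem weight_mul (s r : ℝ) : weight s * weight r = weight (s + r) := by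
  funext x
  rw [Pi.mul_apply, weight, weight, weight, ← Complex.ofReal_mul, ← Real.rpow_add (bracket_pos x)]

/-! ## Operators given by integrals of convolutions -/

/-- A family of convolution kernels, indexed by `t > 0`, that represents an operator on Schwartz
functions. -/
structure KernelRep (X : 𝓢(E3, ℂ) →L[ℂ] 𝓢(E3, ℂ)) (a : ℝ → E3 → ℂ) : Prop where
  measurable : Measurable (Function.uncurry a)
  integrable_space : ∀ t > 0, ∀ (φ : 𝓢(E3, ℂ)) x, Integrable fun y => a t (x - y) * φ y
  integrable_time : ∀ (φ : 𝓢(E3, ℂ)) x, IntegrableOn (fun t => ∫ y, a t (x - y) * φ y) (Ioi 0)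
  eq_integral : ∀ (φ : 𝓢(E3, ℂ)) x, X φ x = ∫ t in Ioi 0, ∫ y, a t (x - y) * φ y
  -- Every moment carries at least one factor `‖z‖`, the gain from the commutator with the weight.
  -- For `P_j (1 - Δ)^{-1/2}` it is indispensable: the kernel behaves like `|z|⁻³` at the origin.
  moments : ∀ n : ℕ, ∫⁻ t in Ioi 0, ∫⁻ z, ‖a t z‖ₑ * ENNReal.ofReal (‖z‖ * (1 + ‖z‖) ^ n) < ⊤

/-- The operator `⟨x⟩^s X ⟨x⟩^{-s}`. -/
def conjWeight (s : ℝ) (X : 𝓢(E3, ℂ) →L[ℂ] 𝓢(E3, ℂ)) : 𝓢(E3, ℂ) →L[ℂ] 𝓢(E3, ℂ) :=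
  (SchwartzMap.smulLeftCLM ℂ (weight s)) ∘L X ∘L (SchwartzMap.smulLeftCLM ℂ (weight (-s)))

theorem conjWeight_apply (s : ℝ) (X : 𝓢(E3, ℂ) →L[ℂ] 𝓢(E3, ℂ)) (φ : 𝓢(E3, ℂ)) (x : E3) :
    conjWeight s X φ x =
      weight s x * X (SchwartzMap.smulLeftCLM ℂ (weight (-s)) φ) x := by
  simp [conjWeight, SchwartzMap.smulLeftCLM_apply_apply (weight_hasTemperateGrowth s)]

/-- Conjugation multiplies the kernel by `⟨x⟩^s ⟨y⟩^{-s}`. Only the difference of the two operators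
is estimated in absolute value, because the unconjugated kernel need not be absolutely integrable in
time and space together. -/
theorem enorm_conjWeight_sub_le {X : 𝓢(E3, ℂ) →L[ℂ] 𝓢(E3, ℂ)} {a : ℝ → E3 → ℂ}
    (h : KernelRep X a) (s : ℝ) (φ : 𝓢(E3, ℂ)) (x : E3) :
    ‖conjWeight s X φ x - X φ x‖ₑ ≤
      ∫⁻ y, (∫⁻ t in Ioi 0, ‖a t (x - y)‖ₑ *
        ENNReal.ofReal (|s| * (‖x - y‖ * (1 + ‖x - y‖) ^ ⌈|s|⌉₊))) * ‖φ y‖ₑ := by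
  set ψ := SchwartzMap.smulLeftCLM ℂ (weight (-s)) φ with hψ
  have hψy : ∀ y, ψ y = weight (-s) y * φ y := fun y => by
    simp [hψ, SchwartzMap.smulLeftCLM_apply_apply (weight_hasTemperateGrowth (-s))]
  have hm := h.measurable
  have e : conjWeight s X φ x - X φ x =
      ∫ t in Ioi 0, ∫ y, (weight s x * weight (-s) y - 1) * (a t (x - y) * φ y) := by
    rw [conjWeight_apply, h.eq_integral, h.eq_integral, ← integral_const_mul,
      ← integral_sub ((h.integrable_time ψ x).const_mul _) (h.integrable_time φ x)]
    refine setIntegral_congr_fun measurableSet_Ioi fun t ht => ?_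
    rw [← integral_const_mul,
      ← integral_sub ((h.integrable_space t ht ψ x).const_mul _) (h.integrable_space t ht φ x)]
    congr 1; ext y
    rw [hψy]; ring
  rw [e]
  calc _ ≤ ∫⁻ t in Ioi 0, ∫⁻ y, ‖(weight s x * weight (-s) y - 1) * (a t (x - y) * φ y)‖ₑ := by
        refine (enorm_integral_le_lintegral_enorm _).trans (lintegral_mono fun t => ?_)
        exact enorm_integral_le_lintegral_enorm _
    _ ≤ ∫⁻ t in Ioi 0, ∫⁻ y, ‖a t (x - y)‖ₑ *
        ENNReal.ofReal (|s| * (‖x - y‖ * (1 + ‖x - y‖) ^ ⌈|s|⌉₊)) * ‖φ y‖ₑ := by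
        refine lintegral_mono fun t => lintegral_mono fun y => ?_
        rw [enorm_mul, enorm_mul, ← mul_assoc, mul_comm ‖_ - 1‖ₑ]
        gcongr
        rw [← ofReal_norm]
        apply ENNReal.ofReal_le_ofReal
        have := abs_weight_ratio_sub_one_le s x y
        rw [weight, weight, ← mul_assoc]
        rw [← Complex.ofReal_mul, ← Complex.ofReal_one, ← Complex.ofReal_sub, Complex.norm_real]
        exact this
    _ = _ := by
        rw [lintegral_lintegral_swap]
        · refine lintegral_congr fun y => ?_
          rw [lintegral_mul_const]
          have : Measurable fun t => a t (x - y) := hm.comp (by fun_prop : Measurable fun t => (t, x - y))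
          fun_prop
        · have : Measurable fun p : ℝ × E3 => a p.1 (x - p.2) :=
            hm.comp (by fun_prop : Measurable fun p : ℝ × E3 => (p.1, x - p.2))
          have h2 : Measurable φ := φ.continuous.measurable
          apply Measurable.aemeasurable
          fun_prop

/-- A Schwartz operator bounded in `L²`. -/
def IsL2Bounded (X : 𝓢(E3, ℂ) →L[ℂ] 𝓢(E3, ℂ)) : Prop :=
  ∃ C : ℝ, ∀ φ : 𝓢(E3, ℂ), ‖(X φ).toLp 2 volume‖ ≤ C * ‖φ.toLp 2 volume‖

theorem eLpNorm_two_sq (f : E3 → ℂ) : eLpNorm f 2 volume ^ 2 = ∫⁻ x, ‖f x‖ₑ ^ 2 := by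
  have := eLpNorm_nnreal_pow_eq_lintegral (f := f) (p := 2) (μ := (volume : Measure E3)) (by norm_num)
  simpa using this

/-- The difference from `X` is dominated by convolution with a positive function `k`, whose integral
is finite by the moment condition. Young's inequality bounds the difference, and `X` itself is
bounded by assumption. -/
theorem KernelRep.isL2Bounded_conjWeight {X : 𝓢(E3, ℂ) →L[ℂ] 𝓢(E3, ℂ)} {a : ℝ → E3 → ℂ}
    (h : KernelRep X a) (hX : IsL2Bounded X) (s : ℝ) : IsL2Bounded (conjWeight s X) := by
  obtain ⟨C, hC⟩ := hX
  set k : E3 → ENNReal := fun z => ∫⁻ t in Ioi 0, ‖a t z‖ₑ *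
    ENNReal.ofReal (|s| * (‖z‖ * (1 + ‖z‖) ^ ⌈|s|⌉₊)) with hk
  have hkm : Measurable k := by
    apply Measurable.lintegral_prod_left' (f := fun p : ℝ × E3 => ‖a p.1 p.2‖ₑ *
      ENNReal.ofReal (|s| * (‖p.2‖ * (1 + ‖p.2‖) ^ ⌈|s|⌉₊)))
    have : Measurable fun p : ℝ × E3 => a p.1 p.2 := h.measurable
    fun_prop
  have hkfin : ∫⁻ z, k z < ⊤ := by
    have hm : Measurable fun p : E3 × ℝ => a p.2 p.1 :=
      h.measurable.comp (by fun_prop : Measurable fun p : E3 × ℝ => (p.2, p.1))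
    rw [hk, lintegral_lintegral_swap]
    · have : ∀ t z, ‖a t z‖ₑ * ENNReal.ofReal (|s| * (‖z‖ * (1 + ‖z‖) ^ ⌈|s|⌉₊)) =
        ENNReal.ofReal |s| * (‖a t z‖ₑ * ENNReal.ofReal (‖z‖ * (1 + ‖z‖) ^ ⌈|s|⌉₊)) := by
        intro t z
        rw [ENNReal.ofReal_mul (abs_nonneg s)]; ring
      simp_rw [this]
      simp_rw [lintegral_const_mul' _ _ ENNReal.ofReal_ne_top]
      exact ENNReal.mul_lt_top ENNReal.ofReal_lt_top (h.moments _)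
    · apply Measurable.aemeasurable
      have h2 : Measurable fun p : E3 × ℝ =>
          ENNReal.ofReal (|s| * (‖p.1‖ * (1 + ‖p.1‖) ^ ⌈|s|⌉₊)) := by fun_prop
      exact hm.enorm.mul h2
  refine ⟨(∫⁻ z, k z).toReal + C, fun φ => ?_⟩
  have h1 : eLpNorm (conjWeight s X φ - X φ) 2 volume ≤ (∫⁻ z, k z) * eLpNorm φ 2 volume := by
    rw [← ENNReal.pow_le_pow_left_iff two_ne_zero, mul_pow, eLpNorm_two_sq, eLpNorm_two_sq]
    refine le_trans (lintegral_mono fun x => ?_) (lintegral_conv_sq_le k (fun y => ‖φ y‖ₑ) hkm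
      φ.continuous.measurable.enorm)
    have := enorm_conjWeight_sub_le h s φ x
    change ‖conjWeight s X φ x - X φ x‖ₑ ^ 2 ≤ _
    gcongr
  have h2 : ‖(conjWeight s X φ).toLp 2 volume - (X φ).toLp 2 volume‖ ≤
      (∫⁻ z, k z).toReal * ‖φ.toLp 2 volume‖ := by
    have e : (conjWeight s X φ).toLp 2 volume - (X φ).toLp 2 volume =
        (conjWeight s X φ - X φ).toLp 2 volume :=
      (map_sub (SchwartzMap.toLpCLM ℂ ℂ 2 volume) _ _).symm
    rw [e, SchwartzMap.norm_toLp, SchwartzMap.norm_toLp, ← ENNReal.toReal_mul]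
    have hφ : eLpNorm φ 2 volume ≠ ⊤ := (φ.memLp 2 volume).2.ne
    exact ENNReal.toReal_mono (ENNReal.mul_ne_top hkfin.ne hφ) h1
  have h3 := hC φ
  have h4 := norm_le_insert' ((conjWeight s X φ).toLp 2 volume) ((X φ).toLp 2 volume)
  linarith

end MagneticSchrodinger
end

noncomputable section

namespace MagneticSchrodinger

open FourierTransform Set

/-! ## The heat kernel -/

/-- The heat kernel `(4πt)^{-3/2} exp (-|z|²/(4t))`. -/
def heatKernel (t : ℝ) (z : E3) : ℝ :=
  (4 * Real.pi * t) ^ (-(3 / 2) : ℝ) * Real.exp (-(‖z‖ ^ 2 / (4 * t)))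

theorem heatKernel_nonneg {t : ℝ} (ht : 0 < t) (z : E3) : 0 ≤ heatKernel t z := by
  unfold heatKernel; positivity

theorem measurable_heatKernel : Measurable (Function.uncurry heatKernel) := by
  unfold heatKernel Function.uncurry
  fun_prop

theorem continuous_heatKernel (t : ℝ) : Continuous (heatKernel t) := by
  unfold heatKernel
  fun_prop

theorem integrable_exp_neg_mul_sq {b : ℝ} (hb : 0 < b) :
    Integrable fun z : E3 => Real.exp (-(b * ‖z‖ ^ 2)) := by
  have := GaussianFourier.integrable_cexp_neg_mul_sq_norm_add (V := E3) (b := (b : ℂ))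
    (by simpa using hb) 0 0
  have h2 := this.norm
  refine h2.congr (ae_of_all _ fun z => ?_)
  simp only [zero_mul, add_zero, Complex.norm_exp]
  congr 1
  rw [← Complex.ofReal_pow, ← Complex.ofReal_neg, ← Complex.ofReal_mul, Complex.ofReal_re]; ring

theorem heatKernel_eq {t : ℝ} (z : E3) :
    heatKernel t z = (4 * Real.pi * t) ^ (-(3 / 2) : ℝ) * Real.exp (-((1 / (4 * t)) * ‖z‖ ^ 2)) := by
  unfold heatKernel
  congr 2; ring

theorem integrable_heatKernel {t : ℝ} (ht : 0 < t) : Integrable (heatKernel t) := by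
  have := (integrable_exp_neg_mul_sq (b := 1 / (4 * t)) (by positivity)).const_mul
    ((4 * Real.pi * t) ^ (-(3 / 2) : ℝ))
  exact this.congr (ae_of_all _ fun z => (heatKernel_eq z).symm)

theorem integral_heatKernel {t : ℝ} (ht : 0 < t) : ∫ z, heatKernel t z = 1 := by
  simp_rw [heatKernel_eq, integral_const_mul]
  have := GaussianFourier.integral_rexp_neg_mul_sq_norm (V := E3) (b := 1 / (4 * t)) (by positivity)
  simp only [neg_mul] at this
  rw [this, finrank_euclideanSpace_fin]
  have e : Real.pi / (1 / (4 * t)) = 4 * Real.pi * t := by field_simp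
  rw [e, ← Real.rpow_add (by positivity)]
  norm_num

theorem lintegral_heatKernel {t : ℝ} (ht : 0 < t) : ∫⁻ z, ENNReal.ofReal (heatKernel t z) = 1 := by
  rw [← ofReal_integral_eq_lintegral_ofReal (integrable_heatKernel ht)
    (ae_of_all _ (heatKernel_nonneg ht)), integral_heatKernel ht, ENNReal.ofReal_one]

theorem add_one_pow_mul_exp_neg_le {r : ℝ} (hr : 0 ≤ r) (m : ℕ) :
    (1 + r) ^ m * Real.exp (-r) ≤ m.factorial * Real.exp 1 := by
  have h := Real.pow_div_factorial_le_exp (x := 1 + r) (by positivity) m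
  rw [div_le_iff₀ (by positivity), Real.exp_add] at h
  have h2 : Real.exp r * Real.exp (-r) = 1 := by rw [← Real.exp_add]; simp
  calc (1 + r) ^ m * Real.exp (-r) ≤ (Real.exp 1 * Real.exp r * m.factorial) * Real.exp (-r) := by
        gcongr
    _ = m.factorial * Real.exp 1 * (Real.exp r * Real.exp (-r)) := by ring
    _ = _ := by rw [h2, mul_one]

/-- Polynomial factors are absorbed by doubling the time in the heat kernel. -/
theorem heatKernel_mul_pow_le {t : ℝ} (ht : 0 < t) (z : E3) (m : ℕ) :
    heatKernel t z * (1 + ‖z‖ ^ 2 / (8 * t)) ^ m ≤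
      2 ^ (3 / 2 : ℝ) * (m.factorial * Real.exp 1) * heatKernel (2 * t) z := by
  have h := add_one_pow_mul_exp_neg_le (r := ‖z‖ ^ 2 / (8 * t)) (by positivity) m
  have e1 : heatKernel t z = 2 ^ (3 / 2 : ℝ) * heatKernel (2 * t) z *
      Real.exp (-(‖z‖ ^ 2 / (8 * t))) := by
    unfold heatKernel
    have a1 : (4 * Real.pi * (2 * t)) = 2 * (4 * Real.pi * t) := by ring
    rw [a1, Real.mul_rpow (x := 2) (y := 4 * Real.pi * t) (by norm_num) (by positivity)]
    have a2 : (2 : ℝ) ^ (3 / 2 : ℝ) * 2 ^ (-(3 / 2) : ℝ) = 1 := by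
      rw [← Real.rpow_add (by norm_num)]; norm_num
    have a3 : Real.exp (-(‖z‖ ^ 2 / (4 * t))) =
        Real.exp (-(‖z‖ ^ 2 / (4 * (2 * t)))) * Real.exp (-(‖z‖ ^ 2 / (8 * t))) := by
      rw [← Real.exp_add]; congr 1; field_simp; ring
    rw [a3]
    linear_combination (-(4 * Real.pi * t) ^ (-(3 / 2) : ℝ) *
      Real.exp (-(‖z‖ ^ 2 / (4 * (2 * t)))) * Real.exp (-(‖z‖ ^ 2 / (8 * t)))) * a2
  have h0 := heatKernel_nonneg (t := 2 * t) (by positivity) z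
  calc heatKernel t z * (1 + ‖z‖ ^ 2 / (8 * t)) ^ m
      = 2 ^ (3 / 2 : ℝ) * heatKernel (2 * t) z *
        ((1 + ‖z‖ ^ 2 / (8 * t)) ^ m * Real.exp (-(‖z‖ ^ 2 / (8 * t)))) := by rw [e1]; ring
    _ ≤ 2 ^ (3 / 2 : ℝ) * heatKernel (2 * t) z * (m.factorial * Real.exp 1) := by gcongr
    _ = _ := by ring

/-- The heat semigroup on the Fourier side. -/
theorem integral_heatKernel_mul {t : ℝ} (ht : 0 < t) (φ : 𝓢(E3, ℂ)) (x : E3) :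
    ∫ y, (heatKernel t (x - y) : ℂ) * φ y =
      ∫ ξ, Complex.exp (-((4 * Real.pi ^ 2 * t : ℝ) : ℂ) * ‖ξ‖ ^ 2 +
        2 * Real.pi * Complex.I * (inner ℝ x ξ : ℝ)) * 𝓕 φ ξ := by
  have hb : 0 < (((4 * Real.pi ^ 2 * t : ℝ) : ℂ)).re := by
    rw [Complex.ofReal_re]; positivity
  have J := GaussianFourier.integrable_cexp_neg_mul_sq_norm_add (V := E3) hb
    (2 * Real.pi * Complex.I) x
  -- The multiplication formula for the Fourier transform, used with a Gaussian modulated by `e^{2πi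
  -- x·ξ}`: its transform is the heat kernel centred at `x`.
  have h := VectorFourier.integral_fourierIntegral_smul_eq_flip (L := innerₗ E3)
      Real.continuous_fourierChar continuous_inner J (φ.integrable (μ := volume))
  have e1 : ∀ w : E3, VectorFourier.fourierIntegral Real.fourierChar volume (innerₗ E3)
      (fun v => Complex.exp (-((4 * Real.pi ^ 2 * t : ℝ) : ℂ) * ‖v‖ ^ 2 +
        2 * Real.pi * Complex.I * (inner ℝ x v : ℝ))) w = (heatKernel t (x - w) : ℂ) := by
    intro w
    have := fourier_gaussian_innerProductSpace' hb x w
    rw [show VectorFourier.fourierIntegral Real.fourierChar volume (innerₗ E3)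
      (fun v => Complex.exp (-((4 * Real.pi ^ 2 * t : ℝ) : ℂ) * ‖v‖ ^ 2 +
        2 * Real.pi * Complex.I * (inner ℝ x v : ℝ))) w = 𝓕 (fun v : E3 =>
          Complex.exp (-((4 * Real.pi ^ 2 * t : ℝ) : ℂ) * ‖v‖ ^ 2 +
        2 * Real.pi * Complex.I * (inner ℝ x v : ℝ))) w from rfl, this, heatKernel,
      finrank_euclideanSpace_fin]
    have hpi := Real.pi_pos
    have e : ((Real.pi : ℂ) / ((4 * Real.pi ^ 2 * t : ℝ) : ℂ)) = (((4 * Real.pi * t)⁻¹ : ℝ) : ℂ) := by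
      rw [← Complex.ofReal_div]
      congr 1; field_simp
    rw [e, Complex.ofReal_mul ((4 * Real.pi * t) ^ (-(3 / 2) : ℝ)),
      Complex.ofReal_cpow (x := 4 * Real.pi * t) (by positivity), Complex.ofReal_exp]
    congr 1
    · rw [Complex.ofReal_inv, Complex.inv_cpow]
      · rw [← Complex.cpow_neg]; push_cast; rfl
      · rw [Complex.arg_ofReal_of_nonneg (by positivity)]; exact hpi.ne
    · congr 1
      push_cast
      have : (Real.pi : ℂ) ≠ 0 := by exact_mod_cast hpi.ne'
      have : (t : ℂ) ≠ 0 := by exact_mod_cast ht.ne'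
      field_simp
  simp only [smul_eq_mul, e1] at h
  rw [h]
  simp only [flip_innerₗ]
  rfl

/-! ## The kernels of `(1 - Δ)^{-1/2}` and `P_j (1 - Δ)^{-1/2}` -/

/-- The operator `(1 - Δ)^{-1/2}` on Schwartz functions. -/
def besselS : 𝓢(E3, ℂ) →L[ℂ] 𝓢(E3, ℂ) := SchwartzMap.fourierMultiplierCLM ℂ (besselSymbol (-1))

/-- The momentum operator on Schwartz functions. -/
def momentumS (j : Fin 3) : 𝓢(E3, ℂ) →L[ℂ] 𝓢(E3, ℂ) :=
  (-Complex.I) • LineDeriv.lineDerivOpCLM ℂ 𝓢(E3, ℂ) (basisVec j)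

theorem momentumS_apply (j : Fin 3) (φ : 𝓢(E3, ℂ)) (x : E3) :
    momentumS j φ x = -Complex.I * fderiv ℝ φ x (basisVec j) := by
  simp [momentumS, SchwartzMap.lineDerivOp_apply_eq_fderiv]

/-- The density in `t` of the kernel of `(1 - Δ)^{-1/2}`. -/
def besselDensity (t : ℝ) : ℝ := Real.pi ^ (-(1 / 2) : ℝ) * (t ^ (-(1 / 2) : ℝ) * Real.exp (-t))

theorem besselDensity_nonneg {t : ℝ} (ht : 0 < t) : 0 ≤ besselDensity t := by
  unfold besselDensity; positivity

theorem measurable_besselDensity : Measurable besselDensity := by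
  unfold besselDensity; fun_prop

theorem integrableOn_rpow_mul_exp {r : ℝ} (hr : 0 < r) :
    IntegrableOn (fun t : ℝ => t ^ (-(1 / 2) : ℝ) * Real.exp (-(r * t))) (Ioi 0) := by
  have h : ∫ t in Ioi (0 : ℝ), t ^ (-(1 / 2) : ℝ) * Real.exp (-(r * t)) ≠ 0 := by
    have := Real.integral_rpow_mul_exp_neg_mul_Ioi (a := 1 / 2) (r := r) (by norm_num) hr
    rw [show (1 / 2 - 1 : ℝ) = -(1 / 2) by norm_num] at this
    rw [this]
    have := Real.Gamma_pos_of_pos (s := 1 / 2) (by norm_num)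
    positivity
  -- The Bochner integral of a non-integrable function is `0`, so the positive value of the Gamma
  -- integral already forces integrability.
  by_contra hc
  exact h (integral_undef hc)

theorem integrableOn_besselDensity : IntegrableOn besselDensity (Ioi 0) := by
  have := (integrableOn_rpow_mul_exp one_pos).const_mul (Real.pi ^ (-(1 / 2) : ℝ))
  exact IntegrableOn.congr_fun this (fun t _ => by simp [besselDensity]) measurableSet_Ioi

/-- Subordination by the Gamma integral. With `a = |2πξ|²` it exhibits `(1 - Δ)^{-1/2}` as a
superposition of heat operators with density `besselDensity`. -/
theorem integral_besselDensity_mul_exp {a : ℝ} (ha : 0 ≤ a) :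
    ∫ t in Ioi 0, besselDensity t * Real.exp (-(a * t)) = (1 + a) ^ (-(1 / 2) : ℝ) := by
  have := Real.integral_rpow_mul_exp_neg_mul_Ioi (a := 1 / 2) (r := 1 + a) (by norm_num)
    (by positivity)
  rw [show (1 / 2 - 1 : ℝ) = -(1 / 2) by norm_num, Real.Gamma_one_half_eq] at this
  have e : ∀ t, besselDensity t * Real.exp (-(a * t)) =
      Real.pi ^ (-(1 / 2) : ℝ) * (t ^ (-(1 / 2) : ℝ) * Real.exp (-((1 + a) * t))) := by
    intro t
    rw [besselDensity, show -((1 + a) * t) = -t + -(a * t) by ring, Real.exp_add]; ring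
  simp_rw [e, integral_const_mul, this]
  rw [Real.sqrt_eq_rpow, one_div (1 + a), Real.inv_rpow (by positivity), ← Real.rpow_neg (by positivity)]
  have : Real.pi ^ (-(1 / 2) : ℝ) * Real.pi ^ (1 / 2 : ℝ) = 1 := by
    rw [← Real.rpow_add Real.pi_pos]; norm_num
  linear_combination ((1 + a) ^ (-(1 / 2) : ℝ)) * this

/-- The kernel of `(1 - Δ)^{-1/2}` at time `t`. -/
def besselKernel (t : ℝ) (z : E3) : ℂ := ((besselDensity t * heatKernel t z : ℝ) : ℂ)

/-- The kernel of `P_j (1 - Δ)^{-1/2}` at time `t`. -/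
def momentumKernel (j : Fin 3) (t : ℝ) (z : E3) : ℂ :=
  Complex.I * ((z j / (2 * t) : ℝ) : ℂ) * besselKernel t z

theorem besselS_apply (φ : 𝓢(E3, ℂ)) (x : E3) :
    besselS φ x = ∫ ξ, Complex.exp (2 * Real.pi * Complex.I * (inner ℝ x ξ : ℝ)) *
      (((1 + 4 * Real.pi ^ 2 * ‖ξ‖ ^ 2) ^ (-(1 / 2) : ℝ) : ℝ) : ℂ) * 𝓕 φ ξ := by
  rw [besselS, SchwartzMap.fourierMultiplierCLM_apply, SchwartzMap.fourierInv_coe,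
    Real.fourierInv_eq']
  congr 1; ext ξ
  rw [SchwartzMap.smulLeftCLM_apply_apply (besselSymbol_hasTemperateGrowth _), smul_eq_mul,
    smul_eq_mul, ← mul_assoc, besselSymbol, real_inner_comm]
  congr 2
  · congr 1; push_cast; ring
  · congr 2
    · rw [norm_smul]; simp [abs_of_pos Real.pi_pos]; ring
    · norm_num

theorem besselDensity_mul_integral {t : ℝ} (ht : 0 < t) (φ : 𝓢(E3, ℂ)) (x : E3) :
    ∫ y, besselKernel t (x - y) * φ y =
      ∫ ξ, ((besselDensity t * Real.exp (-(4 * Real.pi ^ 2 * ‖ξ‖ ^ 2 * t)) : ℝ) : ℂ) *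
        (Complex.exp (2 * Real.pi * Complex.I * (inner ℝ x ξ : ℝ)) * 𝓕 φ ξ) := by
  simp_rw [besselKernel, Complex.ofReal_mul, mul_assoc, integral_const_mul]
  rw [integral_heatKernel_mul ht]
  congr 1
  congr 1; ext ξ
  rw [Complex.exp_add, Complex.ofReal_exp]
  push_cast
  rw [mul_assoc]
  congr 2
  · ring
  · congr 1; ring

/-- Fubini's hypothesis holds on the Fourier side, where `𝓕 φ` is integrable and both the Gaussian
and the phase are bounded by `1`. -/
theorem integrable_bessel_prod (φ : 𝓢(E3, ℂ)) (x : E3) :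
    Integrable (fun p : ℝ × E3 =>
      ((besselDensity p.1 * Real.exp (-(4 * Real.pi ^ 2 * ‖p.2‖ ^ 2 * p.1)) : ℝ) : ℂ) *
        (Complex.exp (2 * Real.pi * Complex.I * (inner ℝ x p.2 : ℝ)) * 𝓕 φ p.2))
      ((volume.restrict (Ioi 0)).prod volume) := by
  have h1 : Integrable (fun p : ℝ × E3 => besselDensity p.1 * ‖𝓕 φ p.2‖)
      ((volume.restrict (Ioi 0)).prod volume) :=
    Integrable.mul_prod (f := besselDensity) (g := fun ξ => ‖𝓕 φ ξ‖) integrableOn_besselDensity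
      ((𝓕 φ).integrable (μ := volume)).norm
  have hm : Measurable (fun ξ => 𝓕 φ ξ) := (𝓕 φ).continuous.measurable
  refine h1.mono' ?_ ?_
  · have := measurable_besselDensity
    apply Measurable.aestronglyMeasurable
    fun_prop
  · have hae : ∀ᵐ p : ℝ × E3 ∂((volume.restrict (Ioi 0)).prod volume), p.1 ∈ Ioi (0 : ℝ) := by
      have : ∀ᵐ t ∂(volume.restrict (Ioi (0 : ℝ))), t ∈ Ioi (0 : ℝ) :=
        ae_restrict_mem measurableSet_Ioi
      exact Measure.quasiMeasurePreserving_fst.ae this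
    filter_upwards [hae] with p hp
    have hd := besselDensity_nonneg hp
    rw [norm_mul, norm_mul, Complex.norm_real, Real.norm_eq_abs, abs_of_nonneg (by positivity)]
    have e1 : ‖Complex.exp (2 * Real.pi * Complex.I * (inner ℝ x p.2 : ℝ))‖ = 1 := by
      rw [show (2 * Real.pi * Complex.I * (inner ℝ x p.2 : ℝ) : ℂ) =
        ((2 * Real.pi * (inner ℝ x p.2 : ℝ) : ℝ) : ℂ) * Complex.I by push_cast; ring,
        Complex.norm_exp_ofReal_mul_I]
    rw [e1, one_mul]
    have e2 : Real.exp (-(4 * Real.pi ^ 2 * ‖p.2‖ ^ 2 * p.1)) ≤ 1 := by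
      rw [Real.exp_le_one_iff]
      have : 0 < p.1 := hp
      have : 0 ≤ 4 * Real.pi ^ 2 * ‖p.2‖ ^ 2 * p.1 := by positivity
      linarith
    calc _ ≤ besselDensity p.1 * 1 * ‖𝓕 φ p.2‖ := by gcongr
      _ = _ := by ring

theorem integrableOn_integral_besselKernel (φ : 𝓢(E3, ℂ)) (x : E3) :
    IntegrableOn (fun t => ∫ y, besselKernel t (x - y) * φ y) (Ioi 0) := by
  have h := (integrable_bessel_prod φ x).integral_prod_left
  refine IntegrableOn.congr_fun h (fun t ht => ?_) measurableSet_Ioi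
  exact (besselDensity_mul_integral ht φ x).symm

theorem besselS_eq_integral (φ : 𝓢(E3, ℂ)) (x : E3) :
    besselS φ x = ∫ t in Ioi 0, ∫ y, besselKernel t (x - y) * φ y := by
  rw [setIntegral_congr_fun measurableSet_Ioi fun t ht => besselDensity_mul_integral ht φ x,
    integral_integral_swap (integrable_bessel_prod φ x), besselS_apply]
  congr 1; ext ξ
  rw [integral_mul_const, integral_complex_ofReal, integral_besselDensity_mul_exp (by positivity)]
  ring

theorem norm_besselKernel {t : ℝ} (ht : 0 < t) (z : E3) :
    ‖besselKernel t z‖ = besselDensity t * heatKernel t z := by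
  rw [besselKernel, Complex.norm_real, Real.norm_eq_abs, abs_of_nonneg]
  have := besselDensity_nonneg ht
  have := heatKernel_nonneg ht z
  positivity

theorem norm_momentumKernel_le {t : ℝ} (ht : 0 < t) (j : Fin 3) (z : E3) :
    ‖momentumKernel j t z‖ ≤ ‖z‖ / (2 * t) * (besselDensity t * heatKernel t z) := by
  have := besselDensity_nonneg ht
  have := heatKernel_nonneg ht z
  rw [momentumKernel, norm_mul, norm_mul, Complex.norm_I, one_mul, norm_besselKernel ht,
    Complex.norm_real, norm_div, Real.norm_of_nonneg (show 0 ≤ 2 * t by positivity)]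
  have h := PiLp.norm_apply_le z j
  gcongr

/-- Summability of moments follows from domination by heat kernels at doubled time. -/
theorem lintegral_moment_lt_top {a : ℝ → E3 → ℂ} {n : ℕ} {C : ℝ} {m : ℕ} (hC : 0 ≤ C)
    (h : ∀ t > 0, ∀ z, ‖a t z‖ * (‖z‖ * (1 + ‖z‖) ^ n) ≤
      C * besselDensity t * (1 + 8 * t) ^ m * heatKernel (2 * t) z) :
    ∫⁻ t in Ioi 0, ∫⁻ z, ‖a t z‖ₑ * ENNReal.ofReal (‖z‖ * (1 + ‖z‖) ^ n) < ⊤ := by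
  set K : ℝ := C * Real.pi ^ (-(1 / 2) : ℝ) * (16 ^ m * (m.factorial * Real.exp (1 / 16))) with hK
  -- Dividing by `16` makes the exponential bound cost only `e^{t/2}`, half of the decay `e^{-t}`
  -- present in `besselDensity`.
  have hpow : ∀ t > 0, (1 + 8 * t) ^ m ≤
      16 ^ m * (m.factorial * Real.exp (1 / 16)) * Real.exp (t / 2) := by
    intro t ht
    have := Real.pow_div_factorial_le_exp (x := (1 + 8 * t) / 16) (by positivity) m
    rw [div_le_iff₀ (by positivity), div_pow, div_le_iff₀ (by positivity),
      show (1 + 8 * t) / 16 = 1 / 16 + t / 2 by ring, Real.exp_add] at this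
    linarith
  have h1 : ∀ t > 0, ∫⁻ z, ‖a t z‖ₑ * ENNReal.ofReal (‖z‖ * (1 + ‖z‖) ^ n) ≤
      ENNReal.ofReal (K * (t ^ (-(1 / 2) : ℝ) * Real.exp (-(1 / 2 * t)))) := by
    intro t ht
    calc _ ≤ ∫⁻ z, ENNReal.ofReal (K * (t ^ (-(1 / 2) : ℝ) * Real.exp (-(1 / 2 * t)))) *
        ENNReal.ofReal (heatKernel (2 * t) z) := by
          refine lintegral_mono fun z => ?_
          have hk0 := heatKernel_nonneg (t := 2 * t) (by positivity) z
          rw [← ofReal_norm, ← ENNReal.ofReal_mul (norm_nonneg _),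
            ← ENNReal.ofReal_mul (by positivity)]
          apply ENNReal.ofReal_le_ofReal
          refine (h t ht z).trans ?_
          refine mul_le_mul_of_nonneg_right ?_ hk0
          have e : Real.exp (-t) * Real.exp (t / 2) = Real.exp (-(1 / 2 * t)) := by
            rw [← Real.exp_add]; congr 1; ring
          calc C * besselDensity t * (1 + 8 * t) ^ m ≤ C * besselDensity t *
                (16 ^ m * (m.factorial * Real.exp (1 / 16)) * Real.exp (t / 2)) := by
                have := besselDensity_nonneg ht
                gcongr
                exact hpow t ht
            _ = K * (t ^ (-(1 / 2) : ℝ) * Real.exp (-(1 / 2 * t))) := by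
                rw [← e, hK, besselDensity]; ring
      _ = _ := by
          rw [lintegral_const_mul' _ _ ENNReal.ofReal_ne_top,
            lintegral_heatKernel (by positivity), mul_one]
  calc _ ≤ ∫⁻ t in Ioi 0, ENNReal.ofReal (K * (t ^ (-(1 / 2) : ℝ) * Real.exp (-(1 / 2 * t)))) :=
        setLIntegral_mono' measurableSet_Ioi h1
    _ < ⊤ := by
        have := (integrableOn_rpow_mul_exp (r := 1 / 2) (by norm_num)).const_mul K
        exact (this.lintegral_lt_top)

/-- Growth in `‖z‖` is traded for growth in the parabolic variable `‖z‖²/(8t)`, which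
`heatKernel_mul_pow_le` absorbs, at the price of powers of `1 + 8t`, which the factor `e^{-t}`
absorbs. -/
theorem one_add_norm_pow_le {t : ℝ} (ht : 0 < t) (z : E3) (n : ℕ) :
    (1 + ‖z‖) ^ n ≤ 2 ^ n * ((1 + 8 * t) ^ n * (1 + ‖z‖ ^ 2 / (8 * t)) ^ n) := by
  rw [← mul_pow, ← mul_pow]
  have e : (1 + 8 * t) * (1 + ‖z‖ ^ 2 / (8 * t)) =
      1 + ‖z‖ ^ 2 + 8 * t + ‖z‖ ^ 2 / (8 * t) := by
    field_simp; ring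
  have h2 : 0 ≤ ‖z‖ ^ 2 / (8 * t) := by positivity
  gcongr
  rw [e]
  nlinarith [sq_nonneg (‖z‖ - 1)]

theorem besselKernel_kernelRep : KernelRep besselS besselKernel where
  measurable := by
    have h1 := measurable_besselDensity
    have h2 : Measurable fun p : ℝ × E3 => heatKernel p.1 p.2 := measurable_heatKernel
    unfold besselKernel Function.uncurry
    fun_prop
  integrable_space t ht φ x := by
    have h1 : Integrable fun y => besselKernel t (x - y) := by
      have := (integrable_heatKernel ht).comp_sub_left x
      exact (this.const_mul (besselDensity t)).ofReal
    refine h1.mul_bdd (c := SchwartzMap.seminorm ℂ 0 0 φ)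
      φ.continuous.aestronglyMeasurable (ae_of_all _ fun y => ?_)
    exact SchwartzMap.norm_le_seminorm ℂ φ y
  integrable_time := integrableOn_integral_besselKernel
  eq_integral := besselS_eq_integral
  moments n := by
    refine lintegral_moment_lt_top (C := 2 ^ (n + 1) * (2 ^ (3 / 2 : ℝ) *
      ((n + 1).factorial * Real.exp 1))) (m := n + 1) (by positivity) fun t ht z => ?_
    have h1 := heatKernel_mul_pow_le ht z (n + 1)
    have h2 := one_add_norm_pow_le ht z (n + 1)
    have hd := besselDensity_nonneg ht
    have hk := heatKernel_nonneg ht z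
    rw [norm_besselKernel ht]
    calc besselDensity t * heatKernel t z * (‖z‖ * (1 + ‖z‖) ^ n)
        ≤ besselDensity t * heatKernel t z * (1 + ‖z‖) ^ (n + 1) := by
          rw [pow_succ']; gcongr; linarith
      _ ≤ besselDensity t * heatKernel t z *
          (2 ^ (n + 1) * ((1 + 8 * t) ^ (n + 1) * (1 + ‖z‖ ^ 2 / (8 * t)) ^ (n + 1))) := by gcongr
      _ = besselDensity t * 2 ^ (n + 1) * (1 + 8 * t) ^ (n + 1) *
          (heatKernel t z * (1 + ‖z‖ ^ 2 / (8 * t)) ^ (n + 1)) := by ring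
      _ ≤ besselDensity t * 2 ^ (n + 1) * (1 + 8 * t) ^ (n + 1) *
          (2 ^ (3 / 2 : ℝ) * ((n + 1).factorial * Real.exp 1) * heatKernel (2 * t) z) := by gcongr
      _ = _ := by ring

theorem hasFDerivAt_heatKernel (t : ℝ) (z : E3) :
    HasFDerivAt (heatKernel t) (-(heatKernel t z / (2 * t)) • innerSL ℝ z) z := by
  have h1 : HasFDerivAt (fun z : E3 => -(‖z‖ ^ 2 / (4 * t))) (-((1 / (2 * t)) • innerSL ℝ z)) z := by
    have := ((hasStrictFDerivAt_norm_sq z).hasFDerivAt.mul_const (1 / (4 * t))).neg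
    refine (this.congr_fderiv ?_).congr_of_eventuallyEq (Filter.Eventually.of_forall fun y => ?_)
    · ext v
      simp
      ring
    · simp; ring
  refine (h1.exp.const_mul ((4 * Real.pi * t) ^ (-(3 / 2) : ℝ))).congr_fderiv ?_
  ext v
  simp [heatKernel]
  ring

theorem inner_basisVec (x : E3) (j : Fin 3) : inner ℝ x (basisVec j) = x j := by
  simp [basisVec, EuclideanSpace.inner_single_right]

theorem hasFDerivAt_besselKernel_sub (t : ℝ) (x y : E3) :
    HasFDerivAt (fun y => besselKernel t (x - y)) (Complex.ofRealCLM ∘L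
      ((besselDensity t * (heatKernel t (x - y) / (2 * t))) • innerSL ℝ (x - y))) y := by
  have h1 := (hasFDerivAt_heatKernel t (x - y)).comp y ((hasFDerivAt_id y).const_sub x)
  have h2 := Complex.ofRealCLM.hasFDerivAt.comp y (h1.const_mul (besselDensity t))
  refine h2.congr_fderiv ?_
  ext v
  simp
  ring

/-- Integration by parts moves `P_j` from `φ` to the heat kernel, whose derivative produces the
factor `z_j/(2t)`. -/
theorem integral_momentumKernel_mul {t : ℝ} (ht : 0 < t) (j : Fin 3) (φ : 𝓢(E3, ℂ)) (x : E3) :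
    (Integrable fun y => momentumKernel j t (x - y) * φ y) ∧
    ∫ y, momentumKernel j t (x - y) * φ y = ∫ y, besselKernel t (x - y) * momentumS j φ y := by
  have hd : ∀ y, fderiv ℝ (fun y => besselKernel t (x - y)) y (basisVec j) =
      -Complex.I * momentumKernel j t (x - y) := by
    intro y
    rw [(hasFDerivAt_besselKernel_sub t x y).fderiv]
    simp [momentumKernel, besselKernel, inner_basisVec]
    ring_nf
    simp
    ring
  have hint : Integrable fun y => momentumKernel j t (x - y) * φ y := by
    have hm1 : Continuous fun y : E3 => momentumKernel j t (x - y) := by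
      have := continuous_heatKernel t
      unfold momentumKernel besselKernel
      fun_prop
    -- At a fixed time the linear factor `‖z‖` is absorbed by the heat kernel at time `2t`, which is
    -- bounded by its value at the origin.
    have hB : ∃ B, ∀ z, ‖momentumKernel j t z‖ ≤ B := by
      refine ⟨(1 / (2 * t)) * besselDensity t * (2 * (1 + 8 * t)) * (2 ^ (3 / 2 : ℝ) *
        ((1).factorial * Real.exp 1)) * (4 * Real.pi * (2 * t)) ^ (-(3 / 2) : ℝ), fun z => ?_⟩
      have h1 := heatKernel_mul_pow_le ht z 1
      have h2 := one_add_norm_pow_le ht z 1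
      have h0 := besselDensity_nonneg ht
      have hk := heatKernel_nonneg ht z
      have hkk : heatKernel (2 * t) z ≤ (4 * Real.pi * (2 * t)) ^ (-(3 / 2) : ℝ) := by
        unfold heatKernel
        have : Real.exp (-(‖z‖ ^ 2 / (4 * (2 * t)))) ≤ 1 := by
          rw [Real.exp_le_one_iff]
          have : 0 ≤ ‖z‖ ^ 2 / (4 * (2 * t)) := by positivity
          linarith
        exact mul_le_of_le_one_right (by positivity) this
      rw [pow_one] at h1 h2
      refine (norm_momentumKernel_le ht j z).trans ?_
      calc ‖z‖ / (2 * t) * (besselDensity t * heatKernel t z)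
          ≤ (2 * ((1 + 8 * t) * (1 + ‖z‖ ^ 2 / (8 * t)))) / (2 * t) *
            (besselDensity t * heatKernel t z) := by
            gcongr
            simp only [pow_one] at h2
            linarith
        _ = (1 / (2 * t)) * besselDensity t * (2 * (1 + 8 * t)) *
            (heatKernel t z * (1 + ‖z‖ ^ 2 / (8 * t))) := by ring
        _ ≤ (1 / (2 * t)) * besselDensity t * (2 * (1 + 8 * t)) * (2 ^ (3 / 2 : ℝ) *
            ((1).factorial * Real.exp 1) * (4 * Real.pi * (2 * t)) ^ (-(3 / 2) : ℝ)) := by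
            refine mul_le_mul_of_nonneg_left (h1.trans ?_) (by positivity)
            gcongr
        _ = _ := by ring
    obtain ⟨B, hB⟩ := hB
    exact (φ.integrable (μ := volume)).bdd_mul hm1.aestronglyMeasurable
      (ae_of_all _ fun y => hB (x - y))
  refine ⟨hint, ?_⟩
  have hi := integral_mul_fderiv_eq_neg_fderiv_mul_of_integrable (μ := (volume : Measure E3))
    (f := fun y => besselKernel t (x - y)) (g := φ) (v := basisVec j) ?_ ?_ ?_ ?_ ?_
  · simp_rw [hd] at hi
    simp_rw [momentumS_apply]
    have e1 : ∀ y, besselKernel t (x - y) * (-Complex.I * fderiv ℝ φ y (basisVec j)) =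
        -Complex.I * (besselKernel t (x - y) * fderiv ℝ φ y (basisVec j)) := fun y => by ring
    have e2 : ∀ y, -Complex.I * momentumKernel j t (x - y) * φ y =
        -Complex.I * (momentumKernel j t (x - y) * φ y) := fun y => by ring
    simp_rw [e2] at hi
    simp_rw [e1]
    rw [integral_const_mul, hi, integral_const_mul]
    linear_combination (∫ (a : E3), momentumKernel j t (x - a) * φ a) * Complex.I_mul_I
  · simp_rw [hd, mul_assoc]
    exact hint.const_mul _
  · exact besselKernel_kernelRep.integrable_space t ht (∂_{basisVec j} φ) x
  · exact besselKernel_kernelRep.integrable_space t ht φ x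
  · exact fun y _ => (hasFDerivAt_besselKernel_sub t x y).differentiableAt
  · exact fun y _ => φ.differentiableAt

theorem momentumKernel_kernelRep (j : Fin 3) :
    KernelRep (besselS ∘L momentumS j) (momentumKernel j) where
  measurable := by
    have h1 : Measurable fun p : ℝ × E3 => besselKernel p.1 p.2 := besselKernel_kernelRep.measurable
    unfold momentumKernel Function.uncurry
    fun_prop
  integrable_space t ht φ x := (integral_momentumKernel_mul ht j φ x).1
  integrable_time φ x := by
    refine IntegrableOn.congr_fun (integrableOn_integral_besselKernel (momentumS j φ) x)
      (fun t ht => ?_) measurableSet_Ioi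
    exact (integral_momentumKernel_mul ht j φ x).2.symm
  eq_integral φ x := by
    rw [ContinuousLinearMap.comp_apply, besselS_eq_integral]
    refine setIntegral_congr_fun measurableSet_Ioi fun t ht => ?_
    exact (integral_momentumKernel_mul ht j φ x).2.symm
  moments n := by
    refine lintegral_moment_lt_top (C := 4 * 2 ^ n * (2 ^ (3 / 2 : ℝ) *
      ((n + 1).factorial * Real.exp 1))) (m := n) (by positivity) fun t ht z => ?_
    have h1 := heatKernel_mul_pow_le ht z (n + 1)
    have h2 := one_add_norm_pow_le ht z n
    have hd := besselDensity_nonneg ht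
    have hk := heatKernel_nonneg ht z
    have h3 := norm_momentumKernel_le ht j z
    have h4 : 0 ≤ ‖z‖ ^ 2 / (8 * t) := by positivity
    -- The singular factor `‖z‖/(2t)` meets the extra `‖z‖` of the moment, and their product is `4 ·
    -- ‖z‖²/(8t)`: a power of the parabolic variable, with no negative power of `t` left over.
    calc ‖momentumKernel j t z‖ * (‖z‖ * (1 + ‖z‖) ^ n)
        ≤ ‖z‖ / (2 * t) * (besselDensity t * heatKernel t z) * (‖z‖ * (2 ^ n * ((1 + 8 * t) ^ n *
          (1 + ‖z‖ ^ 2 / (8 * t)) ^ n))) := by gcongr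
      _ = 4 * 2 ^ n * besselDensity t * (1 + 8 * t) ^ n *
          (heatKernel t z * ((‖z‖ ^ 2 / (8 * t)) * (1 + ‖z‖ ^ 2 / (8 * t)) ^ n)) := by
          field_simp; ring
      _ ≤ 4 * 2 ^ n * besselDensity t * (1 + 8 * t) ^ n *
          (heatKernel t z * ((1 + ‖z‖ ^ 2 / (8 * t)) * (1 + ‖z‖ ^ 2 / (8 * t)) ^ n)) := by
          gcongr; linarith
      _ = 4 * 2 ^ n * besselDensity t * (1 + 8 * t) ^ n *
          (heatKernel t z * (1 + ‖z‖ ^ 2 / (8 * t)) ^ (n + 1)) := by rw [pow_succ' (1 + ‖z‖ ^ 2 / (8 * t))]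
      _ ≤ 4 * 2 ^ n * besselDensity t * (1 + 8 * t) ^ n *
          (2 ^ (3 / 2 : ℝ) * ((n + 1).factorial * Real.exp 1) * heatKernel (2 * t) z) := by gcongr
      _ = _ := by ring

end MagneticSchrodinger
end

noncomputable section

namespace MagneticSchrodinger

open FourierTransform Set Filter Topology

/-! ## Operators on distributions and their `L²` extensions -/

/-- Multiplication of distributions by `⟨x⟩^s`. -/
abbrev weightD (s : ℝ) : 𝓢'(E3, ℂ) →L[ℂ] 𝓢'(E3, ℂ) :=
  TemperedDistribution.smulLeftCLM ℂ (weight s)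

/-- Multiplication of Schwartz functions by `⟨x⟩^s`. -/
abbrev weightS (s : ℝ) : 𝓢(E3, ℂ) →L[ℂ] 𝓢(E3, ℂ) := SchwartzMap.smulLeftCLM ℂ (weight s)

/-- The operator `(1 - Δ)^{k/2}` on distributions. -/
abbrev besselD (k : ℝ) : 𝓢'(E3, ℂ) →L[ℂ] 𝓢'(E3, ℂ) :=
  TemperedDistribution.fourierMultiplierCLM ℂ (besselSymbol k)

/-- The momentum operator on distributions as a continuous linear map. -/
def momentumD (j : Fin 3) : 𝓢'(E3, ℂ) →L[ℂ] 𝓢'(E3, ℂ) :=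
  (-Complex.I) • LineDeriv.lineDerivOpCLM ℂ 𝓢'(E3, ℂ) (basisVec j)

/-- The embedding of `L²` into the tempered distributions. -/
abbrev toD : L2 →L[ℂ] 𝓢'(E3, ℂ) := Lp.toTemperedDistributionCLM ℂ (volume : Measure E3) 2

/-- The embedding of Schwartz functions into `L²`. -/
abbrev toL : 𝓢(E3, ℂ) →L[ℂ] L2 := SchwartzMap.toLpCLM ℂ ℂ 2 (volume : Measure E3)

/-- The bilinear pairing `∫ f g` on `L²`. -/
def pair : L2 →L[ℂ] L2 →L[ℂ] ℂ := (ContinuousLinearMap.mul ℂ ℂ).lpPairing volume 2 2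

theorem pair_apply (f g : L2) : pair f g = ∫ x, f x * g x :=
  ContinuousLinearMap.lpPairing_eq_integral _ _ _

theorem momentumD_apply (j : Fin 3) (T : 𝓢'(E3, ℂ)) : momentumD j T = momentum j T := rfl

theorem momentum_apply (j : Fin 3) (T : 𝓢'(E3, ℂ)) (φ : 𝓢(E3, ℂ)) :
    momentum j T φ = -T (momentumS j φ) := by
  have h1 : momentum j T φ = -Complex.I * T (-∂_{basisVec j} φ) := rfl
  have h2 : momentumS j φ = -Complex.I • ∂_{basisVec j} φ := rfl
  rw [h1, h2, map_neg, map_smul, smul_eq_mul]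
  ring

theorem toD_apply (h : L2) (φ : 𝓢(E3, ℂ)) : toD h φ = pair h (toL φ) := by
  rw [pair_apply]
  simp only [Lp.toTemperedDistributionCLM_apply, Lp.toTemperedDistribution_apply]
  apply integral_congr_ae
  filter_upwards [φ.coeFn_toLp 2 (volume : Measure E3)] with x hx
  rw [SchwartzMap.toLpCLM_apply, hx, smul_eq_mul, mul_comm]

theorem pair_comm (f g : L2) : pair f g = pair g f := by
  simp_rw [pair_apply, mul_comm]

theorem toD_injective : Function.Injective toD := by
  have := Lp.ker_toTemperedDistributionCLM_eq_bot (E := E3) (F := ℂ)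
    (μ := (volume : Measure E3)) (p := 2)
  exact LinearMap.ker_eq_bot.1 this

theorem denseRange_toL : DenseRange toL :=
  SchwartzMap.denseRange_toLpCLM (by norm_num)

theorem toD_toL (φ : 𝓢(E3, ℂ)) :
    toD (toL φ) = SchwartzMap.toTemperedDistributionCLM E3 ℂ volume φ :=
  Lp.toTemperedDistribution_toLp_eq φ

theorem toL_coe (φ : 𝓢(E3, ℂ)) : (toL φ : E3 → ℂ) =ᵐ[volume] φ :=
  φ.coeFn_toLp 2 (volume : Measure E3)

theorem pair_toL (f g : 𝓢(E3, ℂ)) : pair (toL f) (toL g) = ∫ x, f x * g x := by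
  rw [pair_apply]
  apply integral_congr_ae
  filter_upwards [toL_coe f, toL_coe g] with x h1 h2
  rw [h1, h2]

/-- An `L²`-bounded Schwartz operator extends to `L²`, compatibly with its action on
distributions. -/
theorem exists_extension {X : 𝓢(E3, ℂ) →L[ℂ] 𝓢(E3, ℂ)} {X' : 𝓢'(E3, ℂ) →L[ℂ] 𝓢'(E3, ℂ)}
    (hX : IsL2Bounded X) (hc : ∀ φ, X' (toD (toL φ)) = toD (toL (X φ))) :
    ∃ Y : L2 →L[ℂ] L2, (∀ φ, Y (toL φ) = toL (X φ)) ∧ ∀ h, X' (toD h) = toD (Y h) := by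
  obtain ⟨C, hC⟩ := hX
  set Y : L2 →L[ℂ] L2 := (toL ∘L X).toLinearMap.extendOfNorm toL.toLinearMap with hY
  have h1 : ∀ φ, Y (toL φ) = toL (X φ) := fun φ =>
    LinearMap.extendOfNorm_eq (f := (toL ∘L X).toLinearMap) (e := toL.toLinearMap)
      denseRange_toL ⟨C, hC⟩ φ
  refine ⟨Y, h1, fun h => ?_⟩
  refine denseRange_toL.induction_on h ?_ fun φ => by rw [h1, hc]
  exact isClosed_eq (X'.continuous.comp toD.continuous) (toD.continuous.comp Y.continuous)

theorem isL2Bounded_fourierMultiplier {m : E3 → ℂ} (hm : m.HasTemperateGrowth) {C : ℝ}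
    (hC : ∀ ξ, ‖m ξ‖ ≤ C) : IsL2Bounded (SchwartzMap.fourierMultiplierCLM ℂ m) := by
  refine ⟨C, fun φ => ?_⟩
  rw [← SchwartzMap.norm_fourier_toL2_eq, ← SchwartzMap.norm_fourier_toL2_eq φ,
    SchwartzMap.fourierMultiplierCLM_apply, FourierInvPair.fourier_fourierInv_eq]
  have hC0 : 0 ≤ C := (norm_nonneg _).trans (hC 0)
  refine Lp.norm_le_mul_norm_of_ae_le_mul (c := C) ?_
  filter_upwards [(SchwartzMap.smulLeftCLM ℂ m (𝓕 φ)).coeFn_toLp 2 (volume : Measure E3),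
    (𝓕 φ).coeFn_toLp 2 (volume : Measure E3)] with x h1 h2
  rw [h1, h2, SchwartzMap.smulLeftCLM_apply_apply hm, smul_eq_mul, norm_mul]
  gcongr
  exact hC x

/-- The symbol `2πξ_j` of the momentum operator. -/
def momentumSymbol (j : Fin 3) (ξ : E3) : ℂ := ((2 * Real.pi * ξ j : ℝ) : ℂ)

theorem momentumSymbol_eq (j : Fin 3) :
    momentumSymbol j = (2 * Real.pi : ℂ) • fun ξ : E3 => ((inner ℝ ξ (basisVec j) : ℝ) : ℂ) := by
  funext ξ
  simp [momentumSymbol, inner_basisVec]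

theorem momentumSymbol_hasTemperateGrowth (j : Fin 3) : (momentumSymbol j).HasTemperateGrowth := by
  rw [momentumSymbol_eq]
  have : (fun ξ : E3 => ((inner ℝ ξ (basisVec j) : ℝ) : ℂ)).HasTemperateGrowth := by fun_prop
  exact (Function.HasTemperateGrowth.const _).mul this

theorem momentumS_eq (j : Fin 3) :
    momentumS j = SchwartzMap.fourierMultiplierCLM ℂ (momentumSymbol j) := by
  ext1 φ
  have h0 : (fun ξ : E3 => inner ℝ ξ (basisVec j)).HasTemperateGrowth := by fun_prop
  have h0' : (fun ξ : E3 => ((inner ℝ ξ (basisVec j) : ℝ) : ℂ)).HasTemperateGrowth := by fun_prop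
  rw [momentumSymbol_eq, SchwartzMap.fourierMultiplierCLM_smul h0']
  have h1 : momentumS j φ = -Complex.I • ∂_{basisVec j} φ := rfl
  rw [h1, SchwartzMap.lineDeriv_eq_fourierMultiplierCLM,
    ← SchwartzMap.fourierMultiplierCLM_ofReal ℂ h0, smul_smul]
  rw [smul_apply]
  congr 1
  linear_combination (-2 * (Real.pi : ℂ)) * Complex.I_mul_I

theorem momentumD_eq (j : Fin 3) :
    momentumD j = TemperedDistribution.fourierMultiplierCLM ℂ (momentumSymbol j) := by
  ext1 T
  have h0' : (fun ξ : E3 => ((inner ℝ ξ (basisVec j) : ℝ) : ℂ)).HasTemperateGrowth := by fun_prop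
  rw [momentumSymbol_eq, TemperedDistribution.fourierMultiplierCLM_smul h0']
  have h1 : momentumD j T = -Complex.I • ∂_{basisVec j} T := rfl
  rw [h1, TemperedDistribution.lineDeriv_eq_fourierMultiplierCLM, smul_smul]
  rw [smul_apply]
  congr 1
  linear_combination (-2 * (Real.pi : ℂ)) * Complex.I_mul_I

theorem besselSymbol_mul (k l : ℝ) : besselSymbol k * besselSymbol l = besselSymbol (k + l) := by
  funext ξ
  have : 0 < 1 + ‖(2 * Real.pi) • ξ‖ ^ 2 := by positivity
  rw [Pi.mul_apply, besselSymbol, besselSymbol, besselSymbol, ← Complex.ofReal_mul,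
    ← Real.rpow_add this, add_div]

theorem besselSymbol_zero : besselSymbol 0 = fun _ => 1 := by
  funext ξ; simp [besselSymbol]

theorem norm_besselSymbol_neg_one_le (ξ : E3) : ‖besselSymbol (-1) ξ‖ ≤ 1 := by
  rw [besselSymbol, Complex.norm_real, Real.norm_of_nonneg (by positivity)]
  apply Real.rpow_le_one_of_one_le_of_nonpos
  · nlinarith [sq_nonneg ‖(2 * Real.pi) • ξ‖]
  · norm_num

theorem norm_momentumSymbol_mul_le (j : Fin 3) (ξ : E3) :
    ‖(momentumSymbol j * besselSymbol (-1)) ξ‖ ≤ 1 := by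
  set a := ‖(2 * Real.pi) • ξ‖ with ha
  have h1 : ‖momentumSymbol j ξ‖ ≤ a := by
    rw [momentumSymbol, Complex.norm_real, norm_mul, ha, norm_smul]
    gcongr
    exact PiLp.norm_apply_le ξ j
  have h2 : ‖besselSymbol (-1) ξ‖ = (Real.sqrt (1 + a ^ 2))⁻¹ := by
    rw [besselSymbol, Complex.norm_real, Real.norm_of_nonneg (by positivity), Real.sqrt_eq_rpow,
      ← Real.rpow_neg (by positivity)]
    norm_num [ha]
  rw [Pi.mul_apply, norm_mul, h2, mul_inv_le_iff₀ (by positivity), one_mul]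
  exact h1.trans (Real.le_sqrt_of_sq_le (by linarith))

theorem besselS_comp_momentumS (j : Fin 3) : besselS ∘L momentumS j =
    SchwartzMap.fourierMultiplierCLM ℂ (momentumSymbol j * besselSymbol (-1)) := by
  rw [besselS, momentumS_eq, SchwartzMap.fourierMultiplierCLM_compL_fourierMultiplierCLM
    (besselSymbol_hasTemperateGrowth _) (momentumSymbol_hasTemperateGrowth j), mul_comm]

theorem isL2Bounded_conjWeight_besselS (s : ℝ) : IsL2Bounded (conjWeight s besselS) :=
  besselKernel_kernelRep.isL2Bounded_conjWeight
    (isL2Bounded_fourierMultiplier (besselSymbol_hasTemperateGrowth _) norm_besselSymbol_neg_one_le)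
    s

theorem isL2Bounded_conjWeight_momentumS (s : ℝ) (j : Fin 3) :
    IsL2Bounded (conjWeight s (besselS ∘L momentumS j)) := by
  refine (momentumKernel_kernelRep j).isL2Bounded_conjWeight ?_ s
  rw [besselS_comp_momentumS]
  exact isL2Bounded_fourierMultiplier ((momentumSymbol_hasTemperateGrowth j).mul
    (besselSymbol_hasTemperateGrowth _)) (norm_momentumSymbol_mul_le j)

theorem weightD_toD_toL (s : ℝ) (φ : 𝓢(E3, ℂ)) :
    weightD s (toD (toL φ)) = toD (toL (weightS s φ)) := by
  ext χ
  rw [TemperedDistribution.smulLeftCLM_apply_apply, toD_apply, toD_apply, pair_toL, pair_toL]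
  congr 1; ext x
  rw [SchwartzMap.smulLeftCLM_apply_apply (weight_hasTemperateGrowth s),
    SchwartzMap.smulLeftCLM_apply_apply (weight_hasTemperateGrowth s), smul_eq_mul, smul_eq_mul]
  ring

theorem besselD_toD_toL (φ : 𝓢(E3, ℂ)) :
    besselD (-1) (toD (toL φ)) = toD (toL (besselS φ)) := by
  rw [toD_toL, toD_toL, TemperedDistribution.fourierMultiplierCLM_toTemperedDistributionCLM_eq
    (besselSymbol_hasTemperateGrowth _)]
  rfl

theorem momentumD_toD_toL (j : Fin 3) (φ : 𝓢(E3, ℂ)) :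
    momentumD j (toD (toL φ)) = toD (toL (momentumS j φ)) := by
  rw [toD_toL, toD_toL, momentumD_eq, momentumS_eq,
    TemperedDistribution.fourierMultiplierCLM_toTemperedDistributionCLM_eq
    (momentumSymbol_hasTemperateGrowth _)]

theorem exists_besselOp (s : ℝ) : ∃ Y : L2 →L[ℂ] L2,
    (∀ φ, Y (toL φ) = toL (weightS s (besselS (weightS (-s) φ)))) ∧
    ∀ h, weightD s (besselD (-1) (weightD (-s) (toD h))) = toD (Y h) :=
  exists_extension (X' := weightD s ∘L besselD (-1) ∘L weightD (-s))
    (isL2Bounded_conjWeight_besselS s) fun φ => by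
    simp only [ContinuousLinearMap.comp_apply, weightD_toD_toL, besselD_toD_toL]
    rfl

theorem exists_momentumOp (s : ℝ) (j : Fin 3) : ∃ Y : L2 →L[ℂ] L2,
    (∀ φ, Y (toL φ) = toL (weightS s (besselS (momentumS j (weightS (-s) φ))))) ∧
    ∀ h, weightD s (besselD (-1) (momentumD j (weightD (-s) (toD h)))) = toD (Y h) :=
  exists_extension (X' := weightD s ∘L besselD (-1) ∘L momentumD j ∘L weightD (-s))
    (isL2Bounded_conjWeight_momentumS s j) fun φ => by
    simp only [ContinuousLinearMap.comp_apply, weightD_toD_toL, besselD_toD_toL, momentumD_toD_toL]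
    rfl

/-- The bounded operator `⟨x⟩^s (1 - Δ)^{-1/2} ⟨x⟩^{-s}` on `L²`. -/
def besselOp (s : ℝ) : L2 →L[ℂ] L2 := Classical.choose (exists_besselOp s)

/-- The bounded operator `⟨x⟩^s (1 - Δ)^{-1/2} P_j ⟨x⟩^{-s}` on `L²`. -/
def momentumOp (s : ℝ) (j : Fin 3) : L2 →L[ℂ] L2 := Classical.choose (exists_momentumOp s j)

theorem besselOp_toL (s : ℝ) (φ : 𝓢(E3, ℂ)) :
    besselOp s (toL φ) = toL (weightS s (besselS (weightS (-s) φ))) :=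
  (Classical.choose_spec (exists_besselOp s)).1 φ

theorem toD_besselOp (s : ℝ) (h : L2) :
    weightD s (besselD (-1) (weightD (-s) (toD h))) = toD (besselOp s h) :=
  (Classical.choose_spec (exists_besselOp s)).2 h

theorem momentumOp_toL (s : ℝ) (j : Fin 3) (φ : 𝓢(E3, ℂ)) :
    momentumOp s j (toL φ) = toL (weightS s (besselS (momentumS j (weightS (-s) φ)))) :=
  (Classical.choose_spec (exists_momentumOp s j)).1 φ

theorem toD_momentumOp (s : ℝ) (j : Fin 3) (h : L2) :
    weightD s (besselD (-1) (momentumD j (weightD (-s) (toD h)))) = toD (momentumOp s j h) :=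
  (Classical.choose_spec (exists_momentumOp s j)).2 h

/-! ## Algebra of weights and multipliers -/

theorem weightD_weightD (s r : ℝ) (T : 𝓢'(E3, ℂ)) :
    weightD s (weightD r T) = weightD (r + s) T := by
  rw [weightD, weightD, TemperedDistribution.smulLeftCLM_smulLeftCLM_apply
    (weight_hasTemperateGrowth _) (weight_hasTemperateGrowth _), weight_mul]

theorem weight_zero : weight 0 = fun _ => 1 := by
  funext x; simp [weight]

theorem weightD_neg_weightD (s : ℝ) (T : 𝓢'(E3, ℂ)) : weightD (-s) (weightD s T) = T := by
  rw [weightD_weightD, add_neg_cancel, weightD, weight_zero]; simp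

theorem weightD_weightD_neg (s : ℝ) (T : 𝓢'(E3, ℂ)) : weightD s (weightD (-s) T) = T := by
  rw [weightD_weightD, neg_add_cancel, weightD, weight_zero]; simp

theorem weightS_weightS (s r : ℝ) (φ : 𝓢(E3, ℂ)) :
    weightS s (weightS r φ) = weightS (s + r) φ := by
  rw [weightS, weightS, SchwartzMap.smulLeftCLM_smulLeftCLM_apply
    (weight_hasTemperateGrowth _) (weight_hasTemperateGrowth _), weight_mul]

theorem weightS_neg_weightS (s : ℝ) (φ : 𝓢(E3, ℂ)) : weightS (-s) (weightS s φ) = φ := by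
  rw [weightS_weightS, neg_add_cancel, weightS, weight_zero]; simp

theorem weightS_apply (s : ℝ) (φ : 𝓢(E3, ℂ)) (x : E3) : weightS s φ x = weight s x * φ x := by
  rw [SchwartzMap.smulLeftCLM_apply_apply (weight_hasTemperateGrowth s), smul_eq_mul]

theorem weightD_apply (s : ℝ) (T : 𝓢'(E3, ℂ)) (φ : 𝓢(E3, ℂ)) :
    weightD s T φ = T (weightS s φ) := rfl

theorem besselD_besselD (k l : ℝ) (T : 𝓢'(E3, ℂ)) :
    besselD k (besselD l T) = besselD (l + k) T := by
  rw [besselD, besselD, TemperedDistribution.fourierMultiplierCLM_fourierMultiplierCLM_apply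
    (besselSymbol_hasTemperateGrowth _) (besselSymbol_hasTemperateGrowth _), besselSymbol_mul]

theorem besselD_zero (T : 𝓢'(E3, ℂ)) : besselD 0 T = T := by
  rw [besselD, besselSymbol_zero]; simp

theorem momentumD_besselD (j : Fin 3) (k : ℝ) (T : 𝓢'(E3, ℂ)) :
    momentumD j (besselD k T) = besselD k (momentumD j T) := by
  rw [momentumD_eq, besselD, TemperedDistribution.fourierMultiplierCLM_fourierMultiplierCLM_apply
    (besselSymbol_hasTemperateGrowth _) (momentumSymbol_hasTemperateGrowth _),
    TemperedDistribution.fourierMultiplierCLM_fourierMultiplierCLM_apply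
    (momentumSymbol_hasTemperateGrowth _) (besselSymbol_hasTemperateGrowth _), mul_comm]

/-- `(1 - Δ) = 1 + ∑_j P_j²`. -/
theorem besselD_two (T : 𝓢'(E3, ℂ)) :
    besselD 2 T = T + ∑ j, momentumD j (momentumD j T) := by
  have h : besselSymbol 2 = (fun _ => 1) + fun ξ => ∑ j, (momentumSymbol j * momentumSymbol j) ξ := by
    funext ξ
    simp only [besselSymbol, Pi.add_apply, Pi.mul_apply, momentumSymbol]
    rw [norm_smul, mul_pow, EuclideanSpace.norm_sq_eq]
    have : (2 : ℝ) / 2 = 1 := by norm_num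
    rw [this, Real.rpow_one, Finset.mul_sum]
    push_cast
    congr 1
    refine Finset.sum_congr rfl fun j _ => ?_
    have e : ((‖ξ j‖ : ℝ) : ℂ) ^ 2 = (ξ j : ℂ) ^ 2 := by
      rw [Real.norm_eq_abs, ← Complex.ofReal_pow, sq_abs, Complex.ofReal_pow]
    have e2 : ((‖2 * Real.pi‖ : ℝ) : ℂ) = 2 * Real.pi := by
      rw [Real.norm_of_nonneg (by positivity)]; push_cast; rfl
    rw [e, e2]; ring
  have hg : ∀ j ∈ (Finset.univ : Finset (Fin 3)),
      (momentumSymbol j * momentumSymbol j).HasTemperateGrowth := fun j _ =>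
    (momentumSymbol_hasTemperateGrowth j).mul (momentumSymbol_hasTemperateGrowth j)
  have hone : (fun _ : E3 => (1 : ℂ)).HasTemperateGrowth := Function.HasTemperateGrowth.const 1
  have hs : (fun ξ => ∑ j, (momentumSymbol j * momentumSymbol j) ξ).HasTemperateGrowth :=
    Function.HasTemperateGrowth.sum hg
  have e : ∀ (g₁ g₂ : E3 → ℂ), g₁.HasTemperateGrowth → g₂.HasTemperateGrowth →
      TemperedDistribution.fourierMultiplierCLM ℂ (g₁ + g₂) T =
        TemperedDistribution.fourierMultiplierCLM ℂ g₁ T +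
        TemperedDistribution.fourierMultiplierCLM ℂ g₂ T := by
    intro g₁ g₂ h₁ h₂
    ext φ
    simp [SchwartzMap.smulLeftCLM_add h₁ h₂, FourierTransform.fourier_add]
  rw [besselD, h, e _ _ hone hs, TemperedDistribution.fourierMultiplierCLM_sum ℂ hg]
  congr 1
  · simp
  · rw [sum_apply]
    refine Finset.sum_congr rfl fun j _ => ?_
    rw [momentumD_eq, TemperedDistribution.fourierMultiplierCLM_fourierMultiplierCLM_apply
      (momentumSymbol_hasTemperateGrowth _) (momentumSymbol_hasTemperateGrowth _)]

/-! ## Characterizations of the weighted Sobolev spaces -/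

theorem mem_weightedSobolev_iff {k s : ℝ} {u : 𝓢'(E3, ℂ)} :
    u ∈ weightedSobolev k s ↔ ∃ h : L2, weightD s (besselD k u) = toD h := by
  constructor
  · rintro ⟨h, hh⟩; exact ⟨h, hh.symm⟩
  · rintro ⟨h, hh⟩; exact ⟨h, hh.symm⟩

theorem toL2_eq {k s : ℝ} (u : weightedSobolev k s) {h : L2}
    (hh : weightD s (besselD k u) = toD h) : toL2 u = h :=
  toD_injective ((toL2_spec u).trans hh)

theorem besselD_neg_one_of_besselD_one {u : 𝓢'(E3, ℂ)} : besselD (-1) (besselD 1 u) = u := by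
  rw [besselD_besselD, add_neg_cancel, besselD_zero]

/-- A distribution in `H^{1,r}` and its first derivatives are in `L²_r`, and it is a limit of
Schwartz functions in this sense. -/
theorem exists_approx_of_mem {r : ℝ} {u : 𝓢'(E3, ℂ)} (hu : u ∈ weightedSobolev 1 r) :
    ∃ (h : L2) (g : Fin 3 → L2), weightD r u = toD h ∧ (∀ j, weightD r (momentum j u) = toD (g j)) ∧
      ∃ φ : ℕ → 𝓢(E3, ℂ), Tendsto (fun n => toL (weightS r (φ n))) atTop (𝓝 h) ∧
        ∀ j, Tendsto (fun n => toL (weightS r (momentumS j (φ n)))) atTop (𝓝 (g j)) := by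
  obtain ⟨v, hv⟩ := mem_weightedSobolev_iff.1 hu
  have hv' : besselD 1 u = weightD (-r) (toD v) := by rw [← hv, weightD_neg_weightD]
  have hu' : u = besselD (-1) (weightD (-r) (toD v)) := by
    rw [← hv', besselD_neg_one_of_besselD_one]
  refine ⟨besselOp r v, fun j => momentumOp r j v, ?_, fun j => ?_, ?_⟩
  · rw [← toD_besselOp, ← hu']
  · rw [← toD_momentumOp, ← momentumD_apply, hu', momentumD_besselD]
  -- The approximation is made at the level of `v = ⟨x⟩^r (1-Δ)^{1/2} u` in `L²`. The bounded
  -- operators then carry it to `u` and to all `P_j u` at once.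
  · obtain ⟨w, hw1, hw2⟩ := mem_closure_iff_seq_limit.1 (denseRange_toL v)
    choose χ hχ using hw1
    refine ⟨fun n => besselS (weightS (-r) (χ n)), ?_, fun j => ?_⟩
    · simp_rw [← besselOp_toL, hχ]
      exact (besselOp r).continuous.continuousAt.tendsto.comp hw2
    · have : ∀ n, weightS r (momentumS j (besselS (weightS (-r) (χ n)))) =
          weightS r (besselS (momentumS j (weightS (-r) (χ n)))) := by
        intro n
        rw [momentumS_eq, besselS, SchwartzMap.fourierMultiplierCLM_fourierMultiplierCLM_apply
          (momentumSymbol_hasTemperateGrowth _) (besselSymbol_hasTemperateGrowth _),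
          SchwartzMap.fourierMultiplierCLM_fourierMultiplierCLM_apply
          (besselSymbol_hasTemperateGrowth _) (momentumSymbol_hasTemperateGrowth _), mul_comm]
      simp_rw [this, ← momentumOp_toL, hχ]
      exact (momentumOp r j).continuous.continuousAt.tendsto.comp hw2

/-- `T + ∑_j P_j S_j` is in `H^{-1,s}` if `T` and the `S_j` are in `L²_s`. -/
theorem weightD_besselD_divergence {s : ℝ} {T : 𝓢'(E3, ℂ)} {S : Fin 3 → 𝓢'(E3, ℂ)} {t : L2}
    {σ : Fin 3 → L2} (hT : weightD s T = toD t) (hS : ∀ j, weightD s (S j) = toD (σ j)) :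
    weightD s (besselD (-1) (T + ∑ j, momentum j (S j))) =
      toD (besselOp s t + ∑ j, momentumOp s j (σ j)) := by
  have hT' : T = weightD (-s) (toD t) := by rw [← hT, weightD_neg_weightD]
  have hS' : ∀ j, S j = weightD (-s) (toD (σ j)) := fun j => by rw [← hS, weightD_neg_weightD]
  simp_rw [map_add, map_sum, ← toD_besselOp, ← toD_momentumOp, ← hT', ← hS', momentumD_apply]

/-- If `u` and its first derivatives are in `L²_r`, then `u` is in `H^{1,r}`. -/
theorem weightD_besselD_one {r : ℝ} {u : 𝓢'(E3, ℂ)} {h : L2} {g : Fin 3 → L2}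
    (hu : weightD r u = toD h) (hg : ∀ j, weightD r (momentum j u) = toD (g j)) :
    weightD r (besselD 1 u) = toD (besselOp r h + ∑ j, momentumOp r j (g j)) := by
  -- Writing `(1-Δ)^{1/2} = (1-Δ)^{-1/2} (1 + ∑_j P_j²)` leaves only operators of the types
  -- `besselOp` and `momentumOp`, applied to `u` and `P_j u`.
  have : besselD 1 u = besselD (-1) (u + ∑ j, momentum j (momentum j u)) := by
    have := besselD_two u
    simp_rw [momentumD_apply] at this
    rw [← this, besselD_besselD]; norm_num
  rw [this, weightD_besselD_divergence hu hg]

/-- Transposing a multiplier exchanges `𝓕` and `𝓕⁻`. These differ by a reflection, which an even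
symbol does not see; hence `(1-Δ)^{k/2}` is its own transpose. -/
theorem fourier_smulLeft_fourierInv {m : E3 → ℂ} (hm : m.HasTemperateGrowth)
    (he : ∀ ξ, m (-ξ) = m ξ) (φ : 𝓢(E3, ℂ)) :
    𝓕 (SchwartzMap.smulLeftCLM ℂ m (𝓕⁻ φ)) = SchwartzMap.fourierMultiplierCLM ℂ m φ := by
  rw [SchwartzMap.fourierMultiplierCLM_apply]
  set N := SchwartzMap.compCLMOfContinuousLinearEquiv ℂ (F := ℂ)
    (LinearIsometryEquiv.neg ℝ (E := E3)).toContinuousLinearEquiv with hN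
  have hinv : ∀ f : 𝓢(E3, ℂ), 𝓕⁻ f = N (𝓕 f) := fun f => rfl
  have hNN : ∀ f : 𝓢(E3, ℂ), N (N f) = f := fun f => by ext x; simp [hN]
  have hFN : ∀ f : 𝓢(E3, ℂ), 𝓕 (N f) = 𝓕⁻ f := by
    intro f
    have : N f = 𝓕⁻ (𝓕⁻ f) := by rw [hinv (𝓕⁻ f), FourierInvPair.fourier_fourierInv_eq]
    rw [this, FourierInvPair.fourier_fourierInv_eq]
  have hsm : ∀ f : 𝓢(E3, ℂ), SchwartzMap.smulLeftCLM ℂ m (N f) = N (SchwartzMap.smulLeftCLM ℂ m f) := by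
    intro f; ext x
    simp [hN, SchwartzMap.smulLeftCLM_apply_apply hm, he]
  rw [hinv φ, hsm, hFN]

theorem besselD_apply (k : ℝ) (T : 𝓢'(E3, ℂ)) (φ : 𝓢(E3, ℂ)) :
    besselD k T φ = T (SchwartzMap.fourierMultiplierCLM ℂ (besselSymbol k) φ) := by
  rw [TemperedDistribution.fourierMultiplierCLM_apply_apply,
    fourier_smulLeft_fourierInv (besselSymbol_hasTemperateGrowth k)]
  intro ξ; simp [besselSymbol]

/-- The transpose of `besselOp s` is `⟨x⟩^{-s} (1-Δ)^{-1/2} ⟨x⟩^s`, and this operator takes `k` to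
`h`. Density of Schwartz functions reduces the claim to the definitions. -/
theorem pair_besselOp {s : ℝ} {ψ : 𝓢'(E3, ℂ)} {h k : L2} (hψ : weightD (-s) ψ = toD h)
    (hk : weightD (-s) (besselD 1 ψ) = toD k) (t : L2) : pair (besselOp s t) k = pair t h := by
  refine denseRange_toL.induction_on t (isClosed_eq ?_ ?_) fun φ => ?_
  · exact (pair.flip k).continuous.comp (besselOp s).continuous
  · exact (pair.flip h).continuous
  rw [besselOp_toL, pair_comm, ← toD_apply, ← hk, weightD_apply, weightS_neg_weightS,
    besselD_apply, pair_comm, ← toD_apply, ← hψ, weightD_apply, besselS,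
    SchwartzMap.fourierMultiplierCLM_fourierMultiplierCLM_apply
    (besselSymbol_hasTemperateGrowth _) (besselSymbol_hasTemperateGrowth _), besselSymbol_mul,
    add_neg_cancel, besselSymbol_zero]
  simp

/-- As for `besselOp`; the minus sign appears because the pairing is bilinear, without conjugation,
so `P_j` is antisymmetric for it. -/
theorem pair_momentumOp {s : ℝ} {ψ : 𝓢'(E3, ℂ)} {k g : L2} {j : Fin 3}
    (hψ : weightD (-s) (momentum j ψ) = toD g)
    (hk : weightD (-s) (besselD 1 ψ) = toD k) (t : L2) :
    pair (momentumOp s j t) k = -pair t g := by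
  refine denseRange_toL.induction_on t (isClosed_eq ?_ ?_) fun φ => ?_
  · exact (pair.flip k).continuous.comp (momentumOp s j).continuous
  · exact (pair.flip g).continuous.neg
  rw [momentumOp_toL, pair_comm, ← toD_apply, ← hk, weightD_apply, weightS_neg_weightS,
    besselD_apply, pair_comm, ← toD_apply, ← hψ, weightD_apply, momentum_apply, neg_neg, besselS,
    SchwartzMap.fourierMultiplierCLM_fourierMultiplierCLM_apply
    (besselSymbol_hasTemperateGrowth _) (besselSymbol_hasTemperateGrowth _), besselSymbol_mul,
    add_neg_cancel, besselSymbol_zero]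
  simp

/-- The duality between `H^{-1,s}` and `H^{1,-s}` in terms of functions. -/
theorem dualPairing_eq {s : ℝ} {T : 𝓢'(E3, ℂ)} {S : Fin 3 → 𝓢'(E3, ℂ)} {t : L2}
    {σ : Fin 3 → L2} (hT : weightD s T = toD t) (hS : ∀ j, weightD s (S j) = toD (σ j))
    {h : L2} {g : Fin 3 → L2} (G : weightedSobolev (-1) s) (ψ : weightedSobolev 1 (-s))
    (hG : (G : 𝓢'(E3, ℂ)) = T + ∑ j, momentum j (S j))
    (hψ : weightD (-s) ψ = toD h) (hψ' : ∀ j, weightD (-s) (momentum j ψ) = toD (g j)) :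
    dualPairing G ψ = pair t h - ∑ j, pair (σ j) (g j) := by
  have e1 : toL2 G = besselOp s t + ∑ j, momentumOp s j (σ j) := by
    apply toL2_eq; rw [hG]; exact weightD_besselD_divergence hT hS
  have hk : weightD (-s) (besselD 1 ψ) = toD (toL2 ψ) := (toL2_spec ψ).symm
  rw [dualPairing, ← pair_apply, e1, map_add, map_sum, add_apply,
    sum_apply, pair_besselOp hψ hk]
  simp_rw [pair_momentumOp (hψ' _) hk]
  rw [Finset.sum_neg_distrib, sub_eq_add_neg]

end MagneticSchrodinger
end

noncomputable section

namespace MagneticSchrodinger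

open FourierTransform Set Filter Topology

/-! ## Bounded multiplication operators -/

/-- Multiplication by a bounded function as an operator on `L²`. -/
def mulOp {c : E3 → ℂ} (hc : MemLp c ⊤ volume) : L2 →L[ℂ] L2 :=
  (ContinuousLinearMap.mul ℂ ℂ).holderL volume ⊤ 2 2 (hc.toLp c)

theorem mulOp_coe {c : E3 → ℂ} (hc : MemLp c ⊤ volume) (f : L2) :
    (mulOp hc f : E3 → ℂ) =ᵐ[volume] fun x => c x * f x := by
  have h := ContinuousLinearMap.coeFn_holder (r := 2) (ContinuousLinearMap.mul ℂ ℂ) (hc.toLp c) f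
  filter_upwards [h, hc.coeFn_toLp] with x h1 h2
  rw [← h2]
  exact h1

theorem memLp_top_of_forall_norm_le {c : E3 → ℂ} (hc : AEStronglyMeasurable c volume) {K : ℝ}
    (hK : ∀ x, ‖c x‖ ≤ K) : MemLp c ⊤ volume :=
  MeasureTheory.memLp_top_of_bound hc K (ae_of_all _ hK)

theorem memLp_top_of_hasCompactSupport {c : E3 → ℂ} (hc : Continuous c)
    (hs : HasCompactSupport c) : MemLp c ⊤ volume :=
  hc.memLp_top_of_hasCompactSupport hs _

theorem inner_eq_integral (f g : L2) : inner ℂ f g = ∫ x, g x * (starRingEnd ℂ) (f x) := by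
  rw [L2.inner_def]; rfl

theorem integrable_mul_conj (f g : L2) : Integrable fun x => g x * (starRingEnd ℂ) (f x) :=
  L2.integrable_inner (𝕜 := ℂ) f g

/-! ## Distributions given by functions -/

theorem RepresentedBy.locallyIntegrable {T : 𝓢'(E3, ℂ)} {F : E3 → ℂ} (h : RepresentedBy T F) :
    LocallyIntegrable F := by
  intro x
  -- Integrability against a bump function equal to `1` near `x` is integrability of the function
  -- itself near `x`.
  let f : ContDiffBump x := ⟨1, 2, one_pos, one_lt_two⟩
  have hs : HasCompactSupport (Complex.ofRealCLM ∘ f) := f.hasCompactSupport.comp_left rfl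
  have hd : ContDiff ℝ ∞ (Complex.ofRealCLM ∘ f) := Complex.ofRealCLM.contDiff.comp f.contDiff
  refine ⟨Metric.closedBall x 1, Metric.closedBall_mem_nhds x one_pos, ?_⟩
  refine IntegrableOn.congr_fun ((h (hs.toSchwartzMap hd)).1.integrableOn) (fun y hy => ?_)
    Metric.isClosed_closedBall.measurableSet
  have : f y = 1 := f.one_of_mem_closedBall hy
  simp [this]

theorem RepresentedBy.ae_eq {T : 𝓢'(E3, ℂ)} {F F' : E3 → ℂ} (h : RepresentedBy T F)
    (h' : RepresentedBy T F') : F =ᵐ[volume] F' := by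
  refine ae_eq_of_integral_contDiff_smul_eq h.locallyIntegrable h'.locallyIntegrable ?_
  intro g hg hgs
  have hs : HasCompactSupport (Complex.ofRealCLM ∘ g) := hgs.comp_left rfl
  have hd : ContDiff ℝ ∞ (Complex.ofRealCLM ∘ g) := Complex.ofRealCLM.contDiff.comp hg
  have h1 := (h (hs.toSchwartzMap hd)).2
  have h2 := (h' (hs.toSchwartzMap hd)).2
  rw [h1] at h2
  simpa [mul_comm] using h2

theorem representedBy_of_weightD {T : 𝓢'(E3, ℂ)} {r : ℝ} {h : L2} (hT : weightD r T = toD h) :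
    RepresentedBy T fun x => weight (-r) x * h x := by
  intro φ
  have hT' : T = weightD (-r) (toD h) := by rw [← hT, weightD_neg_weightD]
  have e : ∀ᵐ x, h x * (toL (weightS (-r) φ) : L2) x = weight (-r) x * h x * φ x := by
    filter_upwards [toL_coe (weightS (-r) φ)] with x hx
    rw [hx, weightS_apply]; ring
  constructor
  · refine Integrable.congr ?_ e
    exact (Lp.memLp h).integrable_mul (Lp.memLp _)
  · rw [hT', weightD_apply, toD_apply, pair_apply]
    exact integral_congr_ae e

theorem RepresentedBy.congr {T : 𝓢'(E3, ℂ)} {F F' : E3 → ℂ} (h : RepresentedBy T F)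
    (h' : F =ᵐ[volume] F') : RepresentedBy T F' := by
  intro φ
  have e : (fun x => F x * φ x) =ᵐ[volume] fun x => F' x * φ x := by
    filter_upwards [h'] with x hx; rw [hx]
  exact ⟨(h φ).1.congr e, (h φ).2.trans (integral_congr_ae e)⟩

/-! ## Integration by parts for Schwartz functions -/

theorem hasFDerivAt_conj {f : E3 → ℂ} (hf : Differentiable ℝ f) (x : E3) :
    HasFDerivAt (fun y => (starRingEnd ℂ) (f y))
      ((Complex.conjCLE : ℂ →L[ℝ] ℂ) ∘L fderiv ℝ f x) x :=
  (Complex.conjCLE : ℂ →L[ℝ] ℂ).hasFDerivAt.comp x (hf x).hasFDerivAt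

theorem fderiv_ofReal_comp {f : E3 → ℝ} (hf : Differentiable ℝ f) (x v : E3) :
    fderiv ℝ (fun y => ((f y : ℝ) : ℂ)) x v = (fderiv ℝ f x v : ℝ) := by
  have h : HasFDerivAt (fun y => ((f y : ℝ) : ℂ)) (Complex.ofRealCLM ∘L fderiv ℝ f x) x :=
    Complex.ofRealCLM.hasFDerivAt.comp x (hf x).hasFDerivAt
  rw [h.fderiv]; rfl

theorem fderiv_eq_I_mul_momentumS (j : Fin 3) (φ : 𝓢(E3, ℂ)) (x : E3) :
    fderiv ℝ φ x (basisVec j) = Complex.I * momentumS j φ x := by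
  rw [momentumS_apply]
  linear_combination (fderiv ℝ φ x (basisVec j)) * Complex.I_mul_I

theorem contDiff_partial {η : E3 → ℝ} (hη : ContDiff ℝ ∞ η) (v : E3) :
    ContDiff ℝ ∞ fun y => fderiv ℝ η y v :=
  (hη.fderiv_right (m := ∞) le_rfl).clm_apply contDiff_const

theorem hasCompactSupport_partial {η : E3 → ℝ} (hη : HasCompactSupport η) (v : E3) :
    HasCompactSupport fun y => fderiv ℝ η y v :=
  hη.fderiv_apply (𝕜 := ℝ) v

/-- The bracket on the left is `∂_j |φ|²` written with `P_j = -i∂_j`; a second derivative then falls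
on `η`. Summed over `j`, the right side yields `-∫ Δη |φ|²`. -/
theorem integral_partial_mul_density {η : E3 → ℝ} (hη : ContDiff ℝ ∞ η) (hs : HasCompactSupport η)
    (φ : 𝓢(E3, ℂ)) (j : Fin 3) :
    ∫ x, ((fderiv ℝ η x (basisVec j) : ℝ) : ℂ) *
      (Complex.I * momentumS j φ x * (starRingEnd ℂ) (φ x) -
        Complex.I * φ x * (starRingEnd ℂ) (momentumS j φ x)) =
    -∫ x, ((fderiv ℝ (fun y => fderiv ℝ η y (basisVec j)) x (basisVec j) : ℝ) : ℂ) *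
      (φ x * (starRingEnd ℂ) (φ x)) := by
  set ζ : E3 → ℝ := fun y => fderiv ℝ η y (basisVec j) with hζ
  have hζd : ContDiff ℝ ∞ ζ := contDiff_partial hη _
  have hζs : HasCompactSupport ζ := hasCompactSupport_partial hs _
  have hζd' : Differentiable ℝ ζ := hζd.differentiable (by simp)
  have hconj : Continuous fun x => (starRingEnd ℂ) (φ x) := Complex.continuous_conj.comp φ.continuous
  have hd : ∀ x, fderiv ℝ (fun x => φ x * (starRingEnd ℂ) (φ x)) x (basisVec j) =
      Complex.I * momentumS j φ x * (starRingEnd ℂ) (φ x) -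
        Complex.I * φ x * (starRingEnd ℂ) (momentumS j φ x) := by
    intro x
    have : HasFDerivAt (fun x => φ x * (starRingEnd ℂ) (φ x)) _ x :=
      (φ.hasFDerivAt x).mul (hasFDerivAt_conj φ.differentiable x)
    rw [this.fderiv]
    simp only [add_apply, smul_apply, smul_eq_mul]
    change φ x * (starRingEnd ℂ) (fderiv ℝ φ x (basisVec j)) +
      (starRingEnd ℂ) (φ x) * fderiv ℝ φ x (basisVec j) = _
    rw [fderiv_eq_I_mul_momentumS, map_mul, Complex.conj_I]
    ring
  have hc : ∀ f : E3 → ℂ, Continuous f → Integrable fun x => ((ζ x : ℝ) : ℂ) * f x := by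
    intro f hf
    refine Continuous.integrable_of_hasCompactSupport
      ((Complex.continuous_ofReal.comp hζd.continuous).mul hf) ?_
    exact (hζs.comp_left (g := fun t : ℝ => (t : ℂ)) Complex.ofReal_zero).mul_right
  have := integral_mul_fderiv_eq_neg_fderiv_mul_of_integrable (μ := (volume : Measure E3))
    (f := fun y => ((ζ y : ℝ) : ℂ)) (g := fun x => φ x * (starRingEnd ℂ) (φ x)) (v := basisVec j)
    ?_ ?_ ?_ ?_ ?_
  · simp_rw [hd, fderiv_ofReal_comp hζd'] at this
    exact this
  · simp_rw [fderiv_ofReal_comp hζd']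
    refine Continuous.integrable_of_hasCompactSupport ((Complex.continuous_ofReal.comp
      (contDiff_partial hζd _).continuous).mul (φ.continuous.mul hconj)) ?_
    exact ((hasCompactSupport_partial hζs _).comp_left (g := fun t : ℝ => (t : ℂ))
      Complex.ofReal_zero).mul_right
  · simp_rw [hd]
    apply hc
    have := (momentumS j φ).continuous
    have h2 : Continuous fun x => (starRingEnd ℂ) (momentumS j φ x) :=
      Complex.continuous_conj.comp this
    exact ((continuous_const.mul this).mul hconj).sub ((continuous_const.mul φ.continuous).mul h2)
  · exact hc _ (φ.continuous.mul hconj)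
  · exact fun x _ => (Complex.ofRealCLM.hasFDerivAt.comp x
      (hζd' x).hasFDerivAt).differentiableAt
  · exact fun x _ => ((φ.hasFDerivAt x).mul
      (hasFDerivAt_conj φ.differentiable x)).differentiableAt

/-! ## Subharmonicity of the density of a zero-energy solution -/

/-- The Laplacian of a real function, as the sum of the second partial derivatives. -/
def lap (η : E3 → ℝ) (x : E3) : ℝ :=
  ∑ j, fderiv ℝ (fun y => fderiv ℝ η y (basisVec j)) x (basisVec j)

theorem continuous_lap {η : E3 → ℝ} (hη : ContDiff ℝ ∞ η) : Continuous (lap η) :=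
  continuous_finsetSum _ fun _ _ => (contDiff_partial (contDiff_partial hη _) _).continuous

theorem continuous_weight (s : ℝ) : Continuous (weight s) :=
  Complex.continuous_ofReal.comp (continuous_bracket.rpow_const fun x => Or.inl (bracket_pos x).ne')

theorem weight_conj (s : ℝ) (x : E3) : (starRingEnd ℂ) (weight s x) = weight s x :=
  Complex.conj_ofReal _

/-- The coefficient `⟨x⟩^{-2r} η`, a bounded function. -/
theorem memLp_weight_mul {η : E3 → ℝ} (hη : Continuous η) (hs : HasCompactSupport η) (r : ℝ)
    (z : ℂ) : MemLp (fun x => z * (weight (-r) x * weight (-r) x * (η x : ℂ))) ⊤ volume := by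
  apply memLp_top_of_hasCompactSupport
  · have := continuous_weight (-r)
    fun_prop
  · exact ((hs.comp_left (g := fun t : ℝ => (t : ℂ)) Complex.ofReal_zero).mul_left).mul_left

/-- The preceding identity for functions that are only in `H^{1,r}`. The coefficient `⟨x⟩^{-2r}`
undoes the two weights and is bounded on the support of `η`, so both sides are continuous in `h` and
`g` for the `L²` norm, and the limit of Schwartz functions may be taken. -/
theorem weighted_density_identity {r : ℝ} {h : L2} {g : Fin 3 → L2} {φ : ℕ → 𝓢(E3, ℂ)}
    (hφ : Tendsto (fun n => toL (weightS r (φ n))) atTop (𝓝 h))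
    (hφ' : ∀ j, Tendsto (fun n => toL (weightS r (momentumS j (φ n)))) atTop (𝓝 (g j)))
    {η : E3 → ℝ} (hη : ContDiff ℝ ∞ η) (hs : HasCompactSupport η) (j : Fin 3) :
    inner ℂ h (mulOp (memLp_weight_mul (contDiff_partial hη (basisVec j)).continuous
        (hasCompactSupport_partial hs (basisVec j)) r Complex.I) (g j)) -
      inner ℂ (g j) (mulOp (memLp_weight_mul (contDiff_partial hη (basisVec j)).continuous
        (hasCompactSupport_partial hs (basisVec j)) r Complex.I) h) =
      -inner ℂ h (mulOp (memLp_weight_mul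
        (contDiff_partial (contDiff_partial hη (basisVec j)) (basisVec j)).continuous
        (hasCompactSupport_partial (hasCompactSupport_partial hs (basisVec j)) (basisVec j)) r 1)
          h) := by
  set M1 := mulOp (memLp_weight_mul (contDiff_partial hη (basisVec j)).continuous
        (hasCompactSupport_partial hs (basisVec j)) r Complex.I) with hM1
  set M2 := mulOp (memLp_weight_mul
        (contDiff_partial (contDiff_partial hη (basisVec j)) (basisVec j)).continuous
        (hasCompactSupport_partial (hasCompactSupport_partial hs (basisVec j)) (basisVec j)) r 1)
    with hM2
  have ht1 := (hφ.inner (𝕜 := ℂ) ((M1.continuous.tendsto _).comp (hφ' j))).sub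
    ((hφ' j).inner (𝕜 := ℂ) ((M1.continuous.tendsto _).comp hφ))
  have ht2 := (hφ.inner (𝕜 := ℂ) ((M2.continuous.tendsto _).comp hφ)).neg
  refine tendsto_nhds_unique ht1 (ht2.congr fun n => ?_)
  have hw : ∀ (x : E3) (a b c : ℂ), weight (-r) x * weight (-r) x * c * (weight r x * a) *
      (starRingEnd ℂ) (weight r x * b) = c * (a * (starRingEnd ℂ) b) := by
    intro x a b c
    rw [map_mul, weight_conj]
    have := weight_mul_weight_neg r x
    linear_combination (c * a * (starRingEnd ℂ) b) * (weight r x * weight (-r) x + 1) * this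
  simp only [Function.comp]
  rw [inner_eq_integral, inner_eq_integral, inner_eq_integral,
    ← integral_sub (integrable_mul_conj _ _) (integrable_mul_conj _ _)]
  have key := integral_partial_mul_density hη hs (φ n) j
  have e1 : ∫ x, (M2 (toL (weightS r (φ n)))) x * (starRingEnd ℂ) ((toL (weightS r (φ n)) : L2) x) =
      ∫ x, ((fderiv ℝ (fun y => fderiv ℝ η y (basisVec j)) x (basisVec j) : ℝ) : ℂ) *
      (φ n x * (starRingEnd ℂ) (φ n x)) := by
    apply integral_congr_ae
    filter_upwards [mulOp_coe (memLp_weight_mul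
        (contDiff_partial (contDiff_partial hη (basisVec j)) (basisVec j)).continuous
        (hasCompactSupport_partial (hasCompactSupport_partial hs (basisVec j)) (basisVec j)) r 1)
        (toL (weightS r (φ n))), toL_coe (weightS r (φ n))] with x h1 h2
    rw [h1, h2, weightS_apply, one_mul, hw]
  rw [e1, ← key]
  apply integral_congr_ae
  filter_upwards [mulOp_coe (memLp_weight_mul (contDiff_partial hη (basisVec j)).continuous
        (hasCompactSupport_partial hs (basisVec j)) r Complex.I) (toL (weightS r (φ n))),
    mulOp_coe (memLp_weight_mul (contDiff_partial hη (basisVec j)).continuous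
        (hasCompactSupport_partial hs (basisVec j)) r Complex.I)
        (toL (weightS r (momentumS j (φ n)))),
    toL_coe (weightS r (φ n)), toL_coe (weightS r (momentumS j (φ n)))] with x h1 h2 h3 h4
  rw [h1, h2, h3, h4, weightS_apply, weightS_apply, mul_assoc, mul_assoc, mul_assoc, mul_assoc]
  have a1 := hw x (momentumS j (φ n) x) (φ n x) ((fderiv ℝ η x (basisVec j) : ℝ) : ℂ)
  have a2 := hw x (φ n x) (momentumS j (φ n) x) ((fderiv ℝ η x (basisVec j) : ℝ) : ℂ)
  linear_combination (-Complex.I) * a1 + Complex.I * a2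

end MagneticSchrodinger
end

/-! ### The localized weak equation and subharmonicity of `|u|²` -/

noncomputable section

namespace MagneticSchrodinger

open FourierTransform Set Filter Topology

/-- The `L²` form of the test function in the weak formulation of the equation. -/
def testVec {A : E3 → E3} (hA : ∀ j, MemLp (fun x => (A x j : ℂ)) ⊤ volume) {η : E3 → ℝ}
    (hη : ContDiff ℝ ∞ η) (hs : HasCompactSupport η) (r : ℝ) (k : L2) (p : Fin 3 → L2)
    (j : Fin 3) : L2 :=
  mulOp (memLp_weight_mul (contDiff_partial hη (basisVec j)).continuous
      (hasCompactSupport_partial hs (basisVec j)) r (-Complex.I)) k +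
    mulOp (memLp_weight_mul hη.continuous hs r 1) (p j - mulOp (hA j) k)

/-- The `L²` form of the weak formulation of the equation. -/
def weakForm {A : E3 → E3} (hA : ∀ j, MemLp (fun x => (A x j : ℂ)) ⊤ volume) {V : E3 → ℝ}
    (hV : MemLp (fun x => (V x : ℂ)) ⊤ volume) {η : E3 → ℝ}
    (hη : ContDiff ℝ ∞ η) (hs : HasCompactSupport η) (r : ℝ) (h : L2) (g : Fin 3 → L2)
    (k : L2) (p : Fin 3 → L2) : ℂ :=
  ∑ j, inner ℂ (testVec hA hη hs r k p j) (g j - mulOp (hA j) h) +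
    inner ℂ (mulOp (memLp_weight_mul hη.continuous hs r 1) k) (mulOp hV h)

section

variable {A : E3 → E3} (hA : ∀ j, MemLp (fun x => (A x j : ℂ)) ⊤ volume) {V : E3 → ℝ}
    (hV : MemLp (fun x => (V x : ℂ)) ⊤ volume) {η : E3 → ℝ}
    (hη : ContDiff ℝ ∞ η) (hs : HasCompactSupport η) (r : ℝ)

theorem testVec_coe (k : L2) (p : Fin 3 → L2) (j : Fin 3) :
    (testVec hA hη hs r k p j : E3 → ℂ) =ᵐ[volume] fun x =>
      weight (-r) x * weight (-r) x * (-Complex.I * ((fderiv ℝ η x (basisVec j) : ℝ) : ℂ) * k x +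
        (η x : ℂ) * (p j x - (A x j : ℂ) * k x)) := by
  filter_upwards [Lp.coeFn_add (mulOp (memLp_weight_mul (contDiff_partial hη (basisVec j)).continuous
      (hasCompactSupport_partial hs (basisVec j)) r (-Complex.I)) k)
      (mulOp (memLp_weight_mul hη.continuous hs r 1) (p j - mulOp (hA j) k)),
    mulOp_coe (memLp_weight_mul (contDiff_partial hη (basisVec j)).continuous
      (hasCompactSupport_partial hs (basisVec j)) r (-Complex.I)) k,
    mulOp_coe (memLp_weight_mul hη.continuous hs r 1) (p j - mulOp (hA j) k),
    Lp.coeFn_sub (p j) (mulOp (hA j) k), mulOp_coe (hA j) k] with x h1 h2 h3 h4 h5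
  rw [testVec, h1, Pi.add_apply, h2, h3, h4, Pi.sub_apply, h5]
  ring

theorem covariant_coe (h : L2) (g : Fin 3 → L2) (j : Fin 3) :
    ((g j - mulOp (hA j) h : L2) : E3 → ℂ) =ᵐ[volume] fun x => g j x - (A x j : ℂ) * h x := by
  filter_upwards [Lp.coeFn_sub (g j) (mulOp (hA j) h), mulOp_coe (hA j) h] with x h1 h2
  rw [h1, Pi.sub_apply, h2]

/-- Collects the `L²` inner products under one integral sign, which is needed to compare integrands
pointwise. -/
theorem integrable_weakForm (h : L2) (g : Fin 3 → L2) (k : L2) (p : Fin 3 → L2) :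
    (Integrable fun x => (∑ j, (g j x - (A x j : ℂ) * h x) * (starRingEnd ℂ) (weight (-r) x *
      weight (-r) x * (-Complex.I * ((fderiv ℝ η x (basisVec j) : ℝ) : ℂ) * k x +
        (η x : ℂ) * (p j x - (A x j : ℂ) * k x)))) +
      (V x : ℂ) * h x * (starRingEnd ℂ) (weight (-r) x * weight (-r) x * (η x : ℂ) * k x)) ∧
    weakForm hA hV hη hs r h g k p = ∫ x, ((∑ j, (g j x - (A x j : ℂ) * h x) *
      (starRingEnd ℂ) (weight (-r) x *
      weight (-r) x * (-Complex.I * ((fderiv ℝ η x (basisVec j) : ℝ) : ℂ) * k x +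
        (η x : ℂ) * (p j x - (A x j : ℂ) * k x)))) +
      (V x : ℂ) * h x * (starRingEnd ℂ) (weight (-r) x * weight (-r) x * (η x : ℂ) * k x)) := by
  have hi1 : ∀ j ∈ (Finset.univ : Finset (Fin 3)), Integrable fun x =>
      (g j - mulOp (hA j) h : L2) x * (starRingEnd ℂ) (testVec hA hη hs r k p j x) :=
    fun j _ => integrable_mul_conj _ _
  have hi2 := integrable_mul_conj (mulOp (memLp_weight_mul hη.continuous hs r 1) k) (mulOp hV h)
  have e : (fun x => (∑ j, (g j - mulOp (hA j) h : L2) x *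
      (starRingEnd ℂ) (testVec hA hη hs r k p j x)) + mulOp hV h x *
        (starRingEnd ℂ) (mulOp (memLp_weight_mul hη.continuous hs r 1) k x)) =ᵐ[volume]
      fun x => (∑ j, (g j x - (A x j : ℂ) * h x) * (starRingEnd ℂ) (weight (-r) x *
      weight (-r) x * (-Complex.I * ((fderiv ℝ η x (basisVec j) : ℝ) : ℂ) * k x +
        (η x : ℂ) * (p j x - (A x j : ℂ) * k x)))) +
      (V x : ℂ) * h x * (starRingEnd ℂ) (weight (-r) x * weight (-r) x * (η x : ℂ) * k x) := by
    filter_upwards [ae_all_iff.2 (covariant_coe hA h g), ae_all_iff.2 (testVec_coe hA hη hs r k p),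
      mulOp_coe hV h, mulOp_coe (memLp_weight_mul hη.continuous hs r 1) k] with x h1 h2 h3 h4
    simp_rw [h1, h2, h3, h4, one_mul]
  refine ⟨((integrable_finsetSum _ hi1).add hi2).congr e, ?_⟩
  rw [← integral_congr_ae e, integral_add (integrable_finsetSum _ hi1) hi2,
    integral_finsetSum _ hi1, weakForm]
  simp_rw [inner_eq_integral]

/-- Only bounded operators act on the test data `k` and `p`. This continuity admits the solution
itself, cut off by `η`, as a test function. -/
theorem tendsto_weakForm (h : L2) (g : Fin 3 → L2) {k : ℕ → L2} {p : ℕ → Fin 3 → L2} {k' : L2}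
    {p' : Fin 3 → L2} (hk : Tendsto k atTop (𝓝 k'))
    (hp : ∀ j, Tendsto (fun n => p n j) atTop (𝓝 (p' j))) :
    Tendsto (fun n => weakForm hA hV hη hs r h g (k n) (p n)) atTop
      (𝓝 (weakForm hA hV hη hs r h g k' p')) := by
  have hc : ∀ (M : L2 →L[ℂ] L2) {q : ℕ → L2} {q' : L2}, Tendsto q atTop (𝓝 q') →
      Tendsto (fun n => M (q n)) atTop (𝓝 (M q')) := fun M q q' hq =>
    (M.continuous.tendsto _).comp hq
  refine Tendsto.add (tendsto_finsetSum _ fun j _ => Tendsto.inner ?_ tendsto_const_nhds)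
    ((hc _ hk).inner tendsto_const_nhds)
  exact (hc _ hk).add (hc _ ((hp j).sub (hc _ hk)))

/-- The equation is tested with `η φ̄`, smooth and compactly supported. The conjugate turns the
bilinear weak equation into the inner products of `weakForm`. -/
theorem weakForm_eq_zero {u : 𝓢'(E3, ℂ)} (sol : SolvesZeroEnergy A V u) {h : L2}
    {g : Fin 3 → L2} (hu : weightD r u = toD h) (hg : ∀ j, weightD r (momentum j u) = toD (g j))
    (φ : 𝓢(E3, ℂ)) : weakForm hA hV hη hs r h g (toL (weightS r φ))
      (fun j => toL (weightS r (momentumS j φ))) = 0 := by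
  obtain ⟨F, G, hF, hG, heq⟩ := sol
  have hF' := hF.ae_eq (representedBy_of_weightD hu)
  have hG' := fun j => (hG j).ae_eq (representedBy_of_weightD (hg j))
  have hηd : Differentiable ℝ η := hη.differentiable (by simp)
  have hcd : ContDiff ℝ ∞ fun x => (η x : ℂ) * (starRingEnd ℂ) (φ x) :=
    (Complex.ofRealCLM.contDiff.comp hη).mul
      ((Complex.conjCLE : ℂ →L[ℝ] ℂ).contDiff.comp (φ.smooth _))
  have hcs : HasCompactSupport fun x => (η x : ℂ) * (starRingEnd ℂ) (φ x) :=
    (hs.comp_left (g := fun t : ℝ => (t : ℂ)) Complex.ofReal_zero).mul_right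
  have hz := heq _ hcd hcs
  rw [(integrable_weakForm hA hV hη hs r h g _ _).2, ← hz]
  apply integral_congr_ae
  have hd : ∀ x j, fderiv ℝ (fun x => (η x : ℂ) * (starRingEnd ℂ) (φ x)) x (basisVec j) =
      ((fderiv ℝ η x (basisVec j) : ℝ) : ℂ) * (starRingEnd ℂ) (φ x) -
        (η x : ℂ) * (Complex.I * (starRingEnd ℂ) (momentumS j φ x)) := by
    intro x j
    have h1 : HasFDerivAt (fun y => ((η y : ℝ) : ℂ)) (Complex.ofRealCLM ∘L fderiv ℝ η x) x :=
      Complex.ofRealCLM.hasFDerivAt.comp x (hηd x).hasFDerivAt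
    have h2 : HasFDerivAt (fun x => (η x : ℂ) * (starRingEnd ℂ) (φ x)) _ x :=
      h1.mul (hasFDerivAt_conj φ.differentiable x)
    rw [h2.fderiv]
    simp only [add_apply, smul_apply, smul_eq_mul]
    change (η x : ℂ) * (starRingEnd ℂ) (fderiv ℝ φ x (basisVec j)) +
      (starRingEnd ℂ) (φ x) * ((fderiv ℝ η x (basisVec j) : ℝ) : ℂ) = _
    rw [fderiv_eq_I_mul_momentumS, map_mul, Complex.conj_I]
    ring
  filter_upwards [hF', ae_all_iff.2 hG', toL_coe (weightS r φ),
    ae_all_iff.2 fun j => toL_coe (weightS r (momentumS j φ))] with x h1 h2 h3 h4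
  have hw := weight_mul_weight_neg r x
  simp only [h1, h2, h3, h4, weightS_apply, hd, map_mul, map_add, map_sub, map_neg, weight_conj,
    Complex.conj_I, Complex.conj_ofReal]
  congr 1
  · refine Finset.sum_congr rfl fun j _ => ?_
    linear_combination (weight (-r) x * (g j x - (A x j : ℂ) * h x) *
      (Complex.I * ((fderiv ℝ η x (basisVec j) : ℝ) : ℂ) * (starRingEnd ℂ) (φ x) + (η x : ℂ) *
      ((starRingEnd ℂ) (momentumS j φ x) - (A x j : ℂ) * (starRingEnd ℂ) (φ x)))) * hw
      + (weight (-r) x * (g j x - (A x j : ℂ) * h x) * (η x : ℂ) *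
        (starRingEnd ℂ) (momentumS j φ x)) * Complex.I_mul_I
  · linear_combination ((V x : ℂ) * h x * weight (-r) x * (η x : ℂ) * (starRingEnd ℂ) (φ x)) * hw

include hA hV hη hs in
/-- The density `|u|²` of a zero-energy solution is subharmonic if `V ≥ 0`. -/
theorem integral_lap_mul_nonneg {u : 𝓢'(E3, ℂ)} (hu : u ∈ weightedSobolev 1 r)
    (sol : SolvesZeroEnergy A V u) (hV0 : ∀ x, 0 ≤ V x) (hη0 : ∀ x, 0 ≤ η x) {F : E3 → ℂ}
    (hF : RepresentedBy u F) : 0 ≤ ∫ x, lap η x * ‖F x‖ ^ 2 := by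
  obtain ⟨h, g, hh, hg, φ, hφ, hφ'⟩ := exists_approx_of_mem hu
  have hF' := hF.ae_eq (representedBy_of_weightD hh)
  -- The equation tested with `η ū`, reached as a limit of Schwartz functions.
  have hW : weakForm hA hV hη hs r h g h g = 0 := by
    refine tendsto_nhds_unique (tendsto_weakForm hA hV hη hs r h g hφ hφ') ?_
    simp_rw [weakForm_eq_zero hA hV hη hs r sol hh hg]
    exact tendsto_const_nhds
  obtain ⟨hi, hI⟩ := integrable_weakForm hA hV hη hs r h g h g
  set M1 := fun j => mulOp (memLp_weight_mul (contDiff_partial hη (basisVec j)).continuous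
        (hasCompactSupport_partial hs (basisVec j)) r Complex.I) with hM1
  set M2 := fun j => mulOp (memLp_weight_mul
        (contDiff_partial (contDiff_partial hη (basisVec j)) (basisVec j)).continuous
        (hasCompactSupport_partial (hasCompactSupport_partial hs (basisVec j)) (basisVec j)) r 1)
    with hM2
  have hM1c : ∀ j (f : L2), (M1 j f : E3 → ℂ) =ᵐ[volume] _ := fun j f => mulOp_coe _ f
  have hM2c : ∀ j (f : L2), (M2 j f : E3 → ℂ) =ᵐ[volume] _ := fun j f => mulOp_coe _ f
  have hD : ∀ j, inner ℂ h (M1 j (g j)) - inner ℂ (g j) (M1 j h) + inner ℂ h (M2 j h) = 0 := by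
    intro j
    rw [weighted_density_identity hφ hφ' hη hs j, neg_add_cancel]
  simp_rw [inner_eq_integral] at hD
  have hsub : ∀ j, Integrable fun x => M1 j (g j) x * (starRingEnd ℂ) (h x) -
      M1 j h x * (starRingEnd ℂ) (g j x) := fun j =>
    (integrable_mul_conj _ _).sub (integrable_mul_conj _ _)
  have hadd : ∀ j, Integrable fun x => M1 j (g j) x * (starRingEnd ℂ) (h x) -
      M1 j h x * (starRingEnd ℂ) (g j x) + M2 j h x * (starRingEnd ℂ) (h x) := fun j =>
    (hsub j).add (integrable_mul_conj _ _)
  have hD' : ∫ x, ∑ j, (M1 j (g j) x * (starRingEnd ℂ) (h x) -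
      M1 j h x * (starRingEnd ℂ) (g j x) + M2 j h x * (starRingEnd ℂ) (h x)) = 0 := by
    rw [integral_finsetSum]
    · refine Finset.sum_eq_zero fun j _ => ?_
      rw [← hD j, integral_add (hsub j) (integrable_mul_conj _ _), integral_sub (integrable_mul_conj _ _) (integrable_mul_conj _ _)]
    · exact fun j _ => hadd j
  have hDi : Integrable fun x => ∑ j, (M1 j (g j) x * (starRingEnd ℂ) (h x) -
      M1 j h x * (starRingEnd ℂ) (g j x) + M2 j h x * (starRingEnd ℂ) (h x)) :=
    integrable_finsetSum _ fun j _ => hadd j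
  have hLi : Integrable fun x => ∑ j, M2 j h x * (starRingEnd ℂ) (h x) :=
    integrable_finsetSum _ fun j _ => integrable_mul_conj _ _
  have e3 : (fun x => (∑ j, M2 j h x * (starRingEnd ℂ) (h x)).re) =ᵐ[volume]
      fun x => lap η x * ‖F x‖ ^ 2 := by
    filter_upwards [hF', ae_all_iff.2 fun j => hM2c j h] with x h1 h2
    have : ∀ j, M2 j h x * (starRingEnd ℂ) (h x) =
        ((fderiv ℝ (fun y => fderiv ℝ η y (basisVec j)) x (basisVec j) * ‖F x‖ ^ 2 : ℝ) : ℂ) := by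
      intro j
      rw [h2, h1, norm_mul, mul_pow, weight, Complex.norm_real]
      push_cast
      rw [← Complex.mul_conj' (h x), Real.norm_of_nonneg (Real.rpow_nonneg (bracket_pos x).le _)]
      ring
    simp_rw [this, ← Complex.ofReal_sum, Complex.ofReal_re, lap, Finset.sum_mul]
  rw [← integral_congr_ae e3]
  -- The density identity minus twice the weak equation has integral zero. Its integrand has real
  -- part `Δη |u|² - 2η (|(P-A)u|² + V|u|²)`, which is at most `Δη |u|²`.
  have hDW : Integrable fun x => (∑ j, (M1 j (g j) x * (starRingEnd ℂ) (h x) -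
      M1 j h x * (starRingEnd ℂ) (g j x) + M2 j h x * (starRingEnd ℂ) (h x))) -
      2 * ((∑ j, (g j x - (A x j : ℂ) * h x) * (starRingEnd ℂ) (weight (-r) x *
      weight (-r) x * (-Complex.I * ((fderiv ℝ η x (basisVec j) : ℝ) : ℂ) * h x +
        (η x : ℂ) * (g j x - (A x j : ℂ) * h x)))) +
      (V x : ℂ) * h x * (starRingEnd ℂ) (weight (-r) x * weight (-r) x * (η x : ℂ) * h x)) :=
    hDi.sub (hi.const_mul 2)
  have hzero : ∫ x, ((∑ j, (M1 j (g j) x * (starRingEnd ℂ) (h x) -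
      M1 j h x * (starRingEnd ℂ) (g j x) + M2 j h x * (starRingEnd ℂ) (h x))) -
      2 * ((∑ j, (g j x - (A x j : ℂ) * h x) * (starRingEnd ℂ) (weight (-r) x *
      weight (-r) x * (-Complex.I * ((fderiv ℝ η x (basisVec j) : ℝ) : ℂ) * h x +
        (η x : ℂ) * (g j x - (A x j : ℂ) * h x)))) +
      (V x : ℂ) * h x * (starRingEnd ℂ) (weight (-r) x * weight (-r) x * (η x : ℂ) * h x))) = 0 := by
    rw [integral_sub hDi (hi.const_mul 2), integral_const_mul, ← hI, hW, hD']; simp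
  have hre := congrArg Complex.re hzero
  rw [← RCLike.re_eq_complex_re, ← integral_re hDW, map_zero] at hre
  rw [← hre]
  refine integral_mono_ae hDW.re hLi.re ?_
  filter_upwards [ae_all_iff.2 fun j => hM1c j (g j), ae_all_iff.2 fun j => hM1c j h,
    ae_all_iff.2 fun j => hM2c j h] with x h1 h2 h3
  simp only [RCLike.re_eq_complex_re, h1, h2, h3]
  rw [weight]
  set w := bracket x ^ (-r) with hw
  -- The terms with `∂_j η` cancel: both are multiples of `Im (g_j h̄)`, as `A_j |h|²` is real. The
  -- only trace of the magnetic potential is the square `|g_j - A_j h|²`.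
  have key : ∀ j, ((Complex.I * ((w : ℂ) * (w : ℂ) * ((fderiv ℝ η x (basisVec j) : ℝ) : ℂ)) * g j x *
      (starRingEnd ℂ) (h x) -
      Complex.I * ((w : ℂ) * (w : ℂ) * ((fderiv ℝ η x (basisVec j) : ℝ) : ℂ)) * h x *
        (starRingEnd ℂ) (g j x) +
      1 * ((w : ℂ) * (w : ℂ) * ((fderiv ℝ (fun y => fderiv ℝ η y (basisVec j)) x (basisVec j) : ℝ) : ℂ))
        * h x * (starRingEnd ℂ) (h x)) -
      2 * ((g j x - (A x j : ℂ) * h x) * (starRingEnd ℂ) ((w : ℂ) * (w : ℂ) *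
        (-Complex.I * ((fderiv ℝ η x (basisVec j) : ℝ) : ℂ) * h x +
        (η x : ℂ) * (g j x - (A x j : ℂ) * h x))))).re =
      (1 * ((w : ℂ) * (w : ℂ) * ((fderiv ℝ (fun y => fderiv ℝ η y (basisVec j)) x (basisVec j) : ℝ) : ℂ))
        * h x * (starRingEnd ℂ) (h x)).re -
      2 * w ^ 2 * η x * Complex.normSq (g j x - (A x j : ℂ) * h x) := by
    intro j
    rw [Complex.normSq_apply]
    simp [Complex.mul_re, Complex.mul_im, Complex.add_re, Complex.sub_re, Complex.sub_im,
      Complex.add_im]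
    ring
  have keyV : ((V x : ℂ) * h x * (starRingEnd ℂ) ((w : ℂ) * (w : ℂ) * (η x : ℂ) * h x)).re =
      w ^ 2 * (V x * η x) * Complex.normSq (h x) := by
    rw [Complex.normSq_apply]
    simp [Complex.mul_re, Complex.mul_im]
    ring
  have hsplit : ∀ a b c : Fin 3 → ℂ, ∀ d : ℂ, (∀ j, (a j - 2 * b j).re ≤ (c j).re) → 0 ≤ d.re →
      ((∑ j, a j) - 2 * ((∑ j, b j) + d)).re ≤ (∑ j, c j).re := by
    intro a b c d h1 h2
    simp only [Fin.sum_univ_three, Complex.sub_re, Complex.add_re, Complex.mul_re] at *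
    have := h1 0; have := h1 1; have := h1 2
    norm_num at *
    linarith
  apply hsplit
  · intro j
    rw [key]
    have := Complex.normSq_nonneg (g j x - (A x j : ℂ) * h x)
    have := hη0 x
    have : 0 ≤ 2 * w ^ 2 * η x * Complex.normSq (g j x - (A x j : ℂ) * h x) := by positivity
    linarith
  · rw [keyV]
    have := Complex.normSq_nonneg (h x)
    have := hη0 x
    have := hV0 x
    positivity

end

end MagneticSchrodinger
end

noncomputable section

namespace MagneticSchrodinger

open FourierTransform Set Filter Topology

/-! ## A superharmonic weight -/

theorem hasFDerivAt_bracket (x : E3) :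
    HasFDerivAt bracket ((bracket x)⁻¹ • innerSL ℝ x) x := by
  have h1 : HasFDerivAt (fun y : E3 => 1 + ‖y‖ ^ 2) (2 • innerSL ℝ x) x :=
    (hasStrictFDerivAt_norm_sq x).hasFDerivAt.const_add 1
  have h2 := h1.sqrt (by positivity)
  refine h2.congr_fderiv ?_
  ext v
  simp only [smul_apply, smul_eq_mul, nsmul_eq_mul]
  change 1 / (2 * bracket x) * (_ * _) = _
  have := (bracket_pos x).ne'
  field_simp
  norm_num

theorem contDiff_bracket : ContDiff ℝ ∞ bracket :=
  (contDiff_const.add (contDiff_norm_sq ℝ)).sqrt fun x => by positivity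

theorem contDiff_bracket_inv : ContDiff ℝ ∞ fun x : E3 => (bracket x)⁻¹ :=
  contDiff_bracket.inv fun x => (bracket_pos x).ne'

theorem hasFDerivAt_bracket_inv (x : E3) : HasFDerivAt (fun x => (bracket x)⁻¹)
    (-((bracket x)⁻¹ ^ 3) • innerSL ℝ x) x := by
  have h := (hasDerivAt_inv (bracket_pos x).ne').comp_hasFDerivAt x (hasFDerivAt_bracket x)
  refine h.congr_fderiv ?_
  rw [smul_smul]
  congr 1
  have := (bracket_pos x).ne'
  field_simp

theorem partial_bracket_inv (j : Fin 3) (x : E3) :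
    fderiv ℝ (fun x => (bracket x)⁻¹) x (basisVec j) = -((bracket x)⁻¹ ^ 3) * x j := by
  rw [(hasFDerivAt_bracket_inv x).fderiv, smul_apply, innerSL_apply_apply, inner_basisVec,
    smul_eq_mul]

theorem partial_partial_bracket_inv (j : Fin 3) (x : E3) :
    fderiv ℝ (fun y => fderiv ℝ (fun x => (bracket x)⁻¹) y (basisVec j)) x (basisVec j) =
      3 * (bracket x)⁻¹ ^ 5 * x j ^ 2 - (bracket x)⁻¹ ^ 3 := by
  simp_rw [partial_bracket_inv]
  have h1 : HasFDerivAt (fun y : E3 => y j) (EuclideanSpace.proj j : E3 →L[ℝ] ℝ) x :=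
    (EuclideanSpace.proj j : E3 →L[ℝ] ℝ).hasFDerivAt
  have h2 : HasFDerivAt (fun y => -((bracket y)⁻¹ ^ 3) * y j) _ x :=
    ((hasFDerivAt_bracket_inv x).pow 3).neg.mul h1
  rw [h2.fderiv]
  simp only [add_apply, smul_apply, neg_apply, innerSL_apply_apply, inner_basisVec, smul_eq_mul,
    nsmul_eq_mul]
  simp
  ring

/-- In dimension three the trace is `3|x|²⟨x⟩⁻⁵ - 3⟨x⟩⁻³`, and `⟨x⟩² - |x|² = 1` leaves a strictly
negative remainder: `⟨x⟩⁻¹` is a smoothed multiple of the Newton kernel. -/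
theorem lap_bracket_inv (x : E3) : lap (fun x => (bracket x)⁻¹) x = -3 * (bracket x)⁻¹ ^ 5 := by
  have h : ∑ j, x j ^ 2 = bracket x ^ 2 - 1 := by
    rw [bracket_sq, EuclideanSpace.real_norm_sq_eq]; ring
  simp_rw [lap, partial_partial_bracket_inv, Finset.sum_sub_distrib, ← Finset.mul_sum, h]
  have := (bracket_pos x).ne'
  simp
  field_simp
  ring

theorem lap_mul {a b : E3 → ℝ} (ha : ContDiff ℝ ∞ a) (hb : ContDiff ℝ ∞ b) (x : E3) :
    lap (fun x => a x * b x) x = a x * lap b x +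
      ∑ j, (2 * (fderiv ℝ a x (basisVec j) * fderiv ℝ b x (basisVec j)) +
        fderiv ℝ (fun y => fderiv ℝ a y (basisVec j)) x (basisVec j) * b x) := by
  have had := ha.differentiable (by simp)
  have hbd := hb.differentiable (by simp)
  have h1 : ∀ j, (fun y => fderiv ℝ (fun x => a x * b x) y (basisVec j)) =
      fun y => a y * fderiv ℝ b y (basisVec j) + b y * fderiv ℝ a y (basisVec j) := by
    intro j; funext y
    rw [fderiv_fun_mul (had y) (hbd y)]
    simp
  rw [lap, lap, Finset.mul_sum, ← Finset.sum_add_distrib]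
  refine Finset.sum_congr rfl fun j _ => ?_
  have h2 : HasFDerivAt (fun y => a y * fderiv ℝ b y (basisVec j) + b y * fderiv ℝ a y (basisVec j))
      _ x := ((had x).hasFDerivAt.mul
        ((contDiff_partial hb (basisVec j)).differentiable (by simp) x).hasFDerivAt).add
      ((hbd x).hasFDerivAt.mul
        ((contDiff_partial ha (basisVec j)).differentiable (by simp) x).hasFDerivAt)
  rw [h1, h2.fderiv]
  simp
  ring

/-- Cutoffs of `⟨x⟩⁻¹` whose Laplacians converge to that of `⟨x⟩⁻¹` under the bound `⟨x⟩⁻³`. -/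
theorem exists_cutoff : ∃ (η : ℕ → E3 → ℝ) (K : ℝ), (∀ n, ContDiff ℝ ∞ (η n)) ∧
    (∀ n, HasCompactSupport (η n)) ∧ (∀ n x, 0 ≤ η n x) ∧
    (∀ n x, |lap (η n) x| ≤ K * (bracket x)⁻¹ ^ 3) ∧
    ∀ x, Tendsto (fun n => lap (η n) x) atTop (𝓝 (-3 * (bracket x)⁻¹ ^ 5)) := by
  let χ : ContDiffBump (0 : E3) := ⟨1, 2, one_pos, one_lt_two⟩
  have hχ : ContDiff ℝ ∞ χ := χ.contDiff
  have hχs : HasCompactSupport χ := χ.hasCompactSupport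
  set c : ℕ → ℝ := fun n => 1 / ((n : ℝ) + 1) with hc
  have hc0 : ∀ n, 0 < c n := fun n => by positivity
  have hc1 : ∀ n, c n ≤ 1 := fun n => by
    rw [hc]; exact (div_le_one (by positivity)).2 (by linarith [n.cast_nonneg (α := ℝ)])
  have hct : Tendsto c atTop (𝓝 0) := tendsto_one_div_add_atTop_nhds_zero_nat
  set d1 : Fin 3 → E3 → ℝ := fun j y => fderiv ℝ χ y (basisVec j) with hd1
  set d2 : Fin 3 → E3 → ℝ := fun j y => fderiv ℝ (d1 j) y (basisVec j) with hd2
  have hd1c : ∀ j, ContDiff ℝ ∞ (d1 j) := fun j => contDiff_partial hχ _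
  have hd2c : ∀ j, ContDiff ℝ ∞ (d2 j) := fun j => contDiff_partial (hd1c j) _
  have hd1s : ∀ j, HasCompactSupport (d1 j) := fun j => hasCompactSupport_partial hχs _
  have hd2s : ∀ j, HasCompactSupport (d2 j) := fun j => hasCompactSupport_partial (hd1s j) _
  -- A derivative of the scaled cutoff costs a factor `c n`. These bounds, with `c n · ⟨x⟩ ≤ 1 + ‖c
  -- n • x‖`, convert each such factor into `⟨x⟩⁻¹` uniformly in `n`, so every term of the Laplacian
  -- is `O(⟨x⟩⁻³)`.
  have hb1 : ∀ j, ∃ K, ∀ y, ‖d1 j y * (1 + ‖y‖)‖ ≤ K := fun j =>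
    (hd1s j).mul_right.exists_bound_of_continuous
      ((hd1c j).continuous.mul (continuous_const.add continuous_norm))
  have hb2 : ∀ j, ∃ K, ∀ y, ‖d2 j y * (1 + ‖y‖) ^ 2‖ ≤ K := fun j =>
    (hd2s j).mul_right.exists_bound_of_continuous
      ((hd2c j).continuous.mul ((continuous_const.add continuous_norm).pow 2))
  choose K1 hK1 using hb1
  choose K2 hK2 using hb2
  have hp1 : ∀ n j, (fun y => fderiv ℝ (fun x => χ (c n • x)) y (basisVec j)) =
      fun y => c n * d1 j (c n • y) := by
    intro n j; funext y
    rw [fderiv_comp_smul, smul_apply, smul_eq_mul]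
  have hp2 : ∀ n j x, fderiv ℝ (fun y => fderiv ℝ (fun x => χ (c n • x)) y (basisVec j)) x
      (basisVec j) = c n ^ 2 * d2 j (c n • x) := by
    intro n j x
    have := fderiv_comp_smul (𝕜 := ℝ) (f := d1 j) (c n) (x := x)
    rw [hp1, fderiv_const_mul, this]
    · simp only [smul_apply, smul_eq_mul, hd2]; ring
    · exact (((hd1c j).comp (contDiff_const_smul _)).differentiable (by simp)) x
  have hsm : ∀ n, ContDiff ℝ ∞ fun x => χ (c n • x) := fun n => hχ.comp (contDiff_const_smul _)
  have hlap : ∀ n x, lap (fun x => χ (c n • x) * (bracket x)⁻¹) x =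
      χ (c n • x) * (-3 * (bracket x)⁻¹ ^ 5) +
      ∑ j, (2 * (c n * d1 j (c n • x) * (-((bracket x)⁻¹ ^ 3) * x j)) +
        c n ^ 2 * d2 j (c n • x) * (bracket x)⁻¹) := by
    intro n x
    rw [lap_mul (hsm n) contDiff_bracket_inv, lap_bracket_inv]
    simp_rw [hp2, partial_bracket_inv]
    congr 1
    refine Finset.sum_congr rfl fun j _ => ?_
    rw [congrFun (hp1 n j) x]
  have hcb : ∀ n x, c n * bracket x ≤ 1 + ‖c n • x‖ := by
    intro n x
    have h1 : bracket x ≤ 1 + ‖x‖ := by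
      have := bracket_sub_le x 0
      simpa [bracket] using this
    rw [norm_smul, Real.norm_of_nonneg (hc0 n).le]
    nlinarith [hc0 n, hc1 n, norm_nonneg x]
  refine ⟨fun n x => χ (c n • x) * (bracket x)⁻¹, 3 + ∑ j, (2 * K1 j + K2 j), fun n =>
    (hsm n).mul contDiff_bracket_inv, fun n => ?_, fun n x => ?_, fun n x => ?_, fun x => ?_⟩
  · exact (hχs.comp_smul (hc0 n).ne').mul_right
  · exact mul_nonneg χ.nonneg (inv_nonneg.2 (bracket_pos x).le)
  · rw [hlap]
    set b := (bracket x)⁻¹ with hb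
    have hb0 : 0 < b := inv_pos.2 (bracket_pos x)
    have hb1 : b ≤ 1 := inv_le_one_of_one_le₀ (one_le_bracket x)
    have hbb : bracket x * b = 1 := mul_inv_cancel₀ (bracket_pos x).ne'
    refine (abs_add_le _ _).trans ?_
    rw [add_mul, Finset.sum_mul]
    refine add_le_add ?_ ((Finset.abs_sum_le_sum_abs _ _).trans (Finset.sum_le_sum fun j _ => ?_))
    · rw [abs_mul, abs_of_nonneg χ.nonneg, abs_mul, abs_of_nonneg (by positivity : 0 ≤ b ^ 5)]
      have h1 : χ (c n • x) ≤ 1 := χ.le_one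
      have h2 : b ^ 5 ≤ b ^ 3 := pow_le_pow_of_le_one hb0.le hb1 (by norm_num)
      have h3 : 0 ≤ χ (c n • x) := χ.nonneg
      have h4 : 0 ≤ b ^ 5 := by positivity
      norm_num
      nlinarith
    · have hx : |x j| ≤ bracket x := (PiLp.norm_apply_le x j).trans (norm_le_bracket x)
      have e1 : c n * |d1 j (c n • x)| ≤ K1 j * b := by
        have := (hK1 j (c n • x))
        rw [norm_mul, Real.norm_eq_abs, Real.norm_of_nonneg (by positivity)] at this
        have h2 := mul_le_mul_of_nonneg_left (hcb n x) (abs_nonneg (d1 j (c n • x)))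
        calc c n * |d1 j (c n • x)| = |d1 j (c n • x)| * (c n * bracket x) * b := by
              linear_combination (-(c n * |d1 j (c n • x)|)) * hbb
          _ ≤ _ := by gcongr; exact h2.trans this
      have e2 : c n ^ 2 * |d2 j (c n • x)| ≤ K2 j * b ^ 2 := by
        have := (hK2 j (c n • x))
        rw [norm_mul, Real.norm_eq_abs, Real.norm_of_nonneg (by positivity)] at this
        have h2 := mul_le_mul_of_nonneg_left
          (pow_le_pow_left₀ (mul_pos (hc0 n) (bracket_pos x)).le (hcb n x) 2)
          (abs_nonneg (d2 j (c n • x)))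
        calc c n ^ 2 * |d2 j (c n • x)| = |d2 j (c n • x)| * (c n * bracket x) ^ 2 * b ^ 2 := by
              linear_combination (-(c n ^ 2 * |d2 j (c n • x)|)) * (bracket x * b + 1) * hbb
          _ ≤ _ := by gcongr; exact h2.trans this
      refine (abs_add_le _ _).trans ?_
      rw [add_mul]
      simp only [abs_mul, abs_neg, abs_pow, abs_of_pos (hc0 n), abs_of_pos hb0]
      norm_num
      have e3 : b ^ 3 * |x j| ≤ b ^ 2 := by
        calc b ^ 3 * |x j| ≤ b ^ 3 * bracket x := by gcongr
          _ = b ^ 2 := by linear_combination b ^ 2 * hbb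
      have hK1' : 0 ≤ K1 j * b := le_trans (mul_nonneg (hc0 n).le (abs_nonneg _)) e1
      refine add_le_add ?_ ?_
      · calc 2 * (c n * |d1 j (c n • x)| * (b ^ 3 * |x j|)) ≤ 2 * (K1 j * b * b ^ 2) := by
              gcongr
          _ = _ := by ring
      · calc c n ^ 2 * |d2 j (c n • x)| * b ≤ K2 j * b ^ 2 * b := by gcongr
          _ = _ := by ring
  · simp_rw [hlap]
    have ht : Tendsto (fun n => c n • x) atTop (𝓝 0) := by
      simpa using hct.smul_const x
    have h0 : Tendsto (fun n => χ (c n • x)) atTop (𝓝 1) := by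
      have := (hχ.continuous.tendsto 0).comp ht
      rwa [χ.one_of_mem_closedBall (Metric.mem_closedBall_self χ.rIn_pos.le)] at this
    have h1 : ∀ j, Tendsto (fun n => d1 j (c n • x)) atTop (𝓝 (d1 j 0)) := fun j =>
      ((hd1c j).continuous.tendsto 0).comp ht
    have h2 : ∀ j, Tendsto (fun n => d2 j (c n • x)) atTop (𝓝 (d2 j 0)) := fun j =>
      ((hd2c j).continuous.tendsto 0).comp ht
    have := (h0.mul_const (-3 * (bracket x)⁻¹ ^ 5)).add (tendsto_finsetSum Finset.univ fun j _ =>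
      ((((hct.mul (h1 j)).mul_const (-((bracket x)⁻¹ ^ 3) * x j)).const_mul 2).add
        (((hct.pow 2).mul (h2 j)).mul_const (bracket x)⁻¹)))
    simpa using this

/-! ## Absence of zero-energy solutions -/

theorem toD_eq_zero_of_representedBy {u : 𝓢'(E3, ℂ)} {F : E3 → ℂ} (hF : RepresentedBy u F)
    (h : F =ᵐ[volume] 0) : u = 0 := by
  ext φ
  rw [(hF φ).2]
  have : (fun x => F x * φ x) =ᵐ[volume] 0 := by
    filter_upwards [h] with x hx; simp [hx]
  rw [integral_congr_ae this]; simp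

/-- Subharmonicity of `|u|²` is played against the superharmonic weight `⟨x⟩⁻¹`. The limit of the
cutoffs is `0 ≤ -3 ∫ ⟨x⟩⁻⁵ |u|²`. The threshold `3/2` is the one for which `⟨x⟩⁻³ |u|²`, the
majorant for dominated convergence, is integrable. -/
theorem eq_zero_of_solvesZeroEnergy {A : E3 → E3} (hA : ∀ j, MemLp (fun x => (A x j : ℂ)) ⊤ volume)
    {V : E3 → ℝ} (hV : MemLp (fun x => (V x : ℂ)) ⊤ volume) (hV0 : ∀ x, 0 ≤ V x) {s : ℝ}
    (hs : s ≤ 3 / 2) {u : 𝓢'(E3, ℂ)} (hu : u ∈ weightedSobolev 1 (-s))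
    (sol : SolvesZeroEnergy A V u) : u = 0 := by
  obtain ⟨h, g, hh, -, -⟩ := exists_approx_of_mem hu
  have hF := representedBy_of_weightD hh
  rw [neg_neg] at hF
  set F : E3 → ℂ := fun x => weight s x * h x with hFdef
  have hFm : AEStronglyMeasurable F volume :=
    (continuous_weight s).aestronglyMeasurable.mul (Lp.aestronglyMeasurable h)
  have hn : ∀ x, ‖F x‖ = bracket x ^ s * ‖h x‖ := fun x => by
    rw [hFdef]
    simp only [norm_mul, weight, Complex.norm_real]
    rw [Real.norm_of_nonneg (Real.rpow_nonneg (bracket_pos x).le _)]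
  have hh2 : Integrable fun x => ‖h x‖ ^ 2 := (Lp.memLp h).integrable_norm_pow (by norm_num)
  have hbi : AEStronglyMeasurable (fun x : E3 => (bracket x)⁻¹) volume :=
    contDiff_bracket_inv.continuous.aestronglyMeasurable
  have hint : Integrable fun x => (bracket x)⁻¹ ^ 3 * ‖F x‖ ^ 2 := by
    refine hh2.mono' ((hbi.pow 3).mul (hFm.norm.pow 2)) (ae_of_all _ fun x => ?_)
    rw [hn, Real.norm_of_nonneg (by have := bracket_pos x; positivity), mul_pow, ← mul_assoc]
    refine mul_le_of_le_one_left (by positivity) ?_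
    have hb := bracket_pos x
    have h1 : bracket x ^ s ≤ bracket x ^ (3 / 2 : ℝ) :=
      Real.rpow_le_rpow_of_exponent_le (one_le_bracket x) hs
    have h2 : (bracket x ^ (3 / 2 : ℝ)) ^ 2 = bracket x ^ 3 := by
      rw [← Real.rpow_natCast, ← Real.rpow_mul hb.le, ← Real.rpow_natCast]; norm_num
    calc (bracket x)⁻¹ ^ 3 * (bracket x ^ s) ^ 2
        ≤ (bracket x)⁻¹ ^ 3 * (bracket x ^ (3 / 2 : ℝ)) ^ 2 := by gcongr
      _ = 1 := by rw [h2, ← mul_pow, inv_mul_cancel₀ hb.ne', one_pow]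
  obtain ⟨η, K, hη, hηs, hη0, hK, hlim⟩ := exists_cutoff
  have hpos : ∀ n, 0 ≤ ∫ x, lap (η n) x * ‖F x‖ ^ 2 := fun n =>
    integral_lap_mul_nonneg hA hV (hη n) (hηs n) (-s) hu sol hV0 (hη0 n) hF
  have ht : Tendsto (fun n => ∫ x, lap (η n) x * ‖F x‖ ^ 2) atTop
      (𝓝 (∫ x, -3 * (bracket x)⁻¹ ^ 5 * ‖F x‖ ^ 2)) := by
    refine tendsto_integral_of_dominated_convergence _ (fun n =>
      (continuous_lap (hη n)).aestronglyMeasurable.mul (hFm.norm.pow 2)) (hint.const_mul K)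
      (fun n => ae_of_all _ fun x => ?_) (ae_of_all _ fun x => (hlim x).mul_const _)
    rw [norm_mul, Real.norm_eq_abs, norm_pow, norm_norm, ← mul_assoc]
    exact mul_le_mul_of_nonneg_right (hK n x) (by positivity)
  have h5 : Integrable fun x => (bracket x)⁻¹ ^ 5 * ‖F x‖ ^ 2 := by
    refine hint.mono' ((hbi.pow 5).mul (hFm.norm.pow 2)) (ae_of_all _ fun x => ?_)
    have hb := bracket_pos x
    rw [Real.norm_of_nonneg (by positivity)]
    exact mul_le_mul_of_nonneg_right (pow_le_pow_of_le_one (inv_nonneg.2 hb.le)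
      (inv_le_one_of_one_le₀ (one_le_bracket x)) (by norm_num)) (by positivity)
  have hle : 0 ≤ ∫ x, -3 * (bracket x)⁻¹ ^ 5 * ‖F x‖ ^ 2 := ge_of_tendsto' ht hpos
  simp_rw [mul_assoc, integral_const_mul] at hle
  have hge : 0 ≤ fun x => (bracket x)⁻¹ ^ 5 * ‖F x‖ ^ 2 := fun x => by
    have hb := bracket_pos x
    positivity
  have hz : ∫ x, (bracket x)⁻¹ ^ 5 * ‖F x‖ ^ 2 = 0 :=
    le_antisymm (by linarith) (integral_nonneg hge)
  rw [integral_eq_zero_iff_of_nonneg hge h5] at hz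
  refine toD_eq_zero_of_representedBy hF ?_
  filter_upwards [hz] with x hx
  have hb := (bracket_pos x).ne'
  simpa [hb] using hx

theorem solvesZeroEnergy_zero (A : E3 → E3) (V : E3 → ℝ) : SolvesZeroEnergy A V 0 := by
  have h0 : RepresentedBy 0 0 := fun φ => by simp
  refine ⟨0, 0, h0, fun j => ?_, fun φ _ _ => by simp⟩
  have : momentum j (0 : 𝓢'(E3, ℂ)) = 0 := by rw [← momentumD_apply, map_zero]
  rw [this]; exact h0

theorem DecaysLike.bound {F : Type*} [Norm F] {r : ℝ} {f : E3 → F} (hf : DecaysLike r f)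
    (hr : r ≤ 0) : ∃ c, 0 ≤ c ∧ ∀ x, ‖f x‖ ≤ c := by
  obtain ⟨c, hc⟩ := hf
  refine ⟨|c|, abs_nonneg c, fun x => (hc x).trans ?_⟩
  have h1 : bracket x ^ r ≤ 1 := Real.rpow_le_one_of_one_le_of_nonpos (one_le_bracket x) hr
  have h2 : 0 ≤ bracket x ^ r := Real.rpow_nonneg (bracket_pos x).le _
  calc c * bracket x ^ r ≤ |c| * bracket x ^ r := by gcongr; exact le_abs_self c
    _ ≤ |c| * 1 := by gcongr
    _ = |c| := mul_one _

theorem IsVectorPotential.memLp_top {β : ℝ} (hβ : 0 ≤ β) {B A : E3 → E3}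
    (hA : IsVectorPotential β B A) (j : Fin 3) : MemLp (fun x => (A x j : ℂ)) ⊤ volume := by
  obtain ⟨c, -, hc⟩ := hA.decay.bound (by linarith)
  refine memLp_top_of_forall_norm_le (K := c) ?_ fun x => ?_
  · exact (Complex.continuous_ofReal.comp ((EuclideanSpace.proj j : E3 →L[ℝ] ℝ).continuous.comp
      hA.contDiff.continuous)).aestronglyMeasurable
  · rw [Complex.norm_real]; exact (PiLp.norm_apply_le _ j).trans (hc x)

theorem IsElectricPotential.memLp_top {β : ℝ} (hβ : 0 ≤ β) {V : E3 → ℝ}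
    (hV : IsElectricPotential β V) : MemLp (fun x => (V x : ℂ)) ⊤ volume := by
  obtain ⟨c, -, hc⟩ := hV.decay.bound (by linarith)
  refine memLp_top_of_forall_norm_le (K := c)
    (Complex.measurable_ofReal.comp_aemeasurable hV.aemeasurable).aestronglyMeasurable fun x => ?_
  rw [Complex.norm_real]; exact hc x

theorem zeroEnergySolutions_eq {A : E3 → E3} (hA : ∀ j, MemLp (fun x => (A x j : ℂ)) ⊤ volume)
    {V : E3 → ℝ} (hV : MemLp (fun x => (V x : ℂ)) ⊤ volume) (hV0 : ∀ x, 0 ≤ V x) {s : ℝ}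
    (hs : s ≤ 3 / 2) : zeroEnergySolutions A V s = {0} := by
  ext u
  refine ⟨fun hu => eq_zero_of_solvesZeroEnergy hA hV hV0 hs hu.1 hu.2, ?_⟩
  rintro rfl
  exact ⟨zero_mem _, solvesZeroEnergy_zero A V⟩

theorem nullSpace_eq {A : E3 → E3} (hA : ∀ j, MemLp (fun x => (A x j : ℂ)) ⊤ volume)
    {V : E3 → ℝ} (hV : MemLp (fun x => (V x : ℂ)) ⊤ volume) (hV0 : ∀ x, 0 ≤ V x) :
    nullSpace A V = {0} := by
  ext u
  -- Any exponent in `(1/2, 3/2]` would serve; `s = 1` is taken.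
  refine ⟨fun hu => eq_zero_of_solvesZeroEnergy hA hV hV0 (s := 1) (by norm_num)
    (hu.1 (-1) (by norm_num)) hu.2, ?_⟩
  rintro rfl
  exact ⟨fun r _ => zero_mem _, solvesZeroEnergy_zero A V⟩

end MagneticSchrodinger
end

noncomputable section

namespace MagneticSchrodinger

open FourierTransform Set Filter Topology

/-! ## Hardy's inequality -/

theorem integrable_norm_sq (f : 𝓢(E3, ℂ)) : Integrable fun x => ‖f x‖ ^ 2 :=
  (f.memLp 2 volume).integrable_norm_pow (by norm_num)

theorem hasFDerivAt_norm_sq_schwartz (f : 𝓢(E3, ℂ)) (x : E3) :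
    HasFDerivAt (fun y => ‖f y‖ ^ 2) (2 • (innerSL ℝ (f x)).comp (fderiv ℝ f x)) x :=
  (f.hasFDerivAt x).norm_sq

theorem fderiv_norm_sq_schwartz (f : 𝓢(E3, ℂ)) (x v : E3) :
    fderiv ℝ (fun y => ‖f y‖ ^ 2) x v = 2 * inner ℝ (f x) (fderiv ℝ f x v) := by
  rw [(hasFDerivAt_norm_sq_schwartz f x).fderiv, smul_apply, nsmul_eq_mul]
  rfl

theorem norm_fderiv_basisVec (f : 𝓢(E3, ℂ)) (x : E3) (j : Fin 3) :
    ‖fderiv ℝ f x (basisVec j)‖ = ‖momentumS j f x‖ := by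
  rw [momentumS_apply]; simp

/-- Integration by parts against the field `x/(ε + |x|²)`. With `w = (ε + |x|²)⁻¹` its divergence is
`3w - 2w²|x|² ≥ w`. The gradient term is split by Young's inequality so that half of the left side
can be absorbed, which gives the classical constant `4`. -/
theorem hardy_regularized (f : 𝓢(E3, ℂ)) {ε : ℝ} (hε : 0 < ε) :
    Integrable (fun x => (ε + ‖x‖ ^ 2)⁻¹ * ‖f x‖ ^ 2) ∧
    ∫ x, (ε + ‖x‖ ^ 2)⁻¹ * ‖f x‖ ^ 2 ≤ 4 * ∑ j, ∫ x, ‖momentumS j f x‖ ^ 2 := by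
  set w : E3 → ℝ := fun x => (ε + ‖x‖ ^ 2)⁻¹ with hw
  have hpos : ∀ x : E3, 0 < ε + ‖x‖ ^ 2 := fun x => by positivity
  have hw0 : ∀ x, 0 < w x := fun x => inv_pos.2 (hpos x)
  have hw1 : ∀ x, w x * (ε + ‖x‖ ^ 2) = 1 := fun x => inv_mul_cancel₀ (hpos x).ne'
  have hwε : ∀ x, w x ≤ ε⁻¹ := fun x => inv_anti₀ hε (by nlinarith [sq_nonneg ‖x‖])
  have hwr : ∀ x, w x * ‖x‖ ^ 2 ≤ 1 := fun x => by nlinarith [hw0 x, hw1 x]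
  have hwc : Continuous w := by
    refine Continuous.inv₀ (by fun_prop) fun x => (hpos x).ne'
  have hdw : ∀ x, HasFDerivAt w (-(2 * w x ^ 2) • innerSL ℝ x) x := by
    intro x
    have h1 : HasFDerivAt (fun y : E3 => ε + ‖y‖ ^ 2) (2 • innerSL ℝ x) x :=
      (hasStrictFDerivAt_norm_sq x).hasFDerivAt.const_add ε
    have h2 := (hasDerivAt_inv (hpos x).ne').comp_hasFDerivAt x h1
    refine h2.congr_fderiv ?_
    ext v
    simp [hw]
    ring
  have hxj : ∀ (x : E3) (j : Fin 3), |x j| ≤ ‖x‖ := fun x j => PiLp.norm_apply_le x j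
  have hdv : ∀ (j : Fin 3) x, HasFDerivAt (fun y : E3 => w y * y j)
      (w x • (EuclideanSpace.proj j : E3 →L[ℝ] ℝ) + x j • (-(2 * w x ^ 2) • innerSL ℝ x)) x :=
    fun j x => (hdw x).mul (EuclideanSpace.proj j : E3 →L[ℝ] ℝ).hasFDerivAt
  have hdv' : ∀ (j : Fin 3) x, fderiv ℝ (fun y : E3 => w y * y j) x (basisVec j) =
      w x - 2 * w x ^ 2 * x j ^ 2 := by
    intro j x
    rw [(hdv j x).fderiv]
    simp only [add_apply, smul_apply, innerSL_apply_apply, inner_basisVec, smul_eq_mul]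
    simp
    ring
  have hN := integrable_norm_sq f
  have hxc : ∀ j : Fin 3, Continuous fun x : E3 => x j := fun j =>
    (EuclideanSpace.proj j : E3 →L[ℝ] ℝ).continuous
  have hb : ∀ {c : E3 → ℝ} {g : E3 → ℝ}, Continuous c → ∀ K, (∀ x, |c x| ≤ K) → Integrable g →
      Integrable fun x => c x * g x := by
    intro c g hc K hK hg
    exact hg.bdd_mul hc.aestronglyMeasurable (ae_of_all _ hK)
  have hwN : Integrable fun x => w x * ‖f x‖ ^ 2 :=
    hb hwc ε⁻¹ (fun x => by rw [abs_of_pos (hw0 x)]; exact hwε x) hN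
  have hin : ∀ j, Integrable fun x => 2 * inner ℝ (f x) (fderiv ℝ f x (basisVec j)) := by
    intro j
    refine (hN.add (integrable_norm_sq (momentumS j f))).mono' ?_ (ae_of_all _ fun x => ?_)
    · exact (continuous_const.mul (f.continuous.inner
        ((f.smooth 1).continuous_fderiv one_ne_zero |>.clm_apply continuous_const))).aestronglyMeasurable
    · have h1 := abs_real_inner_le_norm (f x) (fderiv ℝ f x (basisVec j))
      rw [norm_fderiv_basisVec] at h1
      rw [Real.norm_eq_abs, abs_mul, abs_two, Pi.add_apply]
      nlinarith [sq_nonneg (‖f x‖ - ‖momentumS j f x‖)]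
  have hi1 : ∀ j : Fin 3, Integrable fun x => (w x - 2 * w x ^ 2 * x j ^ 2) * ‖f x‖ ^ 2 := by
    intro j
    refine hb (by have := hxc j; fun_prop) (3 * ε⁻¹) (fun x => ?_) hN
    have h2 : x j ^ 2 ≤ ‖x‖ ^ 2 := sq_le_sq' (abs_le.1 (hxj x j)).1 (abs_le.1 (hxj x j)).2
    have h3 : w x ^ 2 * x j ^ 2 ≤ w x := by nlinarith [hw0 x, hwr x, mul_pos (hw0 x) (hw0 x)]
    have h4 : 0 ≤ w x ^ 2 * x j ^ 2 := by positivity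
    rw [abs_le]
    constructor <;> nlinarith [hwε x, hw0 x]
  have hi2 : ∀ j : Fin 3, Integrable fun x =>
      (w x * x j) * (2 * inner ℝ (f x) (fderiv ℝ f x (basisVec j))) := by
    intro j
    refine hb (hwc.mul (hxc j)) (ε⁻¹ + 1) (fun x => ?_) (hin j)
    rw [abs_mul, abs_of_pos (hw0 x)]
    have : ‖x‖ ≤ 1 + ‖x‖ ^ 2 := by nlinarith [sq_nonneg (‖x‖ - 1)]
    nlinarith [hxj x j, hw0 x, hwε x, hwr x]
  have hi3 : ∀ j : Fin 3, Integrable fun x => (w x * x j) * ‖f x‖ ^ 2 := by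
    intro j
    refine hb (hwc.mul (hxc j)) (ε⁻¹ + 1) (fun x => ?_) hN
    rw [abs_mul, abs_of_pos (hw0 x)]
    have : ‖x‖ ≤ 1 + ‖x‖ ^ 2 := by nlinarith [sq_nonneg (‖x‖ - 1)]
    nlinarith [hxj x j, hw0 x, hwε x, hwr x]
  have hparts : ∀ j : Fin 3, ∫ x, ((w x - 2 * w x ^ 2 * x j ^ 2) * ‖f x‖ ^ 2 +
      (w x * x j) * (2 * inner ℝ (f x) (fderiv ℝ f x (basisVec j)))) = 0 := by
    intro j
    have := integral_mul_fderiv_eq_neg_fderiv_mul_of_integrable (μ := (volume : Measure E3))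
      (f := fun y : E3 => w y * y j) (g := fun x => ‖f x‖ ^ 2) (v := basisVec j)
      (by simp_rw [hdv']; exact hi1 j) (by simp_rw [fderiv_norm_sq_schwartz]; exact hi2 j) (hi3 j)
      (fun x _ => (hdv j x).differentiableAt)
      (fun x _ => (hasFDerivAt_norm_sq_schwartz f x).differentiableAt)
    simp_rw [hdv', fderiv_norm_sq_schwartz] at this
    rw [integral_add (hi1 j) (hi2 j), this, add_neg_cancel]
  refine ⟨hwN, ?_⟩
  -- With `w|x|² ≤ 1`, the sum of the first terms loses at most `½w|f|²` to Young's inequality. The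
  -- bracket whose integral vanishes is kept intact for `hparts`.
  have hpt : ∀ x, w x * ‖f x‖ ^ 2 ≤ ∑ j, ((w x - 2 * w x ^ 2 * x j ^ 2) * ‖f x‖ ^ 2 +
      (w x * x j) * (2 * inner ℝ (f x) (fderiv ℝ f x (basisVec j))) +
      2 * ‖momentumS j f x‖ ^ 2) + 1 / 2 * (w x * ‖f x‖ ^ 2) := by
    intro x
    have hj : ∀ j : Fin 3, (w x - 2 * w x ^ 2 * x j ^ 2) * ‖f x‖ ^ 2 -
        1 / 2 * w x ^ 2 * x j ^ 2 * ‖f x‖ ^ 2 ≤ (w x - 2 * w x ^ 2 * x j ^ 2) * ‖f x‖ ^ 2 +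
      (w x * x j) * (2 * inner ℝ (f x) (fderiv ℝ f x (basisVec j))) +
      2 * ‖momentumS j f x‖ ^ 2 := by
      intro j
      have h1 := abs_real_inner_le_norm (f x) (fderiv ℝ f x (basisVec j))
      rw [norm_fderiv_basisVec] at h1
      set i := inner ℝ (f x) (fderiv ℝ f x (basisVec j))
      have h2 : |(w x * x j) * (2 * i)| ≤ 2 * (w x * |x j| * ‖f x‖) * ‖momentumS j f x‖ := by
        rw [abs_mul, abs_mul, abs_mul, abs_two, abs_of_pos (hw0 x)]
        have : 0 ≤ w x * |x j| := by have := hw0 x; positivity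
        nlinarith
      have h3 := (abs_le.1 h2).1
      have h4 : (w x * |x j| * ‖f x‖) ^ 2 = w x ^ 2 * x j ^ 2 * ‖f x‖ ^ 2 := by
        rw [mul_pow, mul_pow, sq_abs]
      nlinarith [sq_nonneg (w x * |x j| * ‖f x‖ - 2 * ‖momentumS j f x‖)]
    have hsum := Finset.sum_le_sum fun j (_ : j ∈ Finset.univ) => hj j
    have hr : ‖x‖ ^ 2 = x 0 ^ 2 + x 1 ^ 2 + x 2 ^ 2 := by
      rw [EuclideanSpace.real_norm_sq_eq, Fin.sum_univ_three]
    have h5 : w x ^ 2 * ‖x‖ ^ 2 * ‖f x‖ ^ 2 ≤ w x * ‖f x‖ ^ 2 := by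
      have := mul_le_mul_of_nonneg_left (hwr x) (mul_nonneg (hw0 x).le (sq_nonneg ‖f x‖))
      nlinarith
    refine le_trans ?_ (add_le_add_left hsum _)
    rw [Fin.sum_univ_three]
    rw [hr] at h5
    nlinarith
  have hM := fun j => integrable_norm_sq (momentumS j f)
  have hi12 : ∀ j : Fin 3, Integrable fun x => (w x - 2 * w x ^ 2 * x j ^ 2) * ‖f x‖ ^ 2 +
      (w x * x j) * (2 * inner ℝ (f x) (fderiv ℝ f x (basisVec j))) := fun j => (hi1 j).add (hi2 j)
  have hi4 : ∀ j ∈ (Finset.univ : Finset (Fin 3)), Integrable fun x =>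
      (w x - 2 * w x ^ 2 * x j ^ 2) * ‖f x‖ ^ 2 +
      (w x * x j) * (2 * inner ℝ (f x) (fderiv ℝ f x (basisVec j))) +
      2 * ‖momentumS j f x‖ ^ 2 := fun j _ => (hi12 j).add ((hM j).const_mul 2)
  have hle := integral_mono hwN ((integrable_finsetSum _ hi4).add (hwN.const_mul (1 / 2))) hpt
  have e : ∫ x, (∑ j, ((w x - 2 * w x ^ 2 * x j ^ 2) * ‖f x‖ ^ 2 +
      (w x * x j) * (2 * inner ℝ (f x) (fderiv ℝ f x (basisVec j))) +
      2 * ‖momentumS j f x‖ ^ 2) + 1 / 2 * (w x * ‖f x‖ ^ 2)) =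
      2 * (∑ j, ∫ x, ‖momentumS j f x‖ ^ 2) + 1 / 2 * ∫ x, w x * ‖f x‖ ^ 2 := by
    rw [integral_add (integrable_finsetSum _ hi4) (hwN.const_mul (1 / 2)),
      integral_finsetSum _ hi4, integral_const_mul, Finset.mul_sum]
    congr 1
    refine Finset.sum_congr rfl fun j _ => ?_
    rw [integral_add (hi12 j) ((hM j).const_mul 2), hparts j, zero_add, integral_const_mul]
  have hle' : ∫ x, w x * ‖f x‖ ^ 2 ≤ _ := hle.trans_eq e
  change ∫ x, w x * ‖f x‖ ^ 2 ≤ _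
  linarith

theorem hardy (f : 𝓢(E3, ℂ)) : ∫⁻ x, ENNReal.ofReal ((‖x‖ ^ 2)⁻¹ * ‖f x‖ ^ 2) ≤
    ENNReal.ofReal (4 * ∑ j, ∫ x, ‖momentumS j f x‖ ^ 2) := by
  set ε : ℕ → ℝ := fun n => 1 / ((n : ℝ) + 1) with hε
  have hε0 : ∀ n, 0 < ε n := fun n => by positivity
  have hεt : Tendsto ε atTop (𝓝 0) := tendsto_one_div_add_atTop_nhds_zero_nat
  have hpos : ∀ n (x : E3), 0 < ε n + ‖x‖ ^ 2 := fun n x => by have := hε0 n; positivity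
  have hae : ∀ᵐ x : E3, x ≠ 0 := by simp [ae_iff]
  have hmeas : ∀ n, Measurable fun x => ENNReal.ofReal ((ε n + ‖x‖ ^ 2)⁻¹ * ‖f x‖ ^ 2) := by
    intro n
    have := f.continuous.measurable
    fun_prop
  calc ∫⁻ x, ENNReal.ofReal ((‖x‖ ^ 2)⁻¹ * ‖f x‖ ^ 2)
      ≤ ∫⁻ x, liminf (fun n => ENNReal.ofReal ((ε n + ‖x‖ ^ 2)⁻¹ * ‖f x‖ ^ 2)) atTop := by
        refine lintegral_mono_ae ?_
        filter_upwards [hae] with x hx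
        refine le_of_eq (Tendsto.liminf_eq ?_).symm
        refine (ENNReal.continuous_ofReal.tendsto _).comp ?_
        refine Tendsto.mul_const _ (Tendsto.inv₀ ?_ (by simpa using hx))
        simpa using hεt.add_const (‖x‖ ^ 2)
    -- Fatou's lemma removes the regularization; its right side does not depend on `ε`.
    _ ≤ liminf (fun n => ∫⁻ x, ENNReal.ofReal ((ε n + ‖x‖ ^ 2)⁻¹ * ‖f x‖ ^ 2)) atTop :=
        lintegral_liminf_le hmeas
    _ ≤ _ := by
        refine Filter.liminf_le_of_frequently_le' (Frequently.of_forall fun n => ?_)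
        obtain ⟨h1, h2⟩ := hardy_regularized f (hε0 n)
        rw [← ofReal_integral_eq_lintegral_ofReal h1
          (ae_of_all _ fun x => by have := hpos n x; positivity)]
        exact ENNReal.ofReal_le_ofReal h2

end MagneticSchrodinger
end

noncomputable section

namespace MagneticSchrodinger

open FourierTransform Set Filter Topology

/-! ## Fourier representations of the free resolvent at zero energy -/

theorem norm_toL_sq (f : 𝓢(E3, ℂ)) : ‖toL f‖ ^ 2 = ∫ x, ‖f x‖ ^ 2 := by
  have h := inner_self_eq_norm_sq_to_K (𝕜 := ℂ) (toL f)
  rw [inner_eq_integral] at h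
  have e : (fun x => toL f x * (starRingEnd ℂ) (toL f x)) =ᵐ[volume]
      fun x => ((‖f x‖ ^ 2 : ℝ) : ℂ) := by
    filter_upwards [toL_coe f] with x hx
    rw [hx, Complex.mul_conj']; push_cast; rfl
  rw [integral_congr_ae e, integral_complex_ofReal] at h
  have h' : ((∫ x, ‖f x‖ ^ 2 : ℝ) : ℂ) = ((‖toL f‖ ^ 2 : ℝ) : ℂ) := by
    rw [h]; push_cast; rfl
  exact (Complex.ofReal_injective h').symm

theorem norm_weight_neg_le {s : ℝ} (hs : 0 ≤ s) (x : E3) : ‖weight (-s) x‖ ≤ 1 := by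
  rw [weight, Complex.norm_real, Real.norm_of_nonneg (Real.rpow_nonneg (bracket_pos x).le _)]
  exact Real.rpow_le_one_of_one_le_of_nonpos (one_le_bracket x) (by linarith)

theorem norm_mul_norm_weight_neg_le {s : ℝ} (hs : 1 ≤ s) (x : E3) : ‖x‖ * ‖weight (-s) x‖ ≤ 1 := by
  rw [weight, Complex.norm_real, Real.norm_of_nonneg (Real.rpow_nonneg (bracket_pos x).le _)]
  have hb := bracket_pos x
  calc ‖x‖ * bracket x ^ (-s) ≤ bracket x * bracket x ^ (-1 : ℝ) := by
        gcongr
        · exact norm_le_bracket x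
        · exact one_le_bracket x
    _ = 1 := by rw [Real.rpow_neg_one, mul_inv_cancel₀ hb.ne']

/-- Differentiating a Fourier transform multiplies the function by `-2πi x_j`. With Plancherel, the
gradient term of Hardy's inequality in momentum space becomes a weighted norm in position space. -/
theorem norm_toL_momentumS_fourier (g : 𝓢(E3, ℂ)) (j : Fin 3) :
    ∫ x, ‖momentumS j (𝓕 g) x‖ ^ 2 = ∫ x, (2 * Real.pi) ^ 2 * (x j ^ 2 * ‖g x‖ ^ 2) := by
  have h0 : (fun ξ : E3 => inner ℝ ξ (basisVec j)).HasTemperateGrowth := by fun_prop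
  have h1 : momentumS j (𝓕 g) = -Complex.I • ∂_{basisVec j} (𝓕 g) := rfl
  have h2 : momentumS j (𝓕 g) = 𝓕 (-Complex.I • (-(2 * (Real.pi : ℂ) * Complex.I) •
      SchwartzMap.smulLeftCLM ℂ (inner ℝ · (basisVec j)) g)) := by
    rw [h1, SchwartzMap.lineDerivOp_fourier_eq, ← FourierTransform.fourier_smul]
  rw [← norm_toL_sq, h2]
  have h3 := SchwartzMap.norm_fourier_toL2_eq (-Complex.I • (-(2 * (Real.pi : ℂ) * Complex.I) •
      SchwartzMap.smulLeftCLM ℂ (inner ℝ · (basisVec j)) g))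
  have h4 : ∀ f : 𝓢(E3, ℂ), toL f = f.toLp 2 volume := fun f => rfl
  rw [h4, h3, ← h4, norm_toL_sq]
  congr 1
  ext x
  have h5 : SchwartzMap.smulLeftCLM ℂ (inner ℝ · (basisVec j)) g x = x j • g x := by
    rw [SchwartzMap.smulLeftCLM_apply_apply h0, inner_basisVec]
  rw [smul_apply, smul_apply, h5, norm_smul, norm_smul, norm_smul, norm_neg, norm_neg,
    Complex.norm_I, norm_mul, norm_mul, Complex.norm_I, Complex.norm_real, Complex.norm_two,
    Real.norm_of_nonneg Real.pi_pos.le, one_mul, mul_one, mul_pow, Real.norm_eq_abs,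
    mul_pow |x j|, sq_abs]

/-- The symbol `1 / |2πξ|` of `(-Δ)^{-1/2}`. -/
def rootSymbol (ξ : E3) : ℝ := (2 * Real.pi * ‖ξ‖)⁻¹

/-- The symbol `ξ_j / |ξ|` of `P_j (-Δ)^{-1/2}`. -/
def rieszSymbol (j : Fin 3) (ξ : E3) : ℝ := rootSymbol ξ * (2 * Real.pi * ξ j)

theorem measurable_rootSymbol : Measurable rootSymbol := by unfold rootSymbol; fun_prop

theorem measurable_rieszSymbol (j : Fin 3) : Measurable (rieszSymbol j) :=
  measurable_rootSymbol.mul (measurable_const.mul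
    (EuclideanSpace.proj j : E3 →L[ℝ] ℝ).continuous.measurable)

theorem abs_rieszSymbol_le (j : Fin 3) (ξ : E3) : |rieszSymbol j ξ| ≤ 1 := by
  have hp : 0 < 2 * Real.pi := by positivity
  rw [rieszSymbol, rootSymbol, abs_mul, abs_inv, abs_mul _ ‖ξ‖, abs_mul _ (ξ j), abs_norm,
    abs_of_pos hp, inv_mul_eq_div]
  exact div_le_one_of_le₀ (mul_le_mul_of_nonneg_left (PiLp.norm_apply_le ξ j) hp.le) (by positivity)

theorem sum_rieszSymbol_mul {ξ : E3} (hξ : ξ ≠ 0) :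
    rootSymbol ξ * ∑ j, rieszSymbol j ξ * (2 * Real.pi * ξ j) = 1 := by
  have h : ‖ξ‖ ^ 2 = ∑ j, ξ j ^ 2 := EuclideanSpace.real_norm_sq_eq ξ
  have h0 : ‖ξ‖ ≠ 0 := by simpa using hξ
  have e : ∑ j, rieszSymbol j ξ * (2 * Real.pi * ξ j) =
      rootSymbol ξ * ((2 * Real.pi) ^ 2 * ‖ξ‖ ^ 2) := by
    rw [h, Finset.mul_sum, Finset.mul_sum]
    refine Finset.sum_congr rfl fun j _ => ?_
    rw [rieszSymbol]; ring
  rw [e, rootSymbol]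
  field_simp

theorem rootSymbol_neg (ξ : E3) : rootSymbol (-ξ) = rootSymbol ξ := by simp [rootSymbol]

theorem rieszSymbol_neg (j : Fin 3) (ξ : E3) : rieszSymbol j (-ξ) = -rieszSymbol j ξ := by
  simp [rieszSymbol, rootSymbol_neg]

/-- The `L²` operator `X` is given by `𝓕 (X φ) = m 𝓕 (⟨x⟩^{-s} φ)`, up to the outer transform. -/
def FourierRep (s : ℝ) (m : E3 → ℝ) (X : L2 →L[ℂ] L2) : Prop :=
  ∀ φ : 𝓢(E3, ℂ), (X (toL φ) : E3 → ℂ) =ᵐ[volume] fun ξ => (m ξ : ℂ) * 𝓕 (weightS (-s) φ) ξ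

/-- Hardy's inequality for `f = 𝓕(⟨x⟩^{-s} φ)`: the norm of `f/|ξ|` is controlled by that of `∇f`,
that is, by the norm of `|x|⟨x⟩^{-s} φ`. The factor `|x|⟨x⟩^{-s}` is bounded by `1` for `s ≥ 1`. The
powers of `2π` cancel, leaving `2 = √4`. -/
theorem memLp_rootSymbol_mul {s : ℝ} (hs : 1 ≤ s) (φ : 𝓢(E3, ℂ)) :
    MemLp (fun ξ => (rootSymbol ξ : ℂ) * 𝓕 (weightS (-s) φ) ξ) 2 volume ∧
    eLpNorm (fun ξ => (rootSymbol ξ : ℂ) * 𝓕 (weightS (-s) φ) ξ) 2 volume ≤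
      ENNReal.ofReal (2 * ‖toL φ‖) := by
  set f : 𝓢(E3, ℂ) := 𝓕 (weightS (-s) φ) with hf
  have hm : AEStronglyMeasurable (fun ξ => (rootSymbol ξ : ℂ) * f ξ) volume :=
    (Complex.measurable_ofReal.comp measurable_rootSymbol).aestronglyMeasurable.mul
      f.continuous.aestronglyMeasurable
  have hle : eLpNorm (fun ξ => (rootSymbol ξ : ℂ) * f ξ) 2 volume ≤
      ENNReal.ofReal (2 * ‖toL φ‖) := by
    have h1 : eLpNorm (fun ξ => (rootSymbol ξ : ℂ) * f ξ) 2 volume ^ 2 ≤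
        ENNReal.ofReal (2 * ‖toL φ‖) ^ 2 := by
      rw [eLpNorm_two_sq]
      have e : ∀ ξ, ‖(rootSymbol ξ : ℂ) * f ξ‖ₑ ^ 2 =
          ENNReal.ofReal (((2 * Real.pi) ^ 2)⁻¹) * ENNReal.ofReal ((‖ξ‖ ^ 2)⁻¹ * ‖f ξ‖ ^ 2) := by
        intro ξ
        rw [← ENNReal.ofReal_mul (by positivity), ← ofReal_norm, ← ENNReal.ofReal_pow (norm_nonneg _),
          norm_mul, mul_pow, Complex.norm_real, Real.norm_eq_abs, sq_abs, rootSymbol]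
        congr 1
        rw [inv_pow, mul_pow, mul_inv]; ring
      simp_rw [e]
      rw [lintegral_const_mul' _ _ ENNReal.ofReal_ne_top]
      have hD : ∑ j, ∫ x, ‖momentumS j f x‖ ^ 2 ≤ (2 * Real.pi) ^ 2 * ‖toL φ‖ ^ 2 := by
        have hi : ∀ j ∈ (Finset.univ : Finset (Fin 3)), Integrable fun x : E3 =>
            (2 * Real.pi) ^ 2 * (x j ^ 2 * ‖weightS (-s) φ x‖ ^ 2) := by
          intro j _
          refine Integrable.const_mul ?_ _
          have h0 : (fun ξ : E3 => inner ℝ ξ (basisVec j)).HasTemperateGrowth := by fun_prop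
          refine (integrable_norm_sq (SchwartzMap.smulLeftCLM ℂ (inner ℝ · (basisVec j))
            (weightS (-s) φ))).congr (ae_of_all _ fun x => ?_)
          have h5 : SchwartzMap.smulLeftCLM ℂ (inner ℝ · (basisVec j)) (weightS (-s) φ) x =
              x j • weightS (-s) φ x := by
            rw [SchwartzMap.smulLeftCLM_apply_apply h0, inner_basisVec]
          change ‖SchwartzMap.smulLeftCLM ℂ (inner ℝ · (basisVec j)) (weightS (-s) φ) x‖ ^ 2 = _
          rw [h5, norm_smul, mul_pow, Real.norm_eq_abs, sq_abs]
        simp_rw [hf, norm_toL_momentumS_fourier]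
        rw [← integral_finsetSum _ hi, norm_toL_sq, ← integral_const_mul]
        refine integral_mono (integrable_finsetSum _ hi) ((integrable_norm_sq φ).const_mul _)
          fun x => ?_
        simp only
        rw [← Finset.mul_sum, ← Finset.sum_mul, ← EuclideanSpace.real_norm_sq_eq, weightS_apply,
          norm_mul, mul_pow ‖weight (-s) x‖, ← mul_assoc (‖x‖ ^ 2), ← mul_pow ‖x‖]
        have := norm_mul_norm_weight_neg_le hs x
        have h2 : (‖x‖ * ‖weight (-s) x‖) ^ 2 ≤ 1 := pow_le_one₀ (by positivity) this
        gcongr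
        exact mul_le_of_le_one_left (by positivity) h2
      refine (mul_le_mul_right (hardy f) _).trans ?_
      rw [← ENNReal.ofReal_mul (by positivity), ← ENNReal.ofReal_pow (by positivity)]
      apply ENNReal.ofReal_le_ofReal
      rw [inv_mul_le_iff₀ (by positivity)]
      nlinarith
    exact (ENNReal.pow_le_pow_left_iff two_ne_zero).1 h1
  exact ⟨⟨hm, hle.trans_lt ENNReal.ofReal_lt_top⟩, hle⟩

theorem exists_greenRoot {s : ℝ} (hs : 1 ≤ s) :
    ∃ K : L2 →L[ℂ] L2, FourierRep s rootSymbol K := by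
  let Y : 𝓢(E3, ℂ) →ₗ[ℂ] L2 :=
    { toFun := fun φ => (memLp_rootSymbol_mul hs φ).1.toLp
      map_add' := fun φ ψ => by
        rw [← MemLp.toLp_add]
        refine MemLp.toLp_congr _ _ (ae_of_all _ fun ξ => ?_)
        simp [map_add, FourierTransform.fourier_add, mul_add]
      map_smul' := fun c φ => by
        rw [RingHom.id_apply, ← MemLp.toLp_const_smul]
        refine MemLp.toLp_congr _ _ (ae_of_all _ fun ξ => ?_)
        simp [map_smul, FourierTransform.fourier_smul]
        ring }
  have hY : ∀ φ, ‖Y φ‖ ≤ 2 * ‖toL φ‖ := fun φ => by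
    change ‖(memLp_rootSymbol_mul hs φ).1.toLp‖ ≤ _
    rw [Lp.norm_toLp]
    exact ENNReal.toReal_le_of_le_ofReal (by positivity) (memLp_rootSymbol_mul hs φ).2
  refine ⟨Y.extendOfNorm toL.toLinearMap, fun φ => ?_⟩
  have h1 : Y.extendOfNorm toL.toLinearMap (toL φ) = Y φ :=
    LinearMap.extendOfNorm_eq (f := Y) (e := toL.toLinearMap) denseRange_toL ⟨2, hY⟩ φ
  rw [h1]
  exact (memLp_rootSymbol_mul hs φ).1.coeFn_toLp

/-- The operator `(-Δ)^{-1/2} ⟨x⟩^{-s}`, in momentum space. -/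
def greenRoot {s : ℝ} (hs : 1 ≤ s) : L2 →L[ℂ] L2 := Classical.choose (exists_greenRoot hs)

theorem greenRoot_rep {s : ℝ} (hs : 1 ≤ s) : FourierRep s rootSymbol (greenRoot hs) :=
  Classical.choose_spec (exists_greenRoot hs)

theorem exists_rieszOp {s : ℝ} (hs : 1 ≤ s) (j : Fin 3) :
    ∃ K : L2 →L[ℂ] L2, FourierRep s (rieszSymbol j) K := by
  have h1 : MemLp (fun ξ => (rieszSymbol j ξ : ℂ)) ⊤ volume := by
    refine memLp_top_of_forall_norm_le (K := 1)
      (Complex.measurable_ofReal.comp (measurable_rieszSymbol j)).aestronglyMeasurable fun ξ => ?_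
    rw [Complex.norm_real]; exact abs_rieszSymbol_le j ξ
  have h2 : MemLp (weight (-s)) ⊤ volume := by
    refine memLp_top_of_forall_norm_le (K := 1) (continuous_weight _).aestronglyMeasurable fun ξ =>
      norm_weight_neg_le (by linarith) ξ
  refine ⟨mulOp h1 ∘L (Lp.fourierTransformₗᵢ E3 ℂ).toContinuousLinearEquiv.toContinuousLinearMap ∘L
    mulOp h2, fun φ => ?_⟩
  have e : mulOp h2 (toL φ) = toL (weightS (-s) φ) := by
    apply Lp.ext
    filter_upwards [mulOp_coe h2 (toL φ), toL_coe φ, toL_coe (weightS (-s) φ)] with x a1 a2 a3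
    rw [a1, a2, a3, weightS_apply]
  have e2 : Lp.fourierTransformₗᵢ E3 ℂ (toL (weightS (-s) φ)) = toL (𝓕 (weightS (-s) φ)) :=
    SchwartzMap.toLp_fourier_eq _
  change (mulOp h1 (Lp.fourierTransformₗᵢ E3 ℂ (mulOp h2 (toL φ))) : E3 → ℂ) =ᵐ[volume] _
  rw [e, e2]
  filter_upwards [mulOp_coe h1 (toL (𝓕 (weightS (-s) φ))), toL_coe (𝓕 (weightS (-s) φ))] with x a1 a2
  rw [a1, a2]

/-- The operator `P_j (-Δ)^{-1/2} ⟨x⟩^{-s}`, in momentum space. -/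
def rieszOp {s : ℝ} (hs : 1 ≤ s) (j : Fin 3) : L2 →L[ℂ] L2 := Classical.choose (exists_rieszOp hs j)

theorem rieszOp_rep {s : ℝ} (hs : 1 ≤ s) (j : Fin 3) : FourierRep s (rieszSymbol j) (rieszOp hs j) :=
  Classical.choose_spec (exists_rieszOp hs j)

/-- The complex conjugate of a Schwartz function. -/
def conjS (φ : 𝓢(E3, ℂ)) : 𝓢(E3, ℂ) := φ.postcompCLM (Complex.conjCLE : ℂ →L[ℝ] ℂ)

theorem conjS_apply (φ : 𝓢(E3, ℂ)) (x : E3) : conjS φ x = (starRingEnd ℂ) (φ x) := rfl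

theorem weightS_conjS (s : ℝ) (φ : 𝓢(E3, ℂ)) : weightS s (conjS φ) = conjS (weightS s φ) := by
  ext x
  rw [conjS_apply, weightS_apply, weightS_apply, map_mul, weight_conj, conjS_apply]

theorem conj_fourier_conjS (φ : 𝓢(E3, ℂ)) (ξ : E3) :
    (starRingEnd ℂ) (𝓕 (conjS φ) ξ) = 𝓕 φ (-ξ) := by
  rw [SchwartzMap.fourier_coe, SchwartzMap.fourier_coe, Real.fourier_eq', Real.fourier_eq',
    ← integral_conj]
  congr 1
  ext x
  simp only [smul_eq_mul, map_mul, conjS_apply, Complex.conj_conj, ← Complex.exp_conj,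
    Complex.conj_ofReal, Complex.conj_I, inner_neg_right]
  congr 2
  push_cast; ring

theorem pair_eq_inner (h : L2) (φ : 𝓢(E3, ℂ)) : pair h (toL φ) = inner ℂ (toL (conjS φ)) h := by
  rw [pair_apply, inner_eq_integral]
  apply integral_congr_ae
  filter_upwards [toL_coe φ, toL_coe (conjS φ)] with x h1 h2
  rw [h1, h2, conjS_apply, Complex.conj_conj]

open ContinuousLinearMap (adjoint)

/-- Turning the sesquilinear adjoint into a bilinear pairing conjugates `φ` twice, once on each side
of the Fourier transform, whence the reflection `-ξ`. So `adjoint X h` stands for `⟨x⟩^{-s} m(P)`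
applied to the inverse Fourier transform of `h`. -/
theorem FourierRep.pair_adjoint {s : ℝ} {m : E3 → ℝ} {X : L2 →L[ℂ] L2} (hX : FourierRep s m X)
    (h : L2) (φ : 𝓢(E3, ℂ)) :
    pair (adjoint X h) (toL φ) = ∫ ξ, (m ξ : ℂ) * 𝓕 (weightS (-s) φ) (-ξ) * h ξ := by
  rw [pair_eq_inner, ContinuousLinearMap.adjoint_inner_right, inner_eq_integral]
  apply integral_congr_ae
  filter_upwards [hX (conjS φ)] with x hx
  rw [hx, map_mul, Complex.conj_ofReal, weightS_conjS, conj_fourier_conjS]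
  ring

/-- Transposition reflects `ξ`, so `σ` is the parity of the product of the two symbols: `1` for two
roots, `-1` when one of them is a Riesz symbol. -/
theorem FourierRep.pair_symm {s : ℝ} {m n : E3 → ℝ} {X Y : L2 →L[ℂ] L2} (hX : FourierRep s m X)
    (hY : FourierRep s n Y) (σ : ℝ) (hσ : ∀ ξ, m (-ξ) * n (-ξ) = σ * (m ξ * n ξ)) (t : L2)
    (τ : 𝓢(E3, ℂ)) :
    pair t (adjoint X (Y (toL τ))) = σ * pair (adjoint Y (X t)) (toL τ) := by
  refine denseRange_toL.induction_on t (isClosed_eq ?_ ?_) fun θ => ?_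
  · exact (pair.flip (adjoint X (Y (toL τ)))).continuous
  · exact continuous_const.mul ((pair.flip (toL τ)).continuous.comp
      ((adjoint Y).continuous.comp X.continuous))
  rw [pair_comm, hX.pair_adjoint, hY.pair_adjoint, ← integral_const_mul, ← integral_neg_eq_self]
  apply integral_congr_ae
  have hn : ∀ᵐ ξ : E3, (Y (toL τ) : E3 → ℂ) (-ξ) = (n (-ξ) : ℂ) * 𝓕 (weightS (-s) τ) (-ξ) :=
    (Measure.measurePreserving_neg (volume : Measure E3)).quasiMeasurePreserving.ae (hY τ)
  filter_upwards [hn, hX θ] with ξ h1 h2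
  rw [h1, h2, neg_neg]
  have := hσ ξ
  have h3 : (m (-ξ) : ℂ) * (n (-ξ) : ℂ) = σ * (m ξ * n ξ) := by exact_mod_cast this
  linear_combination (𝓕 (weightS (-s) θ) ξ * 𝓕 (weightS (-s) τ) (-ξ)) * h3

theorem fourier_momentumS (j : Fin 3) (φ : 𝓢(E3, ℂ)) (ξ : E3) :
    𝓕 (momentumS j φ) ξ = ((2 * Real.pi * ξ j : ℝ) : ℂ) * 𝓕 φ ξ := by
  rw [momentumS_eq, SchwartzMap.fourierMultiplierCLM_apply, FourierInvPair.fourier_fourierInv_eq,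
    SchwartzMap.smulLeftCLM_apply_apply (momentumSymbol_hasTemperateGrowth j), smul_eq_mul,
    momentumSymbol]

theorem integral_fourier_neg_mul (f g : 𝓢(E3, ℂ)) :
    ∫ ξ, 𝓕 f (-ξ) * 𝓕 g ξ = ∫ x, f x * g x := by
  have h1 : ∀ ξ, 𝓕 f (-ξ) = 𝓕⁻ f ξ := fun ξ => by
    rw [SchwartzMap.fourier_coe, SchwartzMap.fourierInv_coe, Real.fourierInv_eq_fourier_neg]
  simp_rw [h1]
  rw [← SchwartzMap.integral_fourier_mul_eq, FourierInvPair.fourier_fourierInv_eq]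

/-- If `u` is represented by `(-Δ)^{-1/2} h`, then `P_k u` is represented by
`P_k (-Δ)^{-1/2} h`. -/
theorem weightD_momentum_of_greenRoot {s : ℝ} (hs : 1 ≤ s) {h : L2} {u : 𝓢'(E3, ℂ)}
    (hu : weightD (-s) u = toD (adjoint (greenRoot hs) h)) (k : Fin 3) :
    weightD (-s) (momentum k u) = toD (adjoint (rieszOp hs k) h) := by
  have hu' : u = weightD s (toD (adjoint (greenRoot hs) h)) := by
    rw [← hu, weightD_weightD_neg]
  ext φ
  rw [weightD_apply, momentum_apply, hu', weightD_apply, toD_apply, toD_apply,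
    (greenRoot_rep hs).pair_adjoint, (rieszOp_rep hs k).pair_adjoint, ← integral_neg]
  congr 1
  ext ξ
  rw [weightS_neg_weightS, fourier_momentumS, rieszSymbol, PiLp.neg_apply]
  push_cast
  ring

/-- The element `h` determines `u`, and the weight only records the space in which `u` is measured.
This moves `G₀ w* f` from weight `β/2` to weight `1`. -/
theorem weightD_of_weightD_greenRoot {s r : ℝ} (hs : 1 ≤ s) (hr : 1 ≤ r) {h : L2} {u : 𝓢'(E3, ℂ)}
    (hu : weightD (-s) u = toD (adjoint (greenRoot hs) h)) :
    weightD (-r) u = toD (adjoint (greenRoot hr) h) := by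
  have hu' : u = weightD s (toD (adjoint (greenRoot hs) h)) := by
    rw [← hu, weightD_weightD_neg]
  ext φ
  rw [hu', weightD_apply, weightD_apply, toD_apply, toD_apply,
    (greenRoot_rep hs).pair_adjoint, (greenRoot_rep hr).pair_adjoint, weightS_neg_weightS]

/-- The divergence `∑_j P_j` of the Riesz components, computed in momentum space. The minus sign
comes from the reflected symbol `2πξ_j` of `P_j`. -/
theorem FourierRep.sum_pair_riesz {s : ℝ} (hs : 1 ≤ s) {m : E3 → ℝ} {X : L2 →L[ℂ] L2}
    (hX : FourierRep s m X) (θ φ : 𝓢(E3, ℂ)) :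
    ∑ j, pair (adjoint (rieszOp hs j) (X (toL θ))) (toL (weightS s (momentumS j φ))) =
      -∫ ξ, ((m ξ * ∑ j, rieszSymbol j ξ * (2 * Real.pi * ξ j) : ℝ) : ℂ) *
        (𝓕 φ (-ξ) * 𝓕 (weightS (-s) θ) ξ) := by
  have hi : ∀ j ∈ (Finset.univ : Finset (Fin 3)), Integrable fun ξ => (rieszSymbol j ξ : ℂ) *
      𝓕 (momentumS j φ) (-ξ) * X (toL θ) ξ := by
    intro j _
    have h1 : ∀ᵐ ξ, (rieszOp hs j (toL (conjS (weightS s (momentumS j φ)))) : E3 → ℂ) ξ = _ :=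
      rieszOp_rep hs j _
    refine (integrable_mul_conj (rieszOp hs j (toL (conjS (weightS s (momentumS j φ)))))
      (X (toL θ))).congr ?_
    filter_upwards [h1] with ξ h
    rw [h, map_mul, Complex.conj_ofReal, weightS_conjS, conj_fourier_conjS, weightS_neg_weightS]
    ring
  simp_rw [(rieszOp_rep hs _).pair_adjoint, weightS_neg_weightS]
  rw [← integral_finsetSum _ hi, ← integral_neg]
  apply integral_congr_ae
  filter_upwards [hX θ] with ξ hξ
  simp_rw [hξ, fourier_momentumS]
  push_cast
  rw [Finset.mul_sum, Finset.sum_mul, ← Finset.sum_neg_distrib]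
  refine Finset.sum_congr rfl fun j _ => ?_
  simp
  ring

theorem ae_ne_zero : ∀ᵐ x : E3, x ≠ 0 := by simp [ae_iff]

/-- `-Δ (-Δ)^{-1} T = T` in the weak sense. -/
theorem sum_pair_greenRoot {s : ℝ} (hs : 1 ≤ s) (t : L2) (φ : 𝓢(E3, ℂ)) :
    ∑ j, pair (adjoint (rieszOp hs j) (greenRoot hs t)) (toL (weightS s (momentumS j φ))) =
      -pair t (toL (weightS (-s) φ)) := by
  refine denseRange_toL.induction_on t (isClosed_eq ?_ ?_) fun θ => ?_
  · exact continuous_finsetSum _ fun j _ => (pair.flip _).continuous.comp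
      ((adjoint (rieszOp hs j)).continuous.comp (greenRoot hs).continuous)
  · exact (pair.flip _).continuous.neg
  rw [(greenRoot_rep hs).sum_pair_riesz hs, pair_toL]
  congr 1
  have e : ∫ x, θ x * weightS (-s) φ x = ∫ x, φ x * weightS (-s) θ x := by
    congr 1; ext x; rw [weightS_apply, weightS_apply]; ring
  rw [e, ← integral_fourier_neg_mul]
  apply integral_congr_ae
  filter_upwards [ae_ne_zero] with ξ hξ
  rw [sum_rieszSymbol_mul hξ, Complex.ofReal_one, one_mul]

/-- `-Δ (-Δ)^{-1} P_k σ = P_k σ` in the weak sense. -/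
theorem sum_pair_rieszOp {s : ℝ} (hs : 1 ≤ s) (k : Fin 3) (σ : L2) (φ : 𝓢(E3, ℂ)) :
    ∑ j, pair (adjoint (rieszOp hs j) (rieszOp hs k σ)) (toL (weightS s (momentumS j φ))) =
      pair σ (toL (weightS (-s) (momentumS k φ))) := by
  refine denseRange_toL.induction_on σ (isClosed_eq ?_ ?_) fun θ => ?_
  · exact continuous_finsetSum _ fun j _ => (pair.flip _).continuous.comp
      ((adjoint (rieszOp hs j)).continuous.comp (rieszOp hs k).continuous)
  · exact (pair.flip _).continuous
  rw [(rieszOp_rep hs k).sum_pair_riesz hs, pair_toL, ← integral_neg]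
  have e : ∫ x, θ x * weightS (-s) (momentumS k φ) x =
      ∫ x, momentumS k φ x * weightS (-s) θ x := by
    congr 1; ext x; rw [weightS_apply, weightS_apply]; ring
  rw [e, ← integral_fourier_neg_mul]
  apply integral_congr_ae
  filter_upwards [ae_ne_zero] with ξ hξ
  have h1 := sum_rieszSymbol_mul hξ
  have h2 : rieszSymbol k ξ * ∑ j, rieszSymbol j ξ * (2 * Real.pi * ξ j) = 2 * Real.pi * ξ k := by
    rw [rieszSymbol]; linear_combination (2 * Real.pi * ξ k) * h1
  rw [h2, fourier_momentumS]
  simp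
  ring

end MagneticSchrodinger
end

noncomputable section

namespace MagneticSchrodinger

open FourierTransform Set Filter Topology

/-! ## The Newton potential -/

/-- The heat kernel is the density in time of the kernel `1 / (4π|z|)`. -/
theorem integral_heatKernel_time {z : E3} (hz : z ≠ 0) :
    ∫ t in Ioi 0, heatKernel t z = 1 / (4 * Real.pi * ‖z‖) := by
  have hr : 0 < ‖z‖ := norm_pos_iff.2 hz
  have hpi := Real.pi_pos
  have h1 := Real.integral_rpow_mul_exp_neg_mul_Ioi (a := 1 / 2) (r := ‖z‖ ^ 2 / 4) (by norm_num)
    (by positivity)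
  -- The substitution `t ↦ 1/t` turns the time integral into the Gamma integral at `1/2`.
  rw [← integral_comp_rpow_Ioi _ (p := -1) (by norm_num), Real.Gamma_one_half_eq] at h1
  have e : ∀ t ∈ Ioi (0 : ℝ), heatKernel t z = (4 * Real.pi) ^ (-(3 / 2) : ℝ) *
      ((|(-1 : ℝ)| * t ^ (-1 - 1 : ℝ)) • ((t ^ (-1 : ℝ)) ^ (1 / 2 - 1 : ℝ) *
        Real.exp (-(‖z‖ ^ 2 / 4 * t ^ (-1 : ℝ))))) := by
    intro t ht
    have ht' : 0 < t := ht
    rw [heatKernel, Real.mul_rpow (by positivity) ht'.le, ← Real.rpow_mul ht'.le, smul_eq_mul,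
      Real.rpow_neg_one, abs_neg, abs_one, one_mul]
    have e1 : t ^ (-(3 / 2) : ℝ) = t ^ (-1 - 1 : ℝ) * t ^ (-1 * (1 / 2 - 1) : ℝ) := by
      rw [← Real.rpow_add ht']; norm_num
    have e2 : ‖z‖ ^ 2 / (4 * t) = ‖z‖ ^ 2 / 4 * t⁻¹ := by field_simp
    rw [e1, e2]; ring
  rw [setIntegral_congr_fun measurableSet_Ioi e, integral_const_mul, h1]
  have e3 : (1 / (‖z‖ ^ 2 / 4)) ^ (1 / 2 : ℝ) = 2 / ‖z‖ := by
    rw [← Real.sqrt_eq_rpow, show 1 / (‖z‖ ^ 2 / 4) = (2 / ‖z‖) ^ 2 by field_simp; norm_num,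
      Real.sqrt_sq (by positivity)]
  have e4 : (4 * Real.pi) ^ (-(3 / 2) : ℝ) = (8 * Real.pi * Real.sqrt Real.pi)⁻¹ := by
    rw [Real.rpow_neg (by positivity), show (3 / 2 : ℝ) = 1 + 1 / 2 by norm_num,
      Real.rpow_add (by positivity), Real.rpow_one, ← Real.sqrt_eq_rpow,
      Real.sqrt_mul (by norm_num), show (4 : ℝ) = 2 ^ 2 by norm_num, Real.sqrt_sq (by norm_num)]
    congr 1; ring
  rw [e3, e4]
  have : 0 < Real.sqrt Real.pi := Real.sqrt_pos.2 hpi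
  field_simp
  norm_num

theorem heatKernel_le {t : ℝ} (ht : 0 < t) (z : E3) : heatKernel t z ≤ t ^ (-(3 / 2) : ℝ) := by
  have h1 : (4 * Real.pi * t) ^ (-(3 / 2) : ℝ) ≤ t ^ (-(3 / 2) : ℝ) := by
    refine Real.rpow_le_rpow_of_nonpos ht ?_ (by norm_num)
    nlinarith [Real.pi_gt_three]
  have h2 : Real.exp (-(‖z‖ ^ 2 / (4 * t))) ≤ 1 := by
    rw [Real.exp_le_one_iff, neg_nonpos]; positivity
  calc heatKernel t z ≤ (4 * Real.pi * t) ^ (-(3 / 2) : ℝ) * 1 := by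
        unfold heatKernel; gcongr
    _ ≤ _ := by rw [mul_one]; exact h1

theorem enorm_heatKernel {t : ℝ} (ht : 0 < t) (z : E3) :
    ‖(heatKernel t z : ℂ)‖ₑ = ENNReal.ofReal (heatKernel t z) := by
  rw [← ofReal_norm, Complex.norm_real, Real.norm_of_nonneg (heatKernel_nonneg ht z)]

theorem lintegral_enorm_lt_top (φ : 𝓢(E3, ℂ)) : ∫⁻ x, ‖φ x‖ₑ < ⊤ :=
  (φ.integrable (μ := volume)).2

/-- The time integral is split at `t = 1`. For large times the supremum bound `t^{-3/2}` is
integrable; for small times it is not, but the unit mass of the heat kernel gives a bound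
independent of `t`. -/
theorem integrable_heatKernel_prod (φ χ : 𝓢(E3, ℂ)) :
    Integrable (fun p : ℝ × (E3 × E3) =>
      (heatKernel p.1 (p.2.1 - p.2.2) : ℂ) * (χ p.2.1 * φ p.2.2))
      ((volume.restrict (Ioi 0)).prod (volume.prod volume)) := by
  have hmk : Measurable fun p : ℝ × (E3 × E3) => heatKernel p.1 (p.2.1 - p.2.2) :=
    measurable_heatKernel.comp (measurable_fst.prodMk
      (measurable_snd.fst.sub measurable_snd.snd))
  have hφm := φ.continuous.measurable
  have hχm := χ.continuous.measurable
  have hm : Measurable fun p : ℝ × (E3 × E3) =>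
      (heatKernel p.1 (p.2.1 - p.2.2) : ℂ) * (χ p.2.1 * φ p.2.2) := by fun_prop
  refine ⟨hm.aestronglyMeasurable, ?_⟩
  rw [HasFiniteIntegral, lintegral_prod _ hm.enorm.aemeasurable]
  set a := ∫⁻ x, ‖χ x‖ₑ with ha
  set b := ∫⁻ x, ‖φ x‖ₑ with hb
  have hatop : a ≠ ⊤ := (lintegral_enorm_lt_top χ).ne
  have hbtop : b ≠ ⊤ := (lintegral_enorm_lt_top φ).ne
  obtain ⟨K, hK⟩ : ∃ K, ∀ x, ‖χ x‖ ≤ K :=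
    ⟨_, fun x => χ.toBoundedContinuousFunction.norm_coe_le_norm x⟩
  have hK' : ∀ x, ‖χ x‖ₑ ≤ ENNReal.ofReal K := fun x => by
    rw [← ofReal_norm]; exact ENNReal.ofReal_le_ofReal (hK x)
  have hlarge : ∀ t ∈ Ioi (1 : ℝ), ∫⁻ p : E3 × E3, ‖(heatKernel t (p.1 - p.2) : ℂ) *
      (χ p.1 * φ p.2)‖ₑ ≤ ENNReal.ofReal (t ^ (-(3 / 2) : ℝ)) * (a * b) := by
    intro t ht
    have ht' : 0 < t := lt_trans one_pos ht
    rw [ha, hb, ← lintegral_prod_mul hχm.enorm.aemeasurable hφm.enorm.aemeasurable,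
      ← lintegral_const_mul _ (by fun_prop)]
    refine lintegral_mono fun p => ?_
    rw [enorm_mul, enorm_mul, enorm_heatKernel ht']
    gcongr
    exact heatKernel_le ht' _
  have hsmall : ∀ t ∈ Ioc (0 : ℝ) 1, ∫⁻ p : E3 × E3, ‖(heatKernel t (p.1 - p.2) : ℂ) *
      (χ p.1 * φ p.2)‖ₑ ≤ ENNReal.ofReal K * b := by
    intro t ht
    have hmt : Measurable fun p : E3 × E3 => (heatKernel t (p.1 - p.2) : ℂ) * (χ p.1 * φ p.2) := by
      have := (continuous_heatKernel t).measurable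
      fun_prop
    rw [Measure.volume_eq_prod, lintegral_prod_symm' _ hmt.enorm, hb, ← lintegral_const_mul _ hφm.enorm]
    refine lintegral_mono fun y => ?_
    calc ∫⁻ x, ‖(heatKernel t (x - y) : ℂ) * (χ x * φ y)‖ₑ
        ≤ ∫⁻ x, ENNReal.ofReal (heatKernel t (x - y)) * (ENNReal.ofReal K * ‖φ y‖ₑ) := by
          refine lintegral_mono fun x => ?_
          rw [enorm_mul, enorm_mul, enorm_heatKernel ht.1]
          gcongr
          exact hK' x
      _ = ENNReal.ofReal K * ‖φ y‖ₑ := by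
          have := (continuous_heatKernel t).measurable
          rw [lintegral_mul_const _ (by fun_prop),
            lintegral_sub_right_eq_self (fun x => ENNReal.ofReal (heatKernel t x)) y,
            lintegral_heatKernel ht.1, one_mul]
  rw [← Ioc_union_Ioi_eq_Ioi (zero_le_one (α := ℝ))]
  refine (lintegral_union_le _ _ _).trans_lt (ENNReal.add_lt_top.2 ⟨?_, ?_⟩)
  · refine (setLIntegral_mono measurable_const hsmall).trans_lt ?_
    rw [setLIntegral_const]
    simp only [Real.volume_Ioc]
    exact ENNReal.mul_lt_top (ENNReal.mul_lt_top ENNReal.ofReal_lt_top hbtop.lt_top)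
      ENNReal.ofReal_lt_top
  · refine (setLIntegral_mono (by fun_prop) hlarge).trans_lt ?_
    rw [lintegral_mul_const _ (by fun_prop)]
    refine ENNReal.mul_lt_top ?_ (ENNReal.mul_lt_top hatop.lt_top hbtop.lt_top)
    have hi := integrableOn_Ioi_rpow_of_lt (a := -(3 / 2)) (c := 1) (by norm_num) one_pos
    exact hi.lintegral_lt_top

/-- The heat operator has the Gaussian symbol; integrating in `x` turns the plane wave and `χ` into
`𝓕 χ (-ξ)`. -/
theorem integral_integral_heatKernel {t : ℝ} (ht : 0 < t) (φ χ : 𝓢(E3, ℂ)) :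
    ∫ x, χ x * ∫ y, (heatKernel t (x - y) : ℂ) * φ y =
      ∫ ξ, ((Real.exp (-(4 * Real.pi ^ 2 * ‖ξ‖ ^ 2) * t) : ℝ) : ℂ) * (𝓕 χ (-ξ) * 𝓕 φ ξ) := by
  simp_rw [integral_heatKernel_mul ht, ← integral_const_mul]
  have e : ∀ x ξ : E3, χ x * (Complex.exp (-((4 * Real.pi ^ 2 * t : ℝ) : ℂ) * ‖ξ‖ ^ 2 +
        2 * Real.pi * Complex.I * (inner ℝ x ξ : ℝ)) * 𝓕 φ ξ) =
      Complex.exp (((2 * Real.pi * (inner ℝ x ξ : ℝ) : ℝ) : ℂ) * Complex.I) * χ x *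
      (((Real.exp (-(4 * Real.pi ^ 2 * ‖ξ‖ ^ 2) * t) : ℝ) : ℂ) * 𝓕 φ ξ) := by
    intro x ξ
    rw [Complex.exp_add, Complex.ofReal_exp]
    push_cast
    ring_nf
  simp_rw [e]
  have hφm : Measurable fun ξ => 𝓕 φ ξ := (𝓕 φ).continuous.measurable
  have hχm := χ.continuous.measurable
  rw [integral_integral_swap]
  · congr 1; ext ξ
    rw [integral_mul_const]
    have : ∫ x, Complex.exp (((2 * Real.pi * (inner ℝ x ξ : ℝ) : ℝ) : ℂ) * Complex.I) * χ x =
        𝓕 χ (-ξ) := by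
      rw [SchwartzMap.fourier_coe, Real.fourier_eq']
      congr 1; ext x
      rw [smul_eq_mul, inner_neg_right]; congr 3; ring_nf
    rw [this]; ring
  · refine ((χ.integrable (μ := volume)).mul_prod ((𝓕 φ).integrable (μ := volume))).mono ?_
      (ae_of_all _ fun p => ?_)
    · apply Measurable.aestronglyMeasurable
      unfold Function.uncurry
      have : Measurable fun p : E3 × E3 => inner ℝ p.1 p.2 := measurable_fst.inner measurable_snd
      fun_prop
    · simp only [Function.uncurry, norm_mul, Complex.norm_exp_ofReal_mul_I, one_mul,
        Complex.norm_real, Real.norm_of_nonneg (Real.exp_pos _).le]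
      have h1 : Real.exp (-(4 * Real.pi ^ 2 * ‖p.2‖ ^ 2) * t) ≤ 1 := by
        rw [Real.exp_le_one_iff, neg_mul, neg_nonpos]; positivity
      calc ‖χ p.1‖ * (Real.exp (-(4 * Real.pi ^ 2 * ‖p.2‖ ^ 2) * t) * ‖𝓕 φ p.2‖)
          ≤ ‖χ p.1‖ * (1 * ‖𝓕 φ p.2‖) := by gcongr
        _ = _ := by rw [one_mul]

theorem memLp_rootSymbol_mul_fourier (φ : 𝓢(E3, ℂ)) :
    MemLp (fun ξ => (rootSymbol ξ : ℂ) * 𝓕 φ ξ) 2 volume := by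
  have := (memLp_rootSymbol_mul le_rfl (weightS 1 φ)).1
  rwa [weightS_neg_weightS] at this

theorem integrable_rootSymbol_sq (φ χ : 𝓢(E3, ℂ)) :
    Integrable fun ξ => (rootSymbol ξ : ℂ) ^ 2 * (𝓕 χ (-ξ) * 𝓕 φ ξ) := by
  have h1 : MemLp (fun ξ => (starRingEnd ℂ) ((rootSymbol ξ : ℂ) * 𝓕 (conjS χ) ξ)) 2 volume :=
    (memLp_rootSymbol_mul_fourier (conjS χ)).star
  refine (h1.integrable_mul (memLp_rootSymbol_mul_fourier φ)).congr (ae_of_all _ fun ξ => ?_)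
  simp only [Pi.mul_apply, map_mul, Complex.conj_ofReal, conj_fourier_conjS]
  ring

theorem integral_exp_time {ξ : E3} (hξ : ξ ≠ 0) :
    ∫ t in Ioi 0, Real.exp (-(4 * Real.pi ^ 2 * ‖ξ‖ ^ 2) * t) = rootSymbol ξ ^ 2 := by
  have h : 0 < ‖ξ‖ := norm_pos_iff.2 hξ
  rw [integral_exp_mul_Ioi (by rw [neg_lt_zero]; positivity), rootSymbol]
  simp
  field_simp
  norm_num

theorem integrable_exp_prod (φ χ : 𝓢(E3, ℂ)) :
    Integrable (fun p : ℝ × E3 => ((Real.exp (-(4 * Real.pi ^ 2 * ‖p.2‖ ^ 2) * p.1) : ℝ) : ℂ) *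
      (𝓕 χ (-p.2) * 𝓕 φ p.2)) ((volume.restrict (Ioi 0)).prod volume) := by
  have hφm : Measurable fun ξ => 𝓕 φ ξ := (𝓕 φ).continuous.measurable
  have hχm : Measurable fun ξ => 𝓕 χ ξ := (𝓕 χ).continuous.measurable
  rw [integrable_prod_iff' (by apply Measurable.aestronglyMeasurable; fun_prop)]
  constructor
  · filter_upwards [ae_ne_zero] with ξ hξ
    have h : 0 < ‖ξ‖ := norm_pos_iff.2 hξ
    refine Integrable.mul_const ?_ _
    have := integrableOn_exp_mul_Ioi (a := -(4 * Real.pi ^ 2 * ‖ξ‖ ^ 2))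
      (by rw [neg_lt_zero]; positivity) 0
    exact this.ofReal
  · refine (integrable_rootSymbol_sq φ χ).norm.congr ?_
    filter_upwards [ae_ne_zero] with ξ hξ
    simp_rw [norm_mul, Complex.norm_real, Real.norm_of_nonneg (Real.exp_pos _).le]
    rw [integral_mul_const, integral_exp_time hξ, norm_pow, Complex.norm_real, Real.norm_eq_abs,
      sq_abs]

/-- Both sides are the time integral of the heat semigroup tested with `φ` and `χ`: in position
space the kernels add up to `1/(4π|x-y|)`, in momentum space the Gaussians add up to `|2πξ|⁻²`. Near
`ξ = 0` the integrability is that of a product of two functions controlled by Hardy's inequality. -/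
theorem integral_newtonPotential_mul (φ χ : 𝓢(E3, ℂ)) :
    Integrable (fun x => newtonPotential φ x * χ x) ∧
    ∫ x, newtonPotential φ x * χ x = ∫ ξ, (rootSymbol ξ : ℂ) ^ 2 * (𝓕 χ (-ξ) * 𝓕 φ ξ) := by
  have hI := integrable_heatKernel_prod φ χ
  have hR := hI.integral_prod_right
  have hpt : ∀ x y : E3, y ≠ x → ∫ t in Ioi 0, (heatKernel t (x - y) : ℂ) * (χ x * φ y) =
      χ x * (((1 / (4 * Real.pi * ‖x - y‖) : ℝ) : ℂ) * φ y) := by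
    intro x y hxy
    rw [integral_mul_const, integral_complex_ofReal, integral_heatKernel_time
      (sub_ne_zero.2 hxy.symm)]
    ring
  have hN : ∀ x, ∫ y, ∫ t in Ioi 0, (heatKernel t (x - y) : ℂ) * (χ x * φ y) =
      newtonPotential φ x * χ x := by
    intro x
    rw [newtonPotential, mul_comm, ← integral_const_mul]
    apply integral_congr_ae
    have : ∀ᵐ y : E3, y ≠ x := by simp [ae_iff]
    filter_upwards [this] with y hy
    exact hpt x y hy
  have hL := hR.integral_prod_left
  simp only [hN] at hL
  refine ⟨hL, ?_⟩
  have e1 : ∫ x, newtonPotential φ x * χ x =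
      ∫ p : E3 × E3, (∫ t in Ioi 0, (heatKernel t (p.1 - p.2) : ℂ) * (χ p.1 * φ p.2))
        ∂(volume.prod volume) := by
    rw [integral_prod _ hR]
    simp only [hN]
  have e3 : ∀ᵐ t ∂(volume.restrict (Ioi (0 : ℝ))),
      ∫ p : E3 × E3, (heatKernel t (p.1 - p.2) : ℂ) * (χ p.1 * φ p.2) ∂(volume.prod volume) =
      ∫ ξ, ((Real.exp (-(4 * Real.pi ^ 2 * ‖ξ‖ ^ 2) * t) : ℝ) : ℂ) * (𝓕 χ (-ξ) * 𝓕 φ ξ) := by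
    filter_upwards [hI.prod_right_ae, ae_restrict_mem measurableSet_Ioi] with t h1 ht
    rw [← integral_integral_heatKernel ht, integral_prod _ h1]
    congr 1; ext x
    rw [← integral_const_mul]
    congr 1; ext y; ring
  rw [e1, ← integral_integral_swap (f := fun (t : ℝ) (p : E3 × E3) =>
    (heatKernel t (p.1 - p.2) : ℂ) * (χ p.1 * φ p.2)) hI, integral_congr_ae e3,
    integral_integral_swap (integrable_exp_prod φ χ)]
  apply integral_congr_ae
  filter_upwards [ae_ne_zero] with ξ hξ
  rw [integral_mul_const, integral_complex_ofReal, integral_exp_time hξ]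
  push_cast; rfl

end MagneticSchrodinger
end

noncomputable section

namespace MagneticSchrodinger

open FourierTransform Set Filter Topology

open ContinuousLinearMap (adjoint)

/-! ## The free Green operator between weighted spaces -/

theorem mem_weightedSobolev_of_greenRoot {s : ℝ} (hs : 1 ≤ s) {h : L2} {u : 𝓢'(E3, ℂ)}
    (hu : weightD (-s) u = toD (adjoint (greenRoot hs) h)) : u ∈ weightedSobolev 1 (-s) :=
  mem_weightedSobolev_iff.2
    ⟨_, weightD_besselD_one hu fun k => weightD_momentum_of_greenRoot hs hu k⟩

/-- The symbol `|2πξ|⁻²` is the square of `rootSymbol`, so `G₀ φ` factors through two copies of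
`greenRoot`, and the inner weight `⟨x⟩^s` cancels. -/
theorem representedBy_newtonPotential {s : ℝ} (hs : 1 ≤ s) (φ : 𝓢(E3, ℂ)) {ψ : 𝓢'(E3, ℂ)}
    (hψ : weightD (-s) ψ = toD (adjoint (greenRoot hs) (greenRoot hs (toL (weightS s φ))))) :
    RepresentedBy ψ (newtonPotential φ) := by
  have hψ' : ψ = weightD s (toD (adjoint (greenRoot hs) (greenRoot hs (toL (weightS s φ))))) := by
    rw [← hψ, weightD_weightD_neg]
  intro χ
  obtain ⟨h1, h2⟩ := integral_newtonPotential_mul φ χ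
  refine ⟨h1, ?_⟩
  rw [h2, hψ', weightD_apply, toD_apply, (greenRoot_rep hs).pair_adjoint]
  apply integral_congr_ae
  filter_upwards [greenRoot_rep hs (weightS s φ)] with ξ hξ
  rw [hξ, weightS_neg_weightS, weightS_neg_weightS]
  ring

/-- The solution `(-Δ)^{-1/2} (t, σ)` of the first half of `-Δ u = t + ∑_j P_j σ_j`. -/
def greenSource {s : ℝ} (hs : 1 ≤ s) (t : L2) (σ : Fin 3 → L2) : L2 :=
  greenRoot hs t + ∑ j, rieszOp hs j (σ j)

/-- The test element `G₀ φ` is itself given by `greenRoot`, and both of its factors are transposed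
onto the source. For the terms `P_j S_j` the odd parity of the Riesz symbol cancels the minus sign
from the transposition of `P_j` in `dualPairing_eq`. -/
theorem isFreeGreen_of_greenRoot {s : ℝ} (hs : 1 ≤ s) {T : 𝓢'(E3, ℂ)} {S : Fin 3 → 𝓢'(E3, ℂ)}
    {t : L2} {σ : Fin 3 → L2} (hT : weightD s T = toD t) (hS : ∀ j, weightD s (S j) = toD (σ j))
    (g : weightedSobolev (-1) s) (hg : (g : 𝓢'(E3, ℂ)) = T + ∑ j, momentum j (S j))
    {u : 𝓢'(E3, ℂ)} (hu : weightD (-s) u = toD (adjoint (greenRoot hs) (greenSource hs t σ))) :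
    IsFreeGreen g u := by
  intro φ
  set h := greenRoot hs (toL (weightS s φ)) with hh
  set ψ : 𝓢'(E3, ℂ) := weightD s (toD (adjoint (greenRoot hs) h)) with hψd
  have hψ : weightD (-s) ψ = toD (adjoint (greenRoot hs) h) := by rw [hψd, weightD_neg_weightD]
  refine ⟨⟨ψ, mem_weightedSobolev_of_greenRoot hs hψ⟩, representedBy_newtonPotential hs φ hψ, ?_⟩
  have hu' : u = weightD s (toD (adjoint (greenRoot hs) (greenSource hs t σ))) := by
    rw [← hu, weightD_weightD_neg]
  rw [dualPairing_eq hT hS g _ hg hψ (weightD_momentum_of_greenRoot hs hψ), hu', weightD_apply,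
    toD_apply, greenSource, hh,
    (greenRoot_rep hs).pair_symm (greenRoot_rep hs) 1 (fun ξ => by simp [rootSymbol_neg])]
  have hj : ∀ j, pair (σ j) (adjoint (rieszOp hs j) (greenRoot hs (toL (weightS s φ)))) = _ :=
    fun j => (rieszOp_rep hs j).pair_symm (greenRoot_rep hs) (-1)
      (fun ξ => by rw [rootSymbol_neg, rieszSymbol_neg]; ring) (σ j) (weightS s φ)
  simp_rw [hj]
  simp [map_add, map_sum]

/-- The weak form of `-Δ u = T + ∑_j P_j S_j`. -/
theorem sum_pair_greenSource {s : ℝ} (hs : 1 ≤ s) (t : L2) (σ : Fin 3 → L2) (φ : 𝓢(E3, ℂ)) :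
    ∑ j, pair (adjoint (rieszOp hs j) (greenSource hs t σ)) (toL (weightS s (momentumS j φ))) =
      -pair t (toL (weightS (-s) φ)) +
        ∑ k, pair (σ k) (toL (weightS (-s) (momentumS k φ))) := by
  rw [← sum_pair_greenRoot hs]
  simp_rw [← sum_pair_rieszOp hs, greenSource, map_add, map_sum, add_apply,
    sum_apply, Finset.sum_add_distrib]
  rw [Finset.sum_comm]

/-! ## Bounded weighted coefficients -/

theorem DecaysLike.memLp_weight_mul {s : ℝ} {f : E3 → ℝ} (hf : DecaysLike (-s) f)
    (hm : AEMeasurable f) : MemLp (fun x => weight s x * (f x : ℂ)) ⊤ volume := by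
  obtain ⟨c, hc⟩ := hf
  refine memLp_top_of_forall_norm_le (K := c) ?_ fun x => ?_
  · exact (continuous_weight s).aestronglyMeasurable.mul
      (Complex.measurable_ofReal.comp_aemeasurable hm).aestronglyMeasurable
  · have hb := bracket_pos x
    rw [norm_mul, weight, Complex.norm_real, Complex.norm_real,
      Real.norm_of_nonneg (Real.rpow_nonneg hb.le _)]
    calc bracket x ^ s * ‖f x‖ ≤ bracket x ^ s * (c * bracket x ^ (-s)) := by
          gcongr; exact hc x
      _ = c * (bracket x ^ s * bracket x ^ (-s)) := by ring
      _ = c := by rw [← Real.rpow_add hb, add_neg_cancel, Real.rpow_zero, mul_one]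

theorem DecaysLike.sqrt_abs {β : ℝ} {V : E3 → ℝ} (hV : DecaysLike (-β) V) :
    DecaysLike (-(β / 2)) fun x => Real.sqrt |V x| := by
  obtain ⟨c, hc⟩ := hV
  refine ⟨Real.sqrt c, fun x => ?_⟩
  have hb := bracket_pos x
  rw [Real.norm_of_nonneg (Real.sqrt_nonneg _)]
  have e : bracket x ^ (-(β / 2)) = Real.sqrt (bracket x ^ (-β)) := by
    rw [Real.sqrt_eq_rpow, ← Real.rpow_mul hb.le]; congr 1; ring
  rw [e, ← Real.sqrt_mul' _ (Real.rpow_nonneg hb.le _)]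
  exact Real.sqrt_le_sqrt (hc x)

theorem DecaysLike.component {r s : ℝ} {A : E3 → E3} (hA : DecaysLike r A) (hr : r ≤ s)
    (j : Fin 3) : DecaysLike s fun x => A x j := by
  obtain ⟨c, hc⟩ := hA
  refine ⟨|c|, fun x => (PiLp.norm_apply_le (A x) j).trans ((hc x).trans ?_)⟩
  have h1 := Real.rpow_le_rpow_of_exponent_le (one_le_bracket x) hr
  have h2 : 0 ≤ bracket x ^ r := Real.rpow_nonneg (bracket_pos x).le _
  calc c * bracket x ^ r ≤ |c| * bracket x ^ r := by gcongr; exact le_abs_self c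
    _ ≤ _ := by gcongr

/-- Bounded multipliers that dominate the coefficients of the perturbation at weight `s`. -/
structure CoefficientBounds (s : ℝ) (V : E3 → ℝ) (A : E3 → E3) (C D : Fin 3 → E3 → ℝ) : Prop where
  v : MemLp (fun x => weight s x * ((Real.sqrt |V x| : ℝ) : ℂ)) ⊤ volume
  a : ∀ j, MemLp (fun x => weight s x * (A x j : ℂ)) ⊤ volume
  c : ∀ j, MemLp (fun x => weight s x * (C j x : ℂ)) ⊤ volume
  d : ∀ j, MemLp (fun x => weight s x * (D j x : ℂ)) ⊤ volume
  u : MemLp (signU V) ⊤ volume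

theorem coefficientBounds {β : ℝ} (hβ : 0 ≤ β) {V : E3 → ℝ} {A B : E3 → E3}
    {C D : Fin 3 → E3 → ℝ} (hV : IsElectricPotential β V) (hA : IsVectorPotential β B A)
    (hCD : IsFactorization β A C D) : CoefficientBounds (β / 2) V A C D where
  v := hV.decay.sqrt_abs.memLp_weight_mul
    (Real.continuous_sqrt.measurable.comp_aemeasurable hV.aemeasurable.abs)
  a j := (hA.decay.component (by linarith) j).memLp_weight_mul
    (((EuclideanSpace.proj j : E3 →L[ℝ] ℝ).continuous.comp
      hA.contDiff.continuous).aemeasurable)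
  c j := by
    have := hCD.decay_left j
    rw [neg_div] at this
    exact this.memLp_weight_mul (hCD.aemeasurable_left j)
  d j := by
    have := hCD.decay_right j
    rw [neg_div] at this
    exact this.memLp_weight_mul (hCD.aemeasurable_right j)
  u := by
    refine memLp_top_of_forall_norm_le (K := 1) ?_ fun x => ?_
    · have h : Measurable fun r : ℝ => if r < 0 then (-1 : ℂ) else 1 :=
        Measurable.ite measurableSet_Iio measurable_const measurable_const
      have h2 : signU V = fun x => (fun r : ℝ => if r < 0 then (-1 : ℂ) else 1) (V x) := by
        funext x; simp [signU]
      rw [h2]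
      exact (h.comp_aemeasurable hV.aemeasurable).aestronglyMeasurable
    · unfold signU
      split_ifs <;> simp

/-! ## The operator `M₀` -/

section

variable {s : ℝ} (hs : 1 ≤ s) {V : E3 → ℝ} {A : E3 → E3} {C D : Fin 3 → E3 → ℝ}
  (hb : CoefficientBounds s V A C D)

/-- The projection of `𝒦` to a component. -/
def compK (i : KIndex) : KSpace →L[ℂ] L2 := PiLp.proj 2 (fun _ : KIndex => L2) i

/-- The function part of `w* f`, multiplied by `⟨x⟩^s`. -/
def sourceT : KSpace →L[ℂ] L2 :=
  mulOp hb.v ∘L compK (.inl ()) + ∑ j, mulOp (hb.a j) ∘L compK (.inr (.inl j)) +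
    ∑ j, mulOp (hb.c j) ∘L compK (.inr (.inr (.inl j)))

/-- The divergence part of `w* f`, multiplied by `⟨x⟩^s`. -/
def sourceS (j : Fin 3) : KSpace →L[ℂ] L2 := mulOp (hb.d j) ∘L compK (.inr (.inr (.inr j)))

/-- The momentum space representation of `G₀ w*`. -/
def greenW : KSpace →L[ℂ] L2 :=
  greenRoot hs ∘L sourceT hb + ∑ j, rieszOp hs j ∘L sourceS hb j

/-- `⟨x⟩^{-s} G₀ w*`. -/
def stateW : KSpace →L[ℂ] L2 := adjoint (greenRoot hs) ∘L greenW hs hb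

/-- `⟨x⟩^{-s} P_j G₀ w*`. -/
def gradW (j : Fin 3) : KSpace →L[ℂ] L2 := adjoint (rieszOp hs j) ∘L greenW hs hb

/-- The components of `M₀`. -/
def mZeroComp : KIndex → KSpace →L[ℂ] L2
  | .inl _ => mulOp hb.u ∘L compK (.inl ()) + mulOp hb.v ∘L stateW hs hb
  | .inr (.inl j) => compK (.inr (.inl j)) + mulOp (hb.a j) ∘L stateW hs hb
  | .inr (.inr (.inl j)) => -compK (.inr (.inr (.inr j))) + mulOp (hb.c j) ∘L stateW hs hb
  | .inr (.inr (.inr j)) => -compK (.inr (.inr (.inl j))) + mulOp (hb.d j) ∘L gradW hs hb j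

/-- The operator `M₀ = 𝒰 + w G₀ w*`. -/
def mZero : KSpace →L[ℂ] KSpace :=
  (PiLp.continuousLinearEquiv 2 ℂ (fun _ : KIndex => L2)).symm.toContinuousLinearMap ∘L
    ContinuousLinearMap.pi (mZeroComp hs hb)

theorem mZero_apply (f : KSpace) (i : KIndex) : mZero hs hb f i = mZeroComp hs hb i f := rfl

theorem greenW_apply (f : KSpace) :
    greenW hs hb f = greenSource hs (sourceT hb f) fun j => sourceS hb j f := by
  simp [greenW, greenSource]

/-- The distribution `G₀ w* f`. -/
def stateD (f : KSpace) : 𝓢'(E3, ℂ) := weightD s (toD (stateW hs hb f))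

theorem weightD_stateD (f : KSpace) : weightD (-s) (stateD hs hb f) = toD (stateW hs hb f) := by
  rw [stateD, weightD_neg_weightD]

theorem weightD_stateD' (f : KSpace) :
    weightD (-s) (stateD hs hb f) = toD (adjoint (greenRoot hs) (greenW hs hb f)) :=
  weightD_stateD hs hb f

theorem weightD_momentum_stateD (f : KSpace) (j : Fin 3) :
    weightD (-s) (momentum j (stateD hs hb f)) = toD (gradW hs hb j f) :=
  weightD_momentum_of_greenRoot hs (weightD_stateD' hs hb f) j

theorem sourceT_coe (f : KSpace) : (fun x => weight (-s) x * sourceT hb f x) =ᵐ[volume] fun x =>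
    (Real.sqrt |V x| : ℂ) * f (.inl ()) x + ∑ j, (A x j : ℂ) * f (.inr (.inl j)) x
      + ∑ j, (C j x : ℂ) * f (.inr (.inr (.inl j))) x := by
  have e : sourceT hb f = mulOp hb.v (f (.inl ())) + ∑ j, mulOp (hb.a j) (f (.inr (.inl j))) +
      ∑ j, mulOp (hb.c j) (f (.inr (.inr (.inl j)))) := by
    simp [sourceT]; rfl
  have hsum : ∀ g : Fin 3 → L2, ((∑ j, g j : L2) : E3 → ℂ) =ᵐ[volume] fun x => ∑ j, g j x := by
    intro g
    simp_rw [Fin.sum_univ_three]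
    filter_upwards [Lp.coeFn_add (g 0 + g 1) (g 2), Lp.coeFn_add (g 0) (g 1)] with x h1 h2
    rw [h1, Pi.add_apply, h2, Pi.add_apply]
  rw [e]
  filter_upwards [Lp.coeFn_add (mulOp hb.v (f (.inl ())) + ∑ j, mulOp (hb.a j) (f (.inr (.inl j))))
      (∑ j, mulOp (hb.c j) (f (.inr (.inr (.inl j))))),
    Lp.coeFn_add (mulOp hb.v (f (.inl ()))) (∑ j, mulOp (hb.a j) (f (.inr (.inl j)))),
    hsum fun j => mulOp (hb.a j) (f (.inr (.inl j))),
    hsum fun j => mulOp (hb.c j) (f (.inr (.inr (.inl j)))),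
    mulOp_coe hb.v (f (.inl ())), ae_all_iff.2 fun j => mulOp_coe (hb.a j) (f (.inr (.inl j))),
    ae_all_iff.2 fun j => mulOp_coe (hb.c j) (f (.inr (.inr (.inl j))))]
    with x h1 h2 h3 h4 h5 h6 h7
  rw [h1, Pi.add_apply, h2, Pi.add_apply, h3, h4, h5]
  simp_rw [h6, h7]
  have hw := weight_mul_weight_neg s x
  rw [mul_add, mul_add, Finset.mul_sum, Finset.mul_sum]
  congr 1
  · congr 1
    · linear_combination ((Real.sqrt |V x| : ℂ) * f (.inl ()) x) * hw
    · refine Finset.sum_congr rfl fun j _ => ?_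
      linear_combination ((A x j : ℂ) * f (.inr (.inl j)) x) * hw
  · refine Finset.sum_congr rfl fun j _ => ?_
    linear_combination ((C j x : ℂ) * f (.inr (.inr (.inl j))) x) * hw

theorem sourceS_coe (f : KSpace) (j : Fin 3) :
    (fun x => weight (-s) x * sourceS hb j f x) =ᵐ[volume] fun x =>
      (D j x : ℂ) * f (.inr (.inr (.inr j))) x := by
  filter_upwards [mulOp_coe (hb.d j) (f (.inr (.inr (.inr j))))] with x h1
  have hw := weight_mul_weight_neg s x
  change weight (-s) x * mulOp (hb.d j) (f (.inr (.inr (.inr j)))) x = _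
  rw [h1]
  linear_combination ((D j x : ℂ) * f (.inr (.inr (.inr j))) x) * hw

theorem mZeroComp_coe (f : KSpace) (i : KIndex) : (mZeroComp hs hb i f : E3 → ℂ) =ᵐ[volume]
    fun x => uComponents V (fun i' => (f i' : E3 → ℂ)) i x +
      wComponents V A C D (fun x => weight s x * stateW hs hb f x)
        (fun j x => weight s x * gradW hs hb j f x) i x := by
  rcases i with ⟨⟩ | j | j | j
  · filter_upwards [Lp.coeFn_add (mulOp hb.u (f (.inl ()))) (mulOp hb.v (stateW hs hb f)),
      mulOp_coe hb.u (f (.inl ())), mulOp_coe hb.v (stateW hs hb f)] with x h1 h2 h3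
    change (mulOp hb.u (f (.inl ())) + mulOp hb.v (stateW hs hb f) : L2) x =
      signU V x * f (.inl ()) x + (Real.sqrt |V x| : ℂ) * (weight s x * stateW hs hb f x)
    rw [h1, Pi.add_apply, h2, h3]; ring
  · filter_upwards [Lp.coeFn_add (f (.inr (.inl j))) (mulOp (hb.a j) (stateW hs hb f)),
      mulOp_coe (hb.a j) (stateW hs hb f)] with x h1 h3
    change (f (.inr (.inl j)) + mulOp (hb.a j) (stateW hs hb f) : L2) x =
      f (.inr (.inl j)) x + (A x j : ℂ) * (weight s x * stateW hs hb f x)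
    rw [h1, Pi.add_apply, h3]; ring
  · filter_upwards [Lp.coeFn_add (-f (.inr (.inr (.inr j)))) (mulOp (hb.c j) (stateW hs hb f)),
      Lp.coeFn_neg (f (.inr (.inr (.inr j)))),
      mulOp_coe (hb.c j) (stateW hs hb f)] with x h1 h2 h3
    change (-f (.inr (.inr (.inr j))) + mulOp (hb.c j) (stateW hs hb f) : L2) x =
      -f (.inr (.inr (.inr j))) x + (C j x : ℂ) * (weight s x * stateW hs hb f x)
    rw [h1, Pi.add_apply, h2, h3, Pi.neg_apply]; ring
  · filter_upwards [Lp.coeFn_add (-f (.inr (.inr (.inl j)))) (mulOp (hb.d j) (gradW hs hb j f)),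
      Lp.coeFn_neg (f (.inr (.inr (.inl j)))),
      mulOp_coe (hb.d j) (gradW hs hb j f)] with x h1 h2 h3
    change (-f (.inr (.inr (.inl j))) + mulOp (hb.d j) (gradW hs hb j f) : L2) x =
      -f (.inr (.inr (.inl j))) x + (D j x : ℂ) * (weight s x * gradW hs hb j f x)
    rw [h1, Pi.add_apply, h2, h3, Pi.neg_apply]; ring

theorem representedBy_stateD (f : KSpace) :
    RepresentedBy (stateD hs hb f) fun x => weight s x * stateW hs hb f x := by
  have := representedBy_of_weightD (weightD_stateD hs hb f)
  rwa [neg_neg] at this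

theorem representedBy_momentum_stateD (f : KSpace) (j : Fin 3) :
    RepresentedBy (momentum j (stateD hs hb f)) fun x => weight s x * gradW hs hb j f x := by
  have := representedBy_of_weightD (weightD_momentum_stateD hs hb f j)
  rwa [neg_neg] at this

end

theorem isMZero_mZero {β : ℝ} (hβ : 1 ≤ β / 2) {V : E3 → ℝ} {A : E3 → E3} {C D : Fin 3 → E3 → ℝ}
    (hb : CoefficientBounds (β / 2) V A C D) : IsMZero β V A C D (mZero hβ hb) := by
  intro f
  set T : 𝓢'(E3, ℂ) := weightD (-(β / 2)) (toD (sourceT hb f)) with hTd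
  set S : Fin 3 → 𝓢'(E3, ℂ) := fun j => weightD (-(β / 2)) (toD (sourceS hb j f)) with hSd
  have hT : weightD (β / 2) T = toD (sourceT hb f) := by rw [hTd, weightD_weightD_neg]
  have hS : ∀ j, weightD (β / 2) (S j) = toD (sourceS hb j f) := fun j => by
    rw [hSd, weightD_weightD_neg]
  refine ⟨⟨T + ∑ j, momentum j (S j), mem_weightedSobolev_iff.2
      ⟨_, weightD_besselD_divergence hT hS⟩⟩,
    ⟨stateD hβ hb f, mem_weightedSobolev_of_greenRoot hβ (weightD_stateD' hβ hb f)⟩,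
    fun x => weight (β / 2) x * stateW hβ hb f x,
    fun j x => weight (β / 2) x * gradW hβ hb j f x, ⟨T, S, ?_, fun j => ?_, rfl⟩, ?_,
    representedBy_stateD hβ hb f, representedBy_momentum_stateD hβ hb f, fun i => ?_⟩
  · exact (representedBy_of_weightD hT).congr (sourceT_coe hb f)
  · exact (representedBy_of_weightD (hS j)).congr (sourceS_coe hb f j)
  · refine isFreeGreen_of_greenRoot hβ hT hS _ rfl ?_
    rw [← greenW_apply]
    exact weightD_stateD' hβ hb f
  · rw [mZero_apply]
    exact mZeroComp_coe hβ hb f i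

end MagneticSchrodinger
end

noncomputable section

namespace MagneticSchrodinger

open FourierTransform Set Filter Topology

open ContinuousLinearMap (adjoint)

/-! ## The kernel of `M₀` -/

theorem pair_weightS (k : L2) (r : ℝ) (φ : 𝓢(E3, ℂ)) :
    Integrable (fun x => weight r x * k x * φ x) ∧
      pair k (toL (weightS r φ)) = ∫ x, weight r x * k x * φ x := by
  have h : weightD (-r) (weightD r (toD k)) = toD k := weightD_neg_weightD r _
  have := representedBy_of_weightD h φ
  rw [neg_neg, weightD_apply, toD_apply] at this
  exact this

theorem momentumS_toSchwartz {φ : E3 → ℂ} (hφ : ContDiff ℝ ∞ φ) (hs : HasCompactSupport φ)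
    (j : Fin 3) (x : E3) :
    Complex.I * fderiv ℝ φ x (basisVec j) = -momentumS j (hs.toSchwartzMap hφ) x := by
  rw [momentumS_apply, neg_mul, neg_neg]
  rfl

section

variable {s : ℝ} (hs : 1 ≤ s) {V : E3 → ℝ} {A : E3 → E3} {C D : Fin 3 → E3 → ℝ}
  (hb : CoefficientBounds s V A C D)

/-- The components of an element of the kernel of `M₀` in terms of `u = G₀ w* f`. -/
theorem components_of_mZero_eq_zero (hV0 : ∀ x, 0 ≤ V x) {f : KSpace} (hf : mZero hs hb f = 0) :
    ∀ᵐ x, f (.inl ()) x = -((Real.sqrt |V x| : ℂ) * (weight s x * stateW hs hb f x)) ∧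
      (∀ j, f (.inr (.inl j)) x = -((A x j : ℂ) * (weight s x * stateW hs hb f x))) ∧
      (∀ j, f (.inr (.inr (.inr j))) x = (C j x : ℂ) * (weight s x * stateW hs hb f x)) ∧
      (∀ j, f (.inr (.inr (.inl j))) x = (D j x : ℂ) * (weight s x * gradW hs hb j f x)) := by
  have h0 : ∀ i, (mZeroComp hs hb i f : E3 → ℂ) =ᵐ[volume] 0 := fun i => by
    rw [← mZero_apply, hf]
    exact Lp.coeFn_zero _ _ _
  filter_upwards [ae_all_iff.2 h0, ae_all_iff.2 (mZeroComp_coe hs hb f)] with x h1 h2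
  have h3 : ∀ i, uComponents V (fun i' => (f i' : E3 → ℂ)) i x +
      wComponents V A C D (fun x => weight s x * stateW hs hb f x)
        (fun j x => weight s x * gradW hs hb j f x) i x = 0 := fun i => by
    rw [← h2, h1]; rfl
  refine ⟨?_, fun j => ?_, fun j => ?_, fun j => ?_⟩
  · have h := h3 (.inl ())
    simp only [uComponents, wComponents, signU, not_lt.2 (hV0 x), if_false] at h
    linear_combination h
  · have h := h3 (.inr (.inl j))
    simp only [uComponents, wComponents] at h
    linear_combination h
  · have h := h3 (.inr (.inr (.inl j)))
    simp only [uComponents, wComponents] at h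
    linear_combination -h
  · have h := h3 (.inr (.inr (.inr j)))
    simp only [uComponents, wComponents] at h
    linear_combination -h

/-- Substituting the components of `f` into `-Δu = w* f` gives `-Δu = -Vu - |A|²u + A·Pu + P·(Au)`,
which is `Hu = 0`. The exchange of the last two blocks by `𝒰` pairs each `C_j` with its `D_j` and so
restores `A_j = D_j C_j`. -/
theorem solvesZeroEnergy_stateD (hCD : ∀ j x, A x j = D j x * C j x) (hV0 : ∀ x, 0 ≤ V x)
    {f : KSpace} (hf : mZero hs hb f = 0) : SolvesZeroEnergy A V (stateD hs hb f) := by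
  refine ⟨_, _, representedBy_stateD hs hb f, representedBy_momentum_stateD hs hb f, ?_⟩
  intro φ hφ hφs
  set χ := hφs.toSchwartzMap hφ with hχ
  have hχφ : ∀ x, χ x = φ x := fun x => rfl
  have hweak := sum_pair_greenSource hs (sourceT hb f) (fun j => sourceS hb j f) χ
  rw [← greenW_apply] at hweak
  change ∑ j, pair (gradW hs hb j f) (toL (weightS s (momentumS j χ))) = _ at hweak
  have i1 := fun j => pair_weightS (gradW hs hb j f) s (momentumS j χ)
  have i2 := pair_weightS (sourceT hb f) (-s) χ
  have i3 := fun j => pair_weightS (sourceS hb j f) (-s) (momentumS j χ)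
  simp_rw [(i1 _).2, i2.2, (i3 _).2] at hweak
  rw [← integral_finsetSum _ fun j _ => (i1 j).1, ← integral_finsetSum _ fun j _ => (i3 j).1]
    at hweak
  have j1 := integrable_finsetSum Finset.univ fun j (_ : j ∈ Finset.univ) => (i1 j).1
  have j3 := integrable_finsetSum Finset.univ fun j (_ : j ∈ Finset.univ) => (i3 j).1
  have hz : ∫ x, (∑ j, weight (-s) x * sourceS hb j f x * momentumS j χ x -
      ∑ j, weight s x * gradW hs hb j f x * momentumS j χ x -
      weight (-s) x * sourceT hb f x * χ x) = 0 := by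
    have j31 : Integrable fun x => ∑ j, weight (-s) x * sourceS hb j f x * momentumS j χ x -
        ∑ j, weight s x * gradW hs hb j f x * momentumS j χ x := j3.sub j1
    rw [integral_sub j31 i2.1, integral_sub j3 j1, hweak]
    ring
  rw [← hz]
  apply integral_congr_ae
  filter_upwards [components_of_mZero_eq_zero hs hb hV0 hf, sourceT_coe hb f,
    ae_all_iff.2 (sourceS_coe hb f)] with x h1 h2 h3
  obtain ⟨c1, c2, c3, c4⟩ := h1
  have hV : (Real.sqrt |V x| : ℂ) * (Real.sqrt |V x| : ℂ) = (V x : ℂ) := by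
    rw [← Complex.ofReal_mul, Real.mul_self_sqrt (abs_nonneg _), abs_of_nonneg (hV0 x)]
  have hA : ∀ j, (A x j : ℂ) = (D j x : ℂ) * (C j x : ℂ) := fun j => by
    rw [hCD j x, Complex.ofReal_mul]
  simp_rw [h2, h3, c1, c2, c3, c4, momentumS_toSchwartz hφ hφs, ← hχ, ← hχφ]
  simp only [Fin.sum_univ_three, hA]
  linear_combination (weight s x * stateW hs hb f x * χ x) * (-hV)

/-- The zero-energy solution `u = G₀ w* f` vanishes by uniqueness, hence so do `w u` and `f = -𝒰 w
u`. -/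
theorem eq_zero_of_mZero_eq_zero (hA : ∀ j, MemLp (fun x => (A x j : ℂ)) ⊤ volume)
    (hV : MemLp (fun x => (V x : ℂ)) ⊤ volume) (hCD : ∀ j x, A x j = D j x * C j x)
    (hV0 : ∀ x, 0 ≤ V x) {f : KSpace} (hf : mZero hs hb f = 0) : f = 0 := by
  -- The weight `s = β/2` may exceed `3/2`; the better weight `1` is always admissible in the
  -- uniqueness theorem.
  have hmem : stateD hs hb f ∈ weightedSobolev 1 (-1) :=
    mem_weightedSobolev_of_greenRoot le_rfl
      (weightD_of_weightD_greenRoot hs le_rfl (weightD_stateD' hs hb f))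
  have h0 : stateD hs hb f = 0 := eq_zero_of_solvesZeroEnergy hA hV hV0 (by norm_num) hmem
    (solvesZeroEnergy_stateD hs hb hCD hV0 hf)
  have hz : toD (stateW hs hb f) = 0 := by rw [← weightD_stateD, h0, map_zero]
  have hg : ∀ j, toD (gradW hs hb j f) = 0 := fun j => by
    rw [← weightD_momentum_stateD, h0, ← momentumD_apply, map_zero, map_zero]
  have hz' : stateW hs hb f = 0 := toD_injective (hz.trans (map_zero _).symm)
  have hg' : ∀ j, gradW hs hb j f = 0 := fun j => toD_injective ((hg j).trans (map_zero _).symm)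
  have hc := components_of_mZero_eq_zero hs hb hV0 hf
  simp_rw [hz', hg'] at hc
  have h00 : ((0 : L2) : E3 → ℂ) =ᵐ[volume] 0 := Lp.coeFn_zero _ _ _
  ext1 i
  apply Lp.ext
  refine EventuallyEq.trans ?_ h00.symm
  filter_upwards [hc, h00] with x h1 h2
  obtain ⟨c1, c2, c3, c4⟩ := h1
  simp only [h2, Pi.zero_apply, mul_zero, neg_zero] at c1 c2 c3 c4
  rcases i with ⟨⟩ | j | j | j
  · exact c1
  · exact c2 j
  · exact c4 j
  · exact c3 j

end

theorem exists_isMZero {β : ℝ} (hβ : 2 < β) {V : E3 → ℝ} (hV : IsElectricPotential β V)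
    (hV0 : ∀ x, 0 ≤ V x) {A B : E3 → E3} (hA : IsVectorPotential β B A) {C D : Fin 3 → E3 → ℝ}
    (hCD : IsFactorization β A C D) :
    ∃ M₀ : KSpace →L[ℂ] KSpace, IsMZero β V A C D M₀ ∧ LinearMap.ker M₀.toLinearMap = ⊥ := by
  have hβ' : 1 ≤ β / 2 := by linarith
  have h0 : 0 ≤ β := by linarith
  refine ⟨mZero hβ' (coefficientBounds h0 hV hA hCD), isMZero_mZero hβ' _, ?_⟩
  rw [LinearMap.ker_eq_bot']
  exact fun f hf => eq_zero_of_mZero_eq_zero hβ' _ (hA.memLp_top h0) (hV.memLp_top h0) hCD.eq_mul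
    hV0 hf

end MagneticSchrodinger
end

noncomputable section

namespace MagneticSchrodinger

open Set Filter Topology

/-! ## Vector potentials that decay at infinity -/

/-- The cross product as a continuous bilinear map. -/
def crossB : E3 →L[ℝ] E3 →L[ℝ] E3 :=
  LinearMap.toContinuousLinearMap
    ((LinearMap.toContinuousLinearMap : (E3 →ₗ[ℝ] E3) ≃ₗ[ℝ] (E3 →L[ℝ] E3)).toLinearMap ∘ₗ
      LinearMap.mk₂ ℝ (fun v b : E3 => (!₂[v 1 * b 2 - v 2 * b 1, v 2 * b 0 - v 0 * b 2,
        v 0 * b 1 - v 1 * b 0] : E3))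
        (fun v w b => by ext i; fin_cases i <;> simp <;> ring)
        (fun c v b => by ext i; fin_cases i <;> simp <;> ring)
        (fun v b b' => by ext i; fin_cases i <;> simp <;> ring)
        (fun c v b => by ext i; fin_cases i <;> simp <;> ring))

theorem crossB_apply (v b : E3) : crossB v b = (!₂[v 1 * b 2 - v 2 * b 1, v 2 * b 0 - v 0 * b 2,
    v 0 * b 1 - v 1 * b 0] : E3) := rfl

theorem eq_sum_basisVec (v : E3) : v = ∑ j, v j • basisVec j := by
  ext i; fin_cases i <;> simp [Fin.sum_univ_three]

theorem clm_apply_eq_sum {F : Type*} [NormedAddCommGroup F] [NormedSpace ℝ F] (L : E3 →L[ℝ] F)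
    (v : E3) : L v = ∑ j, v j • L (basisVec j) := by
  conv_lhs => rw [eq_sum_basisVec v]
  simp only [map_sum, map_smul]

theorem norm_le_sum_basisVec (L : E3 →L[ℝ] E3) : ‖L‖ ≤ ∑ j, ‖L (basisVec j)‖ := by
  refine L.opNorm_le_bound (Finset.sum_nonneg fun j _ => norm_nonneg _) fun v => ?_
  conv_lhs => rw [clm_apply_eq_sum]
  rw [Finset.sum_mul]
  refine (norm_sum_le _ _).trans (Finset.sum_le_sum fun j _ => ?_)
  rw [norm_smul, mul_comm]
  gcongr
  exact PiLp.norm_apply_le v j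

/-- A `C¹` field that decays with its derivative like `⟨x⟩^{-p}`. -/
structure IsDecayingField (p c : ℝ) (B : E3 → E3) : Prop where
  contDiff : ContDiff ℝ 1 B
  bound : ∀ x, ‖B x‖ ≤ c * bracket x ^ (-p)
  bound_fderiv : ∀ x, ‖fderiv ℝ B x‖ ≤ c * bracket x ^ (-p)

theorem IsMagneticField.exists_isDecayingField {β : ℝ} {B : E3 → E3} (hB : IsMagneticField β B) :
    ∃ c, IsDecayingField (β + 1) c B := by
  obtain ⟨c, hc⟩ := hB.decay
  choose d hd using hB.decay_deriv
  have e : -β - 1 = -(β + 1) := by ring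
  rw [e] at hc hd
  have h0 : ∀ x, 0 ≤ bracket x ^ (-(β + 1)) := fun x => Real.rpow_nonneg (bracket_pos x).le _
  refine ⟨|c| + ∑ j, |d j|, hB.contDiff, fun x => (hc x).trans ?_, fun x => ?_⟩
  · refine mul_le_mul_of_nonneg_right ((le_abs_self c).trans ?_) (h0 x)
    linarith [Finset.sum_nonneg fun j (_ : j ∈ (Finset.univ : Finset (Fin 3))) => abs_nonneg (d j)]
  · refine (norm_le_sum_basisVec _).trans ?_
    calc ∑ j, ‖fderiv ℝ B x (basisVec j)‖ ≤ ∑ j, |d j| * bracket x ^ (-(β + 1)) :=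
          Finset.sum_le_sum fun j _ => (hd j x).trans
            (mul_le_mul_of_nonneg_right (le_abs_self _) (h0 x))
      _ = (∑ j, |d j|) * bracket x ^ (-(β + 1)) := by rw [Finset.sum_mul]
      _ ≤ _ := mul_le_mul_of_nonneg_right (by linarith [abs_nonneg c]) (h0 x)

/-- A density of mass one in the unit ball. -/
structure IsMollifier (Θ : ℝ) (θ : E3 → ℝ) : Prop where
  contDiff : ContDiff ℝ 1 θ
  support : ∀ x, 1 < ‖x‖ → θ x = 0
  support_fderiv : ∀ x, 1 < ‖x‖ → fderiv ℝ θ x = 0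
  bound : ∀ x, |θ x| ≤ Θ
  bound_fderiv : ∀ x, ‖fderiv ℝ θ x‖ ≤ Θ
  integral_eq : ∫ x, θ x = 1
  compact : HasCompactSupport θ

theorem exists_isMollifier : ∃ Θ θ, IsMollifier Θ θ := by
  let χ : ContDiffBump (0 : E3) := ⟨1 / 2, 1, by norm_num, by norm_num⟩
  set θ : E3 → ℝ := χ.normed volume with hθ
  have hd : ContDiff ℝ ∞ θ := χ.contDiff_normed
  have hs : HasCompactSupport θ := χ.hasCompactSupport_normed
  have hts : tsupport θ = Metric.closedBall 0 1 := χ.tsupport_normed_eq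
  have hnot : ∀ x : E3, 1 < ‖x‖ → x ∉ tsupport θ := fun x hx => by
    rw [hts, mem_closedBall_zero_iff, not_le]; exact hx
  obtain ⟨K, hK⟩ := hs.exists_bound_of_continuous hd.continuous
  obtain ⟨K', hK'⟩ := (hs.fderiv (𝕜 := ℝ)).exists_bound_of_continuous
    (hd.continuous_fderiv (by simp))
  refine ⟨max K K', θ, hd.of_le (by simp), fun x hx => image_eq_zero_of_notMem_tsupport (hnot x hx),
    fun x hx => image_eq_zero_of_notMem_tsupport fun h => hnot x hx (tsupport_fderiv_subset ℝ h),
    fun x => (hK x).trans (le_max_left _ _), fun x => (hK' x).trans (le_max_right _ _),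
    χ.integral_normed, hs⟩

/-- The integrand of the vector potential. -/
def potentialIntegrand (θ : E3 → ℝ) (B : E3 → E3) (x : E3) (q : ℝ × E3) : E3 :=
  -- Here `a = x + b` and `t = τ + 1`, so that `a + t(x-a) = x - τb` and `-t(x-a) = (τ+1)b`. In
  -- these variables differentiation in `x` never produces a factor `τ`.
  ((q.1 + 1) * θ (x + q.2)) • crossB (B (x - q.1 • q.2)) q.2

/-- The derivative of the integrand of the vector potential. -/
def potentialIntegrandDeriv (θ : E3 → ℝ) (B : E3 → E3) (x : E3) (q : ℝ × E3) : E3 →L[ℝ] E3 :=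
  (q.1 + 1) • ((fderiv ℝ θ (x + q.2)).smulRight (crossB (B (x - q.1 • q.2)) q.2) +
    θ (x + q.2) • (crossB.flip q.2 ∘L fderiv ℝ B (x - q.1 • q.2)))

/-- The measure `dτ db` on `(0, ∞) × ℝ³`. -/
def rayMeasure : Measure (ℝ × E3) := (volume.restrict (Ioi 0)).prod volume

/-- The average of the potentials `-∫_1^∞ B(a + t(x-a)) × t(x-a) dt` over `a`. -/
def rayPotential (θ : E3 → ℝ) (B : E3 → E3) (x : E3) : E3 :=
  ∫ q, potentialIntegrand θ B x q ∂rayMeasure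

/-- For bounded `x` the bracket along the ray is at least a multiple of `1 + τ‖b‖`. Up to two powers
of `(τ+1)‖b‖` are spent, each at most `(1+S)(1+τ‖b‖)`, which leaves the exponent `p - 2`. -/
theorem weight_ray_le {p S τ : ℝ} (hp : 0 ≤ p) (hS : 0 ≤ S) (hτ : 0 ≤ τ) {x b : E3} (hx : ‖x‖ ≤ S)
    (hb : ‖b‖ ≤ S) {m : ℕ} (hm : m ≤ 2) :
    ((τ + 1) * ‖b‖) ^ m * bracket (x - τ • b) ^ (-p) ≤
      (1 + S) ^ 2 * (2 + S) ^ p * (1 + τ * ‖b‖) ^ (-(p - 2)) := by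
  set y := 1 + τ * ‖b‖ with hy
  have hτb : 0 ≤ τ * ‖b‖ := by positivity
  have hy1 : 1 ≤ y := by linarith
  have hy0 : 0 < y := by linarith
  have hbr := bracket_pos (x - τ • b)
  have h1 : ((τ + 1) * ‖b‖) ^ m ≤ ((1 + S) * y) ^ 2 := by
    have h2 : (τ + 1) * ‖b‖ ≤ (1 + S) * y := by nlinarith
    have h3 : 1 ≤ (1 + S) * y := by nlinarith
    calc ((τ + 1) * ‖b‖) ^ m ≤ ((1 + S) * y) ^ m := by gcongr
      _ ≤ _ := pow_le_pow_right₀ h3 hm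
  have h4 : y ≤ (2 + S) * bracket (x - τ • b) := by
    have e1 : ‖τ • b‖ = τ * ‖b‖ := by rw [norm_smul, Real.norm_of_nonneg hτ]
    have e2 : ‖τ • b‖ ≤ ‖x‖ + ‖x - τ • b‖ := by
      have := norm_sub_le x (x - τ • b)
      rwa [sub_sub_cancel] at this
    have e3 := norm_le_bracket (x - τ • b)
    have e4 := one_le_bracket (x - τ • b)
    nlinarith
  have h5 : bracket (x - τ • b) ^ (-p) ≤ (2 + S) ^ p * y ^ (-p) := by
    have : (y / (2 + S)) ≤ bracket (x - τ • b) := by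
      rw [div_le_iff₀ (by linarith)]; linarith
    refine (Real.rpow_le_rpow_of_nonpos (by positivity) this (by linarith)).trans (le_of_eq ?_)
    rw [Real.div_rpow hy0.le (by linarith), Real.rpow_neg (by linarith : 0 ≤ 2 + S), div_inv_eq_mul,
      mul_comm]
  have e : y ^ (-(p - 2)) = y ^ 2 * y ^ (-p) := by
    rw [← Real.rpow_two, ← Real.rpow_add hy0]; congr 1; ring
  rw [e]
  calc _ ≤ ((1 + S) * y) ^ 2 * ((2 + S) ^ p * y ^ (-p)) := by gcongr
    _ = _ := by ring

/-- The majorant of the integrands. -/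
def rayMajorant (S r : ℝ) (q : ℝ × E3) : ℝ :=
  (Metric.closedBall (0 : E3) S).indicator (fun b => ‖b‖⁻¹ * (1 + q.1 * ‖b‖) ^ (-r)) q.2

theorem integrableOn_ray {r c : ℝ} (hr : 1 < r) (hc : 0 < c) :
    IntegrableOn (fun τ : ℝ => (1 + τ * c) ^ (-r)) (Ioi 0) ∧
      ∫ τ in Ioi 0, (1 + τ * c) ^ (-r) = c⁻¹ * ∫ t in Ioi (0 : ℝ), (t + 1) ^ (-r) := by
  have e : (fun τ : ℝ => (1 + τ * c) ^ (-r)) = fun τ => (fun t : ℝ => (t + 1) ^ (-r)) (c * τ) := by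
    funext τ; simp only; congr 1; ring
  rw [e]
  constructor
  · refine (integrableOn_Ioi_comp_mul_left_iff (fun t : ℝ => (t + 1) ^ (-r)) 0 hc).2 ?_
    rw [mul_zero]
    exact integrableOn_add_rpow_Ioi_of_lt (by linarith) (by norm_num)
  · refine (integral_comp_mul_left_Ioi (fun t : ℝ => (t + 1) ^ (-r)) 0 hc).trans ?_
    rw [mul_zero, smul_eq_mul]

/-- In polar coordinates the Jacobian `r²` of three dimensions exactly cancels the singularity. -/
theorem integrable_norm_inv_sq (S : ℝ) :
    Integrable fun b : E3 => (Metric.closedBall (0 : E3) S).indicator (fun b => ‖b‖⁻¹ * ‖b‖⁻¹) b := by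
  have e : (fun b : E3 => (Metric.closedBall (0 : E3) S).indicator (fun b => ‖b‖⁻¹ * ‖b‖⁻¹) b) =
      fun b => (fun t : ℝ => (Iic S).indicator (fun t => t⁻¹ * t⁻¹) t) ‖b‖ := by
    funext b
    simp only [indicator, mem_closedBall_zero_iff, mem_Iic]
  rw [e, integrable_fun_norm_addHaar, finrank_euclideanSpace_fin]
  have h1 : IntegrableOn (fun _ : ℝ => (1 : ℝ)) (Ioc 0 S) := by simp
  have h2 : IntegrableOn ((Iic S).indicator fun _ : ℝ => (1 : ℝ)) (Ioi 0) := by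
    rw [IntegrableOn, integrable_indicator_iff measurableSet_Iic, IntegrableOn,
      Measure.restrict_restrict measurableSet_Iic, inter_comm, Ioi_inter_Iic]
    exact h1
  refine h2.congr_fun (fun t ht => ?_) measurableSet_Ioi
  have ht' : t ≠ 0 := (mem_Ioi.1 ht).ne'
  simp only [indicator]
  split_ifs
  · simp; field_simp
  · simp

/-- The `τ`-integral converges for `r > 1` and contributes a second factor `‖b‖⁻¹`; the resulting
`‖b‖⁻²` is locally integrable in dimension three. With `r = p - 2` and `p = β + 1` the condition
reads `β > 2`. -/
theorem integrable_rayMajorant (S : ℝ) {r : ℝ} (hr : 1 < r) :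
    Integrable (rayMajorant S r) rayMeasure := by
  have hm : Measurable (rayMajorant S r) := by
    have h : rayMajorant S r = (Prod.snd ⁻¹' Metric.closedBall (0 : E3) S).indicator
        fun q : ℝ × E3 => ‖q.2‖⁻¹ * (1 + q.1 * ‖q.2‖) ^ (-r) := by
      funext q; rfl
    rw [h]
    exact Measurable.indicator (by fun_prop)
      (measurable_snd Metric.isClosed_closedBall.measurableSet)
  rw [rayMeasure, integrable_prod_iff' hm.aestronglyMeasurable]
  constructor
  · filter_upwards [ae_ne_zero] with b hb
    have hb' := norm_pos_iff.2 hb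
    simp only [rayMajorant, indicator]
    split_ifs
    · exact (integrableOn_ray hr hb').1.const_mul _
    · simp
  · refine ((integrable_norm_inv_sq S).mul_const (∫ t in Ioi (0 : ℝ), (t + 1) ^ (-r))).congr ?_
    filter_upwards [ae_ne_zero] with b hb
    have hb' := norm_pos_iff.2 hb
    simp only [rayMajorant, indicator]
    split_ifs
    · rw [mul_assoc, ← (integrableOn_ray hr hb').2, ← integral_const_mul]
      refine setIntegral_congr_fun measurableSet_Ioi fun t ht => ?_
      have ht' : 0 < t := ht
      rw [Real.norm_of_nonneg]
      positivity
    · simp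

theorem rayMajorant_of_le {S r : ℝ} {τ : ℝ} {b : E3} (hb : ‖b‖ ≤ S) :
    rayMajorant S r (τ, b) = ‖b‖⁻¹ * (1 + τ * ‖b‖) ^ (-r) :=
  indicator_of_mem (mem_closedBall_zero_iff.2 hb) _

theorem rayMajorant_nonneg (S r : ℝ) {τ : ℝ} (hτ : 0 ≤ τ) (b : E3) : 0 ≤ rayMajorant S r (τ, b) := by
  refine indicator_nonneg (fun b _ => ?_) _
  positivity

theorem ae_rayMeasure_pos : ∀ᵐ q ∂rayMeasure, 0 < q.1 := by
  have : ∀ᵐ t ∂(volume.restrict (Ioi (0 : ℝ))), 0 < t := ae_restrict_mem measurableSet_Ioi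
  exact Measure.quasiMeasurePreserving_fst.ae this

end MagneticSchrodinger
end

/-! ### Differentiability of the averaged ray potential -/

noncomputable section

namespace MagneticSchrodinger

open Set Filter Topology

theorem integrableOn_rayMajorant (S : ℝ) {r : ℝ} (hr : 1 < r) {b : E3} (hb : b ≠ 0) :
    IntegrableOn (fun τ => rayMajorant S r (τ, b)) (Ioi 0) := by
  simp only [rayMajorant, indicator]
  split_ifs
  · exact (integrableOn_ray hr (norm_pos_iff.2 hb)).1.const_mul _
  · simp

/-- There is one power of `τ + 1` more than of `‖b‖`; supplying the missing `‖b‖` costs the factor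
`‖b‖⁻¹` in the majorant. -/
theorem ray_weight_le_rayMajorant {p S τ : ℝ} (hp : 0 ≤ p) (hS : 0 ≤ S) (hτ : 0 ≤ τ) {x b : E3}
    (hx : ‖x‖ ≤ S) (hb : ‖b‖ ≤ S) (hb0 : b ≠ 0) {m : ℕ} (hm : m ≤ 1) :
    (τ + 1) ^ (m + 1) * ‖b‖ ^ m * bracket (x - τ • b) ^ (-p) ≤
      (1 + S) ^ 2 * (2 + S) ^ p * rayMajorant S (p - 2) (τ, b) := by
  have hb' := norm_pos_iff.2 hb0
  have h := weight_ray_le hp hS hτ hx hb (by omega : m + 1 ≤ 2)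
  rw [rayMajorant_of_le hb]
  calc (τ + 1) ^ (m + 1) * ‖b‖ ^ m * bracket (x - τ • b) ^ (-p)
      = (((τ + 1) * ‖b‖) ^ (m + 1) * bracket (x - τ • b) ^ (-p)) * ‖b‖⁻¹ := by
        rw [mul_pow]; field_simp; ring
    _ ≤ ((1 + S) ^ 2 * (2 + S) ^ p * (1 + τ * ‖b‖) ^ (-(p - 2))) * ‖b‖⁻¹ := by gcongr
    _ = _ := by ring

theorem norm_le_of_norm_add_le {R : ℝ} {x b : E3} (hx : ‖x‖ ≤ R) (h : ¬ 1 < ‖x + b‖) :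
    ‖b‖ ≤ R + 1 := by
  have := norm_sub_le (x + b) x
  rw [add_sub_cancel_left] at this
  linarith

section

variable {Θ p c R τ : ℝ} {θ : E3 → ℝ} {B : E3 → E3} {x b : E3}

theorem norm_potentialIntegrand_le (hθ : IsMollifier Θ θ) (hB : IsDecayingField p c B) (hp : 0 ≤ p)
    (hx : ‖x‖ ≤ R) (hτ : 0 ≤ τ) :
    ‖potentialIntegrand θ B x (τ, b)‖ ≤
      ‖crossB‖ * Θ * c * ((R + 1) * ((1 + (R + 1)) ^ 2 * (2 + (R + 1)) ^ p)) *
        rayMajorant (R + 1) (p - 2) (τ, b) := by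
  have hR : 0 ≤ R := (norm_nonneg x).trans hx
  have hΘ : 0 ≤ Θ := (abs_nonneg _).trans (hθ.bound 0)
  have hc : 0 ≤ c := nonneg_of_mul_nonneg_left ((norm_nonneg _).trans (hB.bound 0))
    (Real.rpow_pos_of_pos (bracket_pos 0) _)
  have h0 := rayMajorant_nonneg (R + 1) (p - 2) hτ b
  by_cases h : 1 < ‖x + b‖
  · simp only [potentialIntegrand, hθ.support _ h, mul_zero, zero_smul, norm_zero]
    positivity
  by_cases hb0 : b = 0
  · subst hb0
    simp only [potentialIntegrand, map_zero, smul_zero, norm_zero]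
    positivity
  have hb := norm_le_of_norm_add_le hx h
  have h1 : (τ + 1) * ‖b‖ * bracket (x - τ • b) ^ (-p) ≤
      (R + 1) * ((1 + (R + 1)) ^ 2 * (2 + (R + 1)) ^ p * rayMajorant (R + 1) (p - 2) (τ, b)) := by
    refine le_trans (le_of_eq ?_) (mul_le_mul hb (ray_weight_le_rayMajorant hp (by linarith) hτ
      (hx.trans (by linarith)) hb hb0 zero_le_one) ?_ (by linarith))
    · ring
    · have := bracket_pos (x - τ • b)
      positivity
  have h2 : ‖crossB (B (x - τ • b)) b‖ ≤ ‖crossB‖ * (c * bracket (x - τ • b) ^ (-p)) * ‖b‖ :=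
    (crossB.le_opNorm₂ _ _).trans (by gcongr; exact hB.bound _)
  calc ‖potentialIntegrand θ B x (τ, b)‖
      = (τ + 1) * |θ (x + b)| * ‖crossB (B (x - τ • b)) b‖ := by
        rw [potentialIntegrand, norm_smul, norm_mul, Real.norm_of_nonneg (by simp only; linarith),
          Real.norm_eq_abs]
    _ ≤ (τ + 1) * Θ * (‖crossB‖ * (c * bracket (x - τ • b) ^ (-p)) * ‖b‖) := by
        gcongr; exact hθ.bound _
    _ = ‖crossB‖ * Θ * c * ((τ + 1) * ‖b‖ * bracket (x - τ • b) ^ (-p)) := by ring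
    _ ≤ ‖crossB‖ * Θ * c * ((R + 1) * ((1 + (R + 1)) ^ 2 * (2 + (R + 1)) ^ p *
        rayMajorant (R + 1) (p - 2) (τ, b))) := by gcongr
    _ = _ := by ring

/-- The derivative in `x` falls on `θ(x+b)` or on `B(x-τb)`, and neither gains a factor `τ`. The
integrand and its derivative therefore share one majorant, and the `2` counts the two terms. -/
theorem norm_potentialIntegrandDeriv_le (hθ : IsMollifier Θ θ) (hB : IsDecayingField p c B)
    (hp : 0 ≤ p) (hx : ‖x‖ ≤ R) (hτ : 0 ≤ τ) :
    ‖potentialIntegrandDeriv θ B x (τ, b)‖ ≤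
      2 * (‖crossB‖ * Θ * c * ((R + 1) * ((1 + (R + 1)) ^ 2 * (2 + (R + 1)) ^ p))) *
        rayMajorant (R + 1) (p - 2) (τ, b) := by
  have hR : 0 ≤ R := (norm_nonneg x).trans hx
  have hΘ : 0 ≤ Θ := (abs_nonneg _).trans (hθ.bound 0)
  have hc : 0 ≤ c := nonneg_of_mul_nonneg_left ((norm_nonneg _).trans (hB.bound 0))
    (Real.rpow_pos_of_pos (bracket_pos 0) _)
  have h0 := rayMajorant_nonneg (R + 1) (p - 2) hτ b
  by_cases h : 1 < ‖x + b‖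
  · have : potentialIntegrandDeriv θ B x (τ, b) = 0 := by
      ext1 v
      simp [potentialIntegrandDeriv, hθ.support _ h, hθ.support_fderiv _ h]
    rw [this, norm_zero]
    positivity
  by_cases hb0 : b = 0
  · have : potentialIntegrandDeriv θ B x (τ, b) = 0 := by
      ext1 v
      simp [potentialIntegrandDeriv, hb0]
    rw [this, norm_zero]
    positivity
  have hb := norm_le_of_norm_add_le hx h
  have h1 : (τ + 1) * ‖b‖ * bracket (x - τ • b) ^ (-p) ≤
      (R + 1) * ((1 + (R + 1)) ^ 2 * (2 + (R + 1)) ^ p * rayMajorant (R + 1) (p - 2) (τ, b)) := by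
    refine le_trans (le_of_eq ?_) (mul_le_mul hb (ray_weight_le_rayMajorant hp (by linarith) hτ
      (hx.trans (by linarith)) hb hb0 zero_le_one) ?_ (by linarith))
    · ring
    · have := bracket_pos (x - τ • b)
      positivity
  have h2 : ‖crossB (B (x - τ • b)) b‖ ≤ ‖crossB‖ * (c * bracket (x - τ • b) ^ (-p)) * ‖b‖ :=
    (crossB.le_opNorm₂ _ _).trans (by gcongr; exact hB.bound _)
  have h3 : ‖(fderiv ℝ θ (x + b)).smulRight (crossB (B (x - τ • b)) b)‖ ≤
      Θ * (‖crossB‖ * (c * bracket (x - τ • b) ^ (-p)) * ‖b‖) := by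
    rw [ContinuousLinearMap.norm_smulRight_apply]
    gcongr
    exact hθ.bound_fderiv _
  have h4 : ‖θ (x + b) • (crossB.flip b ∘L fderiv ℝ B (x - τ • b))‖ ≤
      Θ * ((‖crossB‖ * ‖b‖) * (c * bracket (x - τ • b) ^ (-p))) := by
    rw [norm_smul]
    gcongr
    · exact hθ.bound _
    · refine (ContinuousLinearMap.opNorm_comp_le _ _).trans ?_
      gcongr
      · exact (crossB.flip.le_opNorm b).trans (by rw [ContinuousLinearMap.opNorm_flip])
      · exact hB.bound_fderiv _
  calc ‖potentialIntegrandDeriv θ B x (τ, b)‖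
      = (τ + 1) * ‖(fderiv ℝ θ (x + b)).smulRight (crossB (B (x - τ • b)) b) +
          θ (x + b) • (crossB.flip b ∘L fderiv ℝ B (x - τ • b))‖ := by
        rw [potentialIntegrandDeriv, norm_smul, Real.norm_of_nonneg (by simp only; linarith)]
    _ ≤ (τ + 1) * (Θ * (‖crossB‖ * (c * bracket (x - τ • b) ^ (-p)) * ‖b‖) +
          Θ * ((‖crossB‖ * ‖b‖) * (c * bracket (x - τ • b) ^ (-p)))) := by
        gcongr; exact (norm_add_le _ _).trans (add_le_add h3 h4)
    _ = 2 * (‖crossB‖ * Θ * c) * ((τ + 1) * ‖b‖ * bracket (x - τ • b) ^ (-p)) := by ring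
    _ ≤ 2 * (‖crossB‖ * Θ * c) * ((R + 1) * ((1 + (R + 1)) ^ 2 * (2 + (R + 1)) ^ p *
        rayMajorant (R + 1) (p - 2) (τ, b))) := by gcongr
    _ = _ := by ring

end

section

variable {Θ p c : ℝ} {θ : E3 → ℝ} {B : E3 → E3}

theorem continuous_potentialIntegrand (hθ : IsMollifier Θ θ) (hB : IsDecayingField p c B) :
    Continuous fun y : E3 × (ℝ × E3) => potentialIntegrand θ B y.1 y.2 := by
  have h1 := hθ.contDiff.continuous
  have h2 := hB.contDiff.continuous
  unfold potentialIntegrand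
  fun_prop

theorem continuous_potentialIntegrandDeriv (hθ : IsMollifier Θ θ) (hB : IsDecayingField p c B) :
    Continuous fun y : E3 × (ℝ × E3) => potentialIntegrandDeriv θ B y.1 y.2 := by
  have h1 := hθ.contDiff.continuous
  have h2 := hB.contDiff.continuous
  have h3 := hθ.contDiff.continuous_fderiv one_ne_zero
  have h4 := hB.contDiff.continuous_fderiv one_ne_zero
  have h5 : Continuous fun y : E3 × (ℝ × E3) =>
      (fderiv ℝ θ (y.1 + y.2.2)).smulRight (crossB (B (y.1 - y.2.1 • y.2.2)) y.2.2) := by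
    have e := (ContinuousLinearMap.smulRightL ℝ E3 E3).continuous₂
    exact e.comp (by fun_prop : Continuous fun y : E3 × (ℝ × E3) =>
      (fderiv ℝ θ (y.1 + y.2.2), crossB (B (y.1 - y.2.1 • y.2.2)) y.2.2))
  unfold potentialIntegrandDeriv
  have h6 : Continuous fun y : E3 × (ℝ × E3) =>
      crossB.flip y.2.2 ∘L fderiv ℝ B (y.1 - y.2.1 • y.2.2) :=
    Continuous.clm_comp (by fun_prop) (by fun_prop)
  exact (by fun_prop : Continuous fun y : E3 × (ℝ × E3) => y.2.1 + 1).smul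
    (h5.add ((by fun_prop : Continuous fun y : E3 × (ℝ × E3) => θ (y.1 + y.2.2)).smul h6))

theorem hasFDerivAt_potentialIntegrand (hθ : IsMollifier Θ θ) (hB : IsDecayingField p c B) (x : E3)
    (q : ℝ × E3) :
    HasFDerivAt (fun x => potentialIntegrand θ B x q) (potentialIntegrandDeriv θ B x q) x := by
  have h1 : HasFDerivAt (fun x => θ (x + q.2)) (fderiv ℝ θ (x + q.2)) x :=
    (hasFDerivAt_comp_add_right q.2).2 (hθ.contDiff.differentiable one_ne_zero _).hasFDerivAt
  have h2 : HasFDerivAt (fun x => B (x - q.1 • q.2)) (fderiv ℝ B (x - q.1 • q.2)) x :=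
    (hasFDerivAt_comp_sub (q.1 • q.2)).2 (hB.contDiff.differentiable one_ne_zero _).hasFDerivAt
  have h3 := (crossB.flip q.2).hasFDerivAt.comp x h2
  refine ((h1.const_mul (q.1 + 1)).smul h3).congr_fderiv ?_
  ext1 v
  simp only [potentialIntegrandDeriv, add_apply,
    smul_apply, ContinuousLinearMap.smulRight_apply, Function.comp_apply,
    ContinuousLinearMap.flip_apply, ContinuousLinearMap.comp_apply, smul_add, smul_smul,
    smul_eq_mul]
  rw [add_comm]

theorem exists_potential_bounds (hθ : IsMollifier Θ θ) (hB : IsDecayingField p c B) (hp : 0 ≤ p)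
    (R : ℝ) : ∃ K, ∀ {x b : E3} {τ : ℝ}, ‖x‖ ≤ R → 0 ≤ τ →
      ‖potentialIntegrand θ B x (τ, b)‖ ≤ K * rayMajorant (R + 1) (p - 2) (τ, b) ∧
        ‖potentialIntegrandDeriv θ B x (τ, b)‖ ≤ K * rayMajorant (R + 1) (p - 2) (τ, b) := by
  set K := ‖crossB‖ * Θ * c * ((R + 1) * ((1 + (R + 1)) ^ 2 * (2 + (R + 1)) ^ p))
  refine ⟨2 * |K|, fun {x b τ} hx hτ => ?_⟩
  have h0 := rayMajorant_nonneg (R + 1) (p - 2) hτ b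
  have hK := le_abs_self K
  have hK' := abs_nonneg K
  exact ⟨(norm_potentialIntegrand_le hθ hB hp hx hτ).trans
    (mul_le_mul_of_nonneg_right (by linarith) h0),
    (norm_potentialIntegrandDeriv_le hθ hB hp hx hτ).trans
    (mul_le_mul_of_nonneg_right (by linarith) h0)⟩

theorem integrable_potentialIntegrand (hθ : IsMollifier Θ θ) (hB : IsDecayingField p c B)
    (hp : 3 < p) (x : E3) : Integrable (potentialIntegrand θ B x) rayMeasure := by
  have hm : Continuous (potentialIntegrand θ B x) :=
    (continuous_potentialIntegrand hθ hB).comp (by fun_prop : Continuous fun q => (x, q))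
  obtain ⟨K, hK⟩ := exists_potential_bounds hθ hB (by linarith) ‖x‖
  refine ((integrable_rayMajorant (‖x‖ + 1) (by linarith : 1 < p - 2)).const_mul K).mono'
    hm.aestronglyMeasurable ?_
  filter_upwards [ae_rayMeasure_pos] with q hq
  exact (hK le_rfl hq.le).1

theorem integrable_potentialIntegrandDeriv (hθ : IsMollifier Θ θ) (hB : IsDecayingField p c B)
    (hp : 3 < p) (x : E3) : Integrable (potentialIntegrandDeriv θ B x) rayMeasure := by
  have hm : Continuous (potentialIntegrandDeriv θ B x) :=
    (continuous_potentialIntegrandDeriv hθ hB).comp (by fun_prop : Continuous fun q => (x, q))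
  obtain ⟨K, hK⟩ := exists_potential_bounds hθ hB (by linarith) ‖x‖
  refine ((integrable_rayMajorant (‖x‖ + 1) (by linarith : 1 < p - 2)).const_mul K).mono'
    hm.aestronglyMeasurable ?_
  filter_upwards [ae_rayMeasure_pos] with q hq
  exact (hK le_rfl hq.le).2

theorem hasFDerivAt_rayPotential (hθ : IsMollifier Θ θ) (hB : IsDecayingField p c B)
    (hp : 3 < p) (x : E3) :
    HasFDerivAt (rayPotential θ B) (∫ q, potentialIntegrandDeriv θ B x q ∂rayMeasure) x := by
  obtain ⟨K, hK⟩ := exists_potential_bounds hθ hB (by linarith) (‖x‖ + 1)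
  refine hasFDerivAt_integral_of_dominated_of_fderiv_le
    (Metric.ball_mem_nhds x one_pos)
    (Eventually.of_forall fun y => (integrable_potentialIntegrand hθ hB hp y).1)
    (integrable_potentialIntegrand hθ hB hp x) (integrable_potentialIntegrandDeriv hθ hB hp x).1
    ?_ ((integrable_rayMajorant (‖x‖ + 1 + 1) (by linarith : 1 < p - 2)).const_mul K)
    (ae_of_all _ fun q y _ => hasFDerivAt_potentialIntegrand hθ hB y q)
  filter_upwards [ae_rayMeasure_pos] with q hq y hy
  exact (hK (norm_lt_of_mem_ball hy).le hq.le).2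

theorem contDiff_rayPotential (hθ : IsMollifier Θ θ) (hB : IsDecayingField p c B)
    (hp : 3 < p) : ContDiff ℝ 1 (rayPotential θ B) := by
  rw [contDiff_one_iff_fderiv]
  refine ⟨fun x => (hasFDerivAt_rayPotential hθ hB hp x).differentiableAt, ?_⟩
  rw [funext fun x => (hasFDerivAt_rayPotential hθ hB hp x).fderiv, continuous_iff_continuousAt]
  intro x
  obtain ⟨K, hK⟩ := exists_potential_bounds hθ hB (by linarith) (‖x‖ + 1)
  refine continuousAt_of_dominated
    (Eventually.of_forall fun y => (integrable_potentialIntegrandDeriv hθ hB hp y).1) ?_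
    ((integrable_rayMajorant (‖x‖ + 1 + 1) (by linarith : 1 < p - 2)).const_mul K)
    (ae_of_all _ fun q => ((continuous_potentialIntegrandDeriv hθ hB).comp
      (by fun_prop : Continuous fun y : E3 => (y, q))).continuousAt)
  filter_upwards [Metric.ball_mem_nhds x one_pos] with y hy
  filter_upwards [ae_rayMeasure_pos] with q hq
  exact (hK (norm_lt_of_mem_ball hy).le hq.le).2

end

end MagneticSchrodinger
end

/-! ### The curl of the averaged ray potential -/

noncomputable section

namespace MagneticSchrodinger

open Set Filter Topology

/-- The components of the rotation of a field with derivative `L`. -/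
def curlComp (i : Fin 3) : (E3 →L[ℝ] E3) →L[ℝ] ℝ :=
  (EuclideanSpace.proj (i + 2) : E3 →L[ℝ] ℝ) ∘L
      ContinuousLinearMap.apply ℝ E3 (basisVec (i + 1)) -
    (EuclideanSpace.proj (i + 1) : E3 →L[ℝ] ℝ) ∘L
      ContinuousLinearMap.apply ℝ E3 (basisVec (i + 2))

theorem curlComp_apply (i : Fin 3) (L : E3 →L[ℝ] E3) :
    curlComp i L = L (basisVec (i + 1)) (i + 2) - L (basisVec (i + 2)) (i + 1) := rfl

theorem curl_apply (X : E3 → E3) (x : E3) (i : Fin 3) :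
    curl X x i = curlComp i (fderiv ℝ X x) := by
  rw [curlComp_apply]
  fin_cases i <;> rfl

theorem integral_divergence_eq_zero {W : E3 → E3} (hW : ContDiff ℝ 1 W) (hs : HasCompactSupport W) :
    ∫ x, divergence W x = 0 := by
  have hc : Continuous (fderiv ℝ W) := hW.continuous_fderiv one_ne_zero
  have hi : ∀ l : Fin 3, Integrable fun x => fderiv ℝ W x (basisVec l) := fun l =>
    (by fun_prop : Continuous fun x => fderiv ℝ W x (basisVec l)).integrable_of_hasCompactSupport
      ((hs.fderiv_apply (𝕜 := ℝ) (basisVec l)))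
  have h0 : ∀ l : Fin 3, ∫ x, fderiv ℝ W x (basisVec l) = 0 := fun l => by
    have h := integral_smul_fderiv_eq_neg_fderiv_smul_of_integrable (μ := volume)
      (f := fun _ : E3 => (1 : ℝ)) (g := W) (v := basisVec l) (by simp) (by simpa using hi l)
      (by simpa using hW.continuous.integrable_of_hasCompactSupport hs) (by fun_prop)
      fun x _ => hW.differentiable one_ne_zero x
    simpa using h
  have h1 : ∀ l : Fin 3, Integrable fun x => partialD W l l x := fun l =>
    (EuclideanSpace.proj l : E3 →L[ℝ] ℝ).integrable_comp (hi l)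
  simp only [divergence]
  rw [integral_finsetSum _ fun l _ => h1 l]
  refine Finset.sum_eq_zero fun l _ => ?_
  have := (EuclideanSpace.proj l : E3 →L[ℝ] ℝ).integral_comp_comm (hi l)
  rw [h0 l, map_zero] at this
  exact this

/-- The derivative of `b ↦ θ(x+b) (F_i(b) b - b_i F(b))` where `F(b) = B(x - τ b)`, in terms of
`H = ∇θ(x+b)`, `t = θ(x+b)`, `G = ∇B(x - τ b)` and `F = B(x - τ b)`. -/
def fluxDeriv (i : Fin 3) (H : E3 →L[ℝ] ℝ) (t τ : ℝ) (F b : E3) (G : E3 →L[ℝ] E3) : E3 →L[ℝ] E3 :=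
  t • ((F i • ContinuousLinearMap.id ℝ E3 +
      ((EuclideanSpace.proj i : E3 →L[ℝ] ℝ) ∘L (-τ • G)).smulRight b) -
      (b i • (-τ • G) + (EuclideanSpace.proj i : E3 →L[ℝ] ℝ).smulRight F)) +
    H.smulRight (F i • b - b i • F)

/-- An algebraic identity: the curl of the integrand is a total derivative in `τ` plus `τ + 1` times
a divergence in `b`. The left over trace of `G` is the divergence of `B`, so `∇·B = 0` enters here.
-/
theorem curlComp_sub_eq (i : Fin 3) (H : E3 →L[ℝ] ℝ) (t τ : ℝ) (F b : E3) {G : E3 →L[ℝ] E3}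
    (hG : ∑ l, G (basisVec l) l = 0) :
    curlComp i ((τ + 1) • (H.smulRight (crossB F b) + t • (crossB.flip b ∘L G))) +
      t * (2 * (τ + 1) * F i - (τ + 1) ^ 2 * G b i) =
      (τ + 1) * ∑ l, fluxDeriv i H t τ F b G (basisVec l) l := by
  rw [clm_apply_eq_sum G b, curlComp_apply]
  rw [Fin.sum_univ_three] at hG
  simp only [Fin.sum_univ_three, fluxDeriv, crossB_apply, add_apply, smul_apply, sub_apply,
    ContinuousLinearMap.smulRight_apply, ContinuousLinearMap.comp_apply,
    ContinuousLinearMap.flip_apply, PiLp.add_apply, PiLp.smul_apply, PiLp.sub_apply, smul_eq_mul,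
    PiLp.proj_apply, ContinuousLinearMap.id_apply]
  fin_cases i
  · simp
    linear_combination -(τ + 1) ^ 2 * t * b 0 * hG
  · simp
    linear_combination -(τ + 1) ^ 2 * t * b 1 * hG
  · simp
    linear_combination -(τ + 1) ^ 2 * t * b 2 * hG

theorem hasFDerivAt_flux {θ : E3 → ℝ} {B : E3 → E3} (hθ : ContDiff ℝ 1 θ) (hB : ContDiff ℝ 1 B)
    (i : Fin 3) (τ : ℝ) (x b : E3) :
    HasFDerivAt (fun b : E3 => θ (x + b) • (B (x - τ • b) i • b - b i • B (x - τ • b)))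
      (fluxDeriv i (fderiv ℝ θ (x + b)) (θ (x + b)) τ (B (x - τ • b)) b
        (fderiv ℝ B (x - τ • b))) b := by
  have h1 : HasFDerivAt (fun b => θ (x + b)) (fderiv ℝ θ (x + b)) b :=
    (hasFDerivAt_comp_add_left x).2 (hθ.differentiable one_ne_zero _).hasFDerivAt
  have h2 : HasFDerivAt (fun b : E3 => x - τ • b) (-(τ • ContinuousLinearMap.id ℝ E3)) b :=
    ((hasFDerivAt_id b).const_smul τ).const_sub x
  have h3 : HasFDerivAt (fun b => B (x - τ • b)) (-τ • fderiv ℝ B (x - τ • b)) b := by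
    refine ((hB.differentiable one_ne_zero _).hasFDerivAt.comp b h2).congr_fderiv ?_
    ext1 v
    simp
  have h4 : ∀ {g : E3 → E3} {g' : E3 →L[ℝ] E3}, HasFDerivAt g g' b →
      HasFDerivAt (fun b => g b i) ((EuclideanSpace.proj i : E3 →L[ℝ] ℝ) ∘L g') b :=
    fun h => (EuclideanSpace.proj i : E3 →L[ℝ] ℝ).hasFDerivAt.comp b h
  have h5 := ((h4 h3).smul (hasFDerivAt_id b)).sub ((h4 (hasFDerivAt_id b)).smul h3)
  exact h1.smul h5

section

variable {Θ p c : ℝ} {θ : E3 → ℝ} {B : E3 → E3}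

/-- The radial derivative `-∂_τ [(τ+1)² θ(x+b) B_i(x - τ b)]`. -/
def radialIntegrand (θ : E3 → ℝ) (B : E3 → E3) (i : Fin 3) (x : E3) (q : ℝ × E3) : ℝ :=
  -(θ (x + q.2) * (2 * (q.1 + 1) * B (x - q.1 • q.2) i -
    (q.1 + 1) ^ 2 * fderiv ℝ B (x - q.1 • q.2) q.2 i))

theorem continuous_radialIntegrand (hθ : IsMollifier Θ θ) (hB : IsDecayingField p c B) (i : Fin 3)
    (x : E3) : Continuous (radialIntegrand θ B i x) := by
  have h1 := hθ.contDiff.continuous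
  have h2 := hB.contDiff.continuous
  have h4 := hB.contDiff.continuous_fderiv one_ne_zero
  unfold radialIntegrand
  fun_prop

/-- The term `(τ+1)² ‖b‖` is the critical one: it uses both spare powers of `weight_ray_le`. -/
theorem abs_radialIntegrand_le (hθ : IsMollifier Θ θ) (hB : IsDecayingField p c B) (hp : 0 ≤ p)
    (i : Fin 3) {R τ : ℝ} {x b : E3} (hx : ‖x‖ ≤ R) (hτ : 0 ≤ τ) (hb0 : b ≠ 0) :
    |radialIntegrand θ B i x (τ, b)| ≤
      3 * (Θ * c * ((1 + (R + 1)) ^ 2 * (2 + (R + 1)) ^ p)) * rayMajorant (R + 1) (p - 2) (τ, b) := by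
  have hR : 0 ≤ R := (norm_nonneg x).trans hx
  have hΘ : 0 ≤ Θ := (abs_nonneg _).trans (hθ.bound 0)
  have hc : 0 ≤ c := nonneg_of_mul_nonneg_left ((norm_nonneg _).trans (hB.bound 0))
    (Real.rpow_pos_of_pos (bracket_pos 0) _)
  have h0 := rayMajorant_nonneg (R + 1) (p - 2) hτ b
  by_cases h : 1 < ‖x + b‖
  · simp only [radialIntegrand, hθ.support _ h, zero_mul, neg_zero, abs_zero]
    positivity
  have hb := norm_le_of_norm_add_le hx h
  have k0 := ray_weight_le_rayMajorant hp (by linarith) hτ (hx.trans (by linarith)) hb hb0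
    (m := 0) zero_le_one
  have k1 := ray_weight_le_rayMajorant hp (by linarith) hτ (hx.trans (by linarith)) hb hb0
    (m := 1) le_rfl
  have h1 : |B (x - τ • b) i| ≤ c * bracket (x - τ • b) ^ (-p) :=
    (PiLp.norm_apply_le (B (x - τ • b)) i).trans (hB.bound _)
  have h2 : |fderiv ℝ B (x - τ • b) b i| ≤ c * bracket (x - τ • b) ^ (-p) * ‖b‖ :=
    (PiLp.norm_apply_le (fderiv ℝ B (x - τ • b) b) i).trans
      ((fderiv ℝ B (x - τ • b)).le_of_opNorm_le (hB.bound_fderiv _) b)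
  calc |radialIntegrand θ B i x (τ, b)|
      = |θ (x + b)| * |2 * (τ + 1) * B (x - τ • b) i -
          (τ + 1) ^ 2 * fderiv ℝ B (x - τ • b) b i| := by rw [radialIntegrand, abs_neg, abs_mul]
    _ ≤ Θ * (2 * (τ + 1) * (c * bracket (x - τ • b) ^ (-p)) +
          (τ + 1) ^ 2 * (c * bracket (x - τ • b) ^ (-p) * ‖b‖)) := by
        gcongr
        · exact hθ.bound _
        · refine (abs_sub _ _).trans ?_
          rw [abs_mul, abs_mul, abs_mul, abs_two, abs_of_nonneg (by linarith : 0 ≤ τ + 1),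
            abs_of_nonneg (by positivity : 0 ≤ (τ + 1) ^ 2)]
          gcongr
    _ = 2 * (Θ * c) * ((τ + 1) ^ (0 + 1) * ‖b‖ ^ 0 * bracket (x - τ • b) ^ (-p)) +
          Θ * c * ((τ + 1) ^ (1 + 1) * ‖b‖ ^ 1 * bracket (x - τ • b) ^ (-p)) := by ring
    _ ≤ 2 * (Θ * c) * ((1 + (R + 1)) ^ 2 * (2 + (R + 1)) ^ p * rayMajorant (R + 1) (p - 2) (τ, b)) +
          Θ * c * ((1 + (R + 1)) ^ 2 * (2 + (R + 1)) ^ p * rayMajorant (R + 1) (p - 2) (τ, b)) := by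
        gcongr
    _ = _ := by ring

theorem ae_rayMeasure_ne_zero : ∀ᵐ q ∂rayMeasure, q.2 ≠ 0 :=
  Measure.quasiMeasurePreserving_snd.ae ae_ne_zero

theorem integrable_radialIntegrand (hθ : IsMollifier Θ θ) (hB : IsDecayingField p c B)
    (hp : 3 < p) (i : Fin 3) (x : E3) : Integrable (radialIntegrand θ B i x) rayMeasure := by
  refine ((integrable_rayMajorant (‖x‖ + 1) (by linarith : 1 < p - 2)).const_mul
    (3 * (Θ * c * ((1 + (‖x‖ + 1)) ^ 2 * (2 + (‖x‖ + 1)) ^ p)))).mono'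
    (continuous_radialIntegrand hθ hB i x).aestronglyMeasurable ?_
  filter_upwards [ae_rayMeasure_pos, ae_rayMeasure_ne_zero] with q hq hq'
  exact abs_radialIntegrand_le hθ hB (by linarith) i le_rfl hq.le hq'

/-- The fundamental theorem of calculus along the ray: only the value at `τ = 0` survives. -/
theorem integral_radialIntegrand_ray (hθ : IsMollifier Θ θ) (hB : IsDecayingField p c B)
    (hp : 3 < p) (i : Fin 3) (x : E3) {b : E3} (hb0 : b ≠ 0) :
    ∫ τ in Ioi (0 : ℝ), radialIntegrand θ B i x (τ, b) = θ (x + b) * B x i := by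
  have hmaj := integrableOn_rayMajorant (‖x‖ + 1) (by linarith : 1 < p - 2) hb0
  have hΘ : 0 ≤ Θ := (abs_nonneg _).trans (hθ.bound 0)
  have hc : 0 ≤ c := nonneg_of_mul_nonneg_left ((norm_nonneg _).trans (hB.bound 0))
    (Real.rpow_pos_of_pos (bracket_pos 0) _)
  set φ : ℝ → ℝ := fun τ => -(θ (x + b) * ((τ + 1) ^ 2 * B (x - τ • b) i)) with hφ
  have hBd := hB.contDiff.differentiable one_ne_zero
  have hder : ∀ τ, HasDerivAt φ (radialIntegrand θ B i x (τ, b)) τ := fun τ => by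
    have h1 : HasDerivAt (fun τ : ℝ => x - τ • b) (-b) τ := by
      simpa using ((hasDerivAt_id τ).smul_const b).const_sub x
    have h2 : HasDerivAt (fun τ : ℝ => B (x - τ • b)) (fderiv ℝ B (x - τ • b) (-b)) τ :=
      (hBd _).hasFDerivAt.comp_hasDerivAt τ h1
    have h3 : HasDerivAt (fun τ : ℝ => B (x - τ • b) i) (fderiv ℝ B (x - τ • b) (-b) i) τ :=
      (EuclideanSpace.proj i : E3 →L[ℝ] ℝ).hasFDerivAt.comp_hasDerivAt τ h2
    have h4 : HasDerivAt (fun τ : ℝ => (τ + 1) ^ 2) (2 * (τ + 1)) τ := by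
      simpa using ((hasDerivAt_id τ).add_const 1).fun_pow 2
    refine (((h4.mul h3).const_mul (θ (x + b))).neg).congr_deriv ?_
    rw [map_neg, PiLp.neg_apply, radialIntegrand]
    ring
  have hint : IntegrableOn (fun τ => radialIntegrand θ B i x (τ, b)) (Ioi 0) := by
    refine (hmaj.const_mul (3 * (Θ * c * ((1 + (‖x‖ + 1)) ^ 2 * (2 + (‖x‖ + 1)) ^ p)))).mono'
      ((continuous_radialIntegrand hθ hB i x).comp
        (by fun_prop : Continuous fun τ : ℝ => (τ, b))).aestronglyMeasurable ?_
    filter_upwards [ae_restrict_mem measurableSet_Ioi] with τ hτ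
    exact abs_radialIntegrand_le hθ hB (by linarith) i le_rfl (mem_Ioi.1 hτ).le hb0
  have hcont : Continuous φ := continuous_iff_continuousAt.2 fun τ => (hder τ).continuousAt
  have hint' : IntegrableOn φ (Ioi 0) := by
    refine (hmaj.const_mul (Θ * c * ‖b‖⁻¹ * ((1 + (‖x‖ + 1)) ^ 2 * (2 + (‖x‖ + 1)) ^ p))).mono'
      hcont.aestronglyMeasurable ?_
    filter_upwards [ae_restrict_mem measurableSet_Ioi] with τ hτ
    have hτ' : 0 ≤ τ := (mem_Ioi.1 hτ).le
    have h0 := rayMajorant_nonneg (‖x‖ + 1) (p - 2) hτ' b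
    by_cases h : 1 < ‖x + b‖
    · simp only [hφ, hθ.support _ h, zero_mul, neg_zero, norm_zero]
      positivity
    have hb := norm_le_of_norm_add_le le_rfl h
    have hbpos := norm_pos_iff.2 hb0
    have k1 := ray_weight_le_rayMajorant (by linarith : 0 ≤ p) (by positivity) hτ'
      (by linarith) hb hb0 (m := 1) le_rfl
    have h1 : |B (x - τ • b) i| ≤ c * bracket (x - τ • b) ^ (-p) :=
      (PiLp.norm_apply_le (B (x - τ • b)) i).trans (hB.bound _)
    calc ‖φ τ‖ = |θ (x + b)| * ((τ + 1) ^ 2 * |B (x - τ • b) i|) := by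
          rw [hφ, Real.norm_eq_abs, abs_neg, abs_mul, abs_mul,
            abs_of_nonneg (by positivity : 0 ≤ (τ + 1) ^ 2)]
      _ ≤ Θ * ((τ + 1) ^ 2 * (c * bracket (x - τ • b) ^ (-p))) := by
          gcongr; exact hθ.bound _
      _ = Θ * c * ‖b‖⁻¹ * ((τ + 1) ^ (1 + 1) * ‖b‖ ^ 1 * bracket (x - τ • b) ^ (-p)) := by
          field_simp
          ring
      _ ≤ Θ * c * ‖b‖⁻¹ * ((1 + (‖x‖ + 1)) ^ 2 * (2 + (‖x‖ + 1)) ^ p *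
            rayMajorant (‖x‖ + 1) (p - 2) (τ, b)) := by gcongr
      _ = _ := by ring
  -- The primitive and its derivative are both integrable on the ray, so the primitive tends to `0`.
  have hlim := tendsto_zero_of_hasDerivAt_of_integrableOn_Ioi (fun τ _ => hder τ) hint hint'
  rw [integral_Ioi_of_hasDerivAt_of_tendsto hcont.continuousWithinAt (fun τ _ => hder τ) hint hlim]
  simp [hφ]

theorem integral_radialIntegrand (hθ : IsMollifier Θ θ) (hB : IsDecayingField p c B)
    (hp : 3 < p) (i : Fin 3) (x : E3) :
    ∫ q, radialIntegrand θ B i x q ∂rayMeasure = B x i := by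
  have h := integrable_radialIntegrand hθ hB hp i x
  rw [rayMeasure] at h ⊢
  rw [integral_prod_symm _ h]
  have : ∀ᵐ b : E3, ∫ τ in Ioi (0 : ℝ), radialIntegrand θ B i x (τ, b) = θ (x + b) * B x i := by
    filter_upwards [ae_ne_zero] with b hb
    exact integral_radialIntegrand_ray hθ hB hp i x hb
  rw [integral_congr_ae this, integral_mul_const, integral_add_left_eq_self (fun b => θ b) x,
    hθ.integral_eq, one_mul]

/-- For each `τ`, the curl of the integrand differs from the radial derivative by `(τ+1)` times the
divergence in `b` of a compactly supported field, which integrates to zero. The radial part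
integrates to `B`, as `θ` has mass one. -/
theorem curl_rayPotential (hθ : IsMollifier Θ θ) (hB : IsDecayingField p c B)
    (hdiv : ∀ x, divergence B x = 0) (hp : 3 < p) (x : E3) :
    curl (rayPotential θ B) x = B x := by
  ext i
  have hD := integrable_potentialIntegrandDeriv hθ hB hp x
  have hI := (curlComp i).integrable_comp hD
  have hJ := integrable_radialIntegrand hθ hB hp i x
  rw [curl_apply, (hasFDerivAt_rayPotential hθ hB hp x).fderiv,
    ← (curlComp i).integral_comp_comm hD, ← integral_radialIntegrand hθ hB hp i x, ← sub_eq_zero,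
    ← integral_sub hI hJ]
  have hIJ : Integrable (fun q => curlComp i (potentialIntegrandDeriv θ B x q) -
    radialIntegrand θ B i x q) rayMeasure := hI.sub hJ
  rw [rayMeasure] at hIJ ⊢
  rw [integral_prod _ hIJ]
  refine integral_eq_zero_of_ae (ae_of_all _ fun τ => ?_)
  set W : E3 → E3 := fun b => θ (x + b) • (B (x - τ • b) i • b - b i • B (x - τ • b)) with hW
  have hWd : ContDiff ℝ 1 W := by
    have h1 := hθ.contDiff
    have h2 := hB.contDiff
    fun_prop
  have hWs : HasCompactSupport W :=
    (hθ.compact.comp_homeomorph (Homeomorph.addLeft x)).smul_right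
  have key : ∀ b, curlComp i (potentialIntegrandDeriv θ B x (τ, b)) -
      radialIntegrand θ B i x (τ, b) = (τ + 1) * divergence W b := fun b => by
    have h := curlComp_sub_eq i (fderiv ℝ θ (x + b)) (θ (x + b)) τ (B (x - τ • b)) b
      (G := fderiv ℝ B (x - τ • b)) (hdiv _)
    simp only [divergence, partialD, hW,
      (hasFDerivAt_flux hθ.contDiff hB.contDiff i τ x b).fderiv]
    rw [← h, radialIntegrand, sub_neg_eq_add]
    rfl
  simp only [key]
  rw [integral_const_mul, integral_divergence_eq_zero hWd hWs, mul_zero]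
  rfl

end

end MagneticSchrodinger
end

/-! ### Decay of the averaged ray potential and existence of `A` -/

noncomputable section

namespace MagneticSchrodinger

open Set Filter Topology

section

variable {Θ p c : ℝ} {θ : E3 → ℝ} {B : E3 → E3}

/-- From `(1+τ)x = (x - τb) + τ(x+b)` with base point `x + b` in the unit ball: for `‖x‖ ≥ 2` the
ray loses at most half of `(1+τ)‖x‖`. The other factor `2` in the constant `4` is `⟨x⟩ ≤ 2‖x‖`. -/
theorem bracket_ray_ge {τ : ℝ} {x b : E3} (hτ : 0 ≤ τ) (hx : 2 ≤ ‖x‖) (h : ‖x + b‖ ≤ 1) :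
    (τ + 1) * (bracket x / 4) ≤ bracket (x - τ • b) := by
  have h1 : (1 + τ) * ‖x‖ ≤ ‖x - τ • b‖ + τ * ‖x + b‖ := by
    have e : (1 + τ) • x = (x - τ • b) + τ • (x + b) := by module
    have h2 := norm_add_le (x - τ • b) (τ • (x + b))
    rwa [← e, norm_smul, norm_smul, Real.norm_of_nonneg hτ,
      Real.norm_of_nonneg (by linarith : 0 ≤ 1 + τ)] at h2
  have h3 := norm_le_bracket (x - τ • b)
  have h4 : bracket x ≤ 2 * ‖x‖ := by
    rw [bracket]
    refine Real.sqrt_le_iff.2 ⟨by positivity, ?_⟩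
    nlinarith
  have h5 : τ * ‖x + b‖ ≤ τ := by nlinarith
  nlinarith

/-- Far from the base points the variables separate: the growth `(τ+1)‖b‖` uses up one power of
`(τ+1)⟨x⟩`, and `1 - p` powers of each remain. -/
theorem norm_potentialIntegrand_le_of_two_le (hθ : IsMollifier Θ θ) (hB : IsDecayingField p c B)
    (hp : 0 ≤ p) {τ : ℝ} {x b : E3} (hτ : 0 ≤ τ) (hx : 2 ≤ ‖x‖) :
    ‖potentialIntegrand θ B x (τ, b)‖ ≤
      2 * (Θ * ‖crossB‖ * c) * 4 ^ p * bracket x ^ (1 - p) *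
        ((τ + 1) ^ (1 - p) * (Metric.closedBall (0 : E3) 1).indicator (fun _ => (1 : ℝ)) (x + b)) := by
  have hΘ : 0 ≤ Θ := (abs_nonneg _).trans (hθ.bound 0)
  have hc : 0 ≤ c := nonneg_of_mul_nonneg_left ((norm_nonneg _).trans (hB.bound 0))
    (Real.rpow_pos_of_pos (bracket_pos 0) _)
  have hw := bracket_pos x
  by_cases h : 1 < ‖x + b‖
  · rw [indicator_of_notMem (by rwa [mem_closedBall_zero_iff, not_le])]
    simp [potentialIntegrand, hθ.support _ h]
  rw [not_lt] at h
  rw [indicator_of_mem (mem_closedBall_zero_iff.2 h), mul_one]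
  have hb : ‖b‖ ≤ 2 * bracket x := by
    have h1 := norm_sub_le (x + b) x
    rw [add_sub_cancel_left] at h1
    linarith [norm_le_bracket x]
  have h1 : bracket (x - τ • b) ^ (-p) ≤ ((τ + 1) * (bracket x / 4)) ^ (-p) :=
    Real.rpow_le_rpow_of_nonpos (by positivity) (bracket_ray_ge hτ hx h) (by linarith)
  have h2 : ((τ + 1) * (bracket x / 4)) ^ (-p) = (τ + 1) ^ (-p) * bracket x ^ (-p) * 4 ^ p := by
    rw [Real.mul_rpow (by linarith) (by positivity), Real.div_rpow hw.le (by norm_num),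
      Real.rpow_neg (by norm_num : (0 : ℝ) ≤ 4), div_inv_eq_mul, mul_assoc]
  have h3 : ‖crossB (B (x - τ • b)) b‖ ≤ ‖crossB‖ * (c * bracket (x - τ • b) ^ (-p)) * ‖b‖ :=
    (crossB.le_opNorm₂ _ _).trans (by gcongr; exact hB.bound _)
  have e : ∀ {y : ℝ}, 0 < y → y ^ (1 - p) = y * y ^ (-p) := fun hy => by
    rw [sub_eq_add_neg, Real.rpow_add hy, Real.rpow_one]
  rw [h2] at h1
  calc ‖potentialIntegrand θ B x (τ, b)‖
      = (τ + 1) * |θ (x + b)| * ‖crossB (B (x - τ • b)) b‖ := by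
        rw [potentialIntegrand, norm_smul, norm_mul, Real.norm_of_nonneg (by simp only; linarith),
          Real.norm_eq_abs]
    _ ≤ (τ + 1) * Θ * (‖crossB‖ * (c * ((τ + 1) ^ (-p) * bracket x ^ (-p) * 4 ^ p)) *
          (2 * bracket x)) := by
        gcongr
        · exact hθ.bound _
        · exact h3.trans (by gcongr)
    _ = _ := by rw [e hw, e (by linarith : 0 < τ + 1)]; ring

/-- For `‖x‖ ≥ 2` the separated bound is integrated over `τ` and over the unit ball of base points.
For `‖x‖ < 2` the potential is bounded by compactness and `⟨x⟩ ≤ 3`. -/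
theorem decaysLike_rayPotential (hθ : IsMollifier Θ θ) (hB : IsDecayingField p c B) (hp : 3 < p) :
    DecaysLike (1 - p) (rayPotential θ B) := by
  obtain ⟨M, hM⟩ := (isCompact_closedBall (0 : E3) 2).exists_bound_of_continuousOn
    (contDiff_rayPotential hθ hB hp).continuous.continuousOn
  set ι : E3 → ℝ := (Metric.closedBall (0 : E3) 1).indicator fun _ => (1 : ℝ) with hι
  set K := 2 * (Θ * ‖crossB‖ * c) * 4 ^ p
  set N := K * ((∫ τ in Ioi (0 : ℝ), (τ + 1) ^ (1 - p)) * ∫ b, ι b)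
  have hint : Integrable (fun τ : ℝ => (τ + 1) ^ (1 - p)) (volume.restrict (Ioi 0)) :=
    integrableOn_add_rpow_Ioi_of_lt (by linarith) (by norm_num)
  have hιi : Integrable ι := by
    rw [hι, integrable_indicator_iff Metric.isClosed_closedBall.measurableSet]
    exact integrableOn_const (isCompact_closedBall (0 : E3) 1).measure_lt_top.ne
  have h0 : ∀ x, 0 ≤ bracket x ^ (1 - p) := fun x => Real.rpow_nonneg (bracket_pos x).le _
  refine ⟨|N| + |M| * (3 : ℝ) ^ (p - 1), fun x => ?_⟩
  by_cases hx : 2 ≤ ‖x‖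
  · have hb := (hint.mul_prod (hιi.comp_add_left x)).const_mul (K * bracket x ^ (1 - p))
    have h1 : ‖rayPotential θ B x‖ ≤ _ := norm_integral_le_of_norm_le (f := potentialIntegrand θ B x)
      (μ := rayMeasure) hb (by
        filter_upwards [ae_rayMeasure_pos] with q hq
        exact norm_potentialIntegrand_le_of_two_le hθ hB (by linarith) hq.le hx)
    rw [integral_const_mul, rayMeasure, integral_prod_mul
      (fun τ : ℝ => (τ + 1) ^ (1 - p)) (fun b => ι (x + b)), integral_add_left_eq_self ι x] at h1
    refine h1.trans ?_
    calc _ = N * bracket x ^ (1 - p) := by ring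
      _ ≤ _ := by
        refine mul_le_mul_of_nonneg_right ((le_abs_self N).trans ?_) (h0 x)
        have : 0 ≤ |M| * (3 : ℝ) ^ (p - 1) := by positivity
        linarith
  · rw [not_le] at hx
    have h1 := hM x (mem_closedBall_zero_iff.2 hx.le)
    have h2 : bracket x ≤ 3 := by
      rw [bracket]
      refine Real.sqrt_le_iff.2 ⟨by norm_num, ?_⟩
      nlinarith [norm_nonneg x]
    have h3 : (3 : ℝ) ^ (1 - p) ≤ bracket x ^ (1 - p) :=
      Real.rpow_le_rpow_of_nonpos (bracket_pos x) h2 (by linarith)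
    have h4 : (3 : ℝ) ^ (p - 1) * 3 ^ (1 - p) = 1 := by
      rw [← Real.rpow_add (by norm_num)]; simp
    calc ‖rayPotential θ B x‖ ≤ |M| * ((3 : ℝ) ^ (p - 1) * 3 ^ (1 - p)) := by
          rw [h4, mul_one]; exact h1.trans (le_abs_self M)
      _ ≤ |M| * ((3 : ℝ) ^ (p - 1) * bracket x ^ (1 - p)) := by gcongr
      _ = |M| * (3 : ℝ) ^ (p - 1) * bracket x ^ (1 - p) := by ring
      _ ≤ _ := mul_le_mul_of_nonneg_right (by linarith [abs_nonneg N]) (h0 x)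

end

theorem exists_isVectorPotential {β : ℝ} (hβ : 2 < β) {B : E3 → E3} (hB : IsMagneticField β B) :
    ∃ A, IsVectorPotential β B A := by
  obtain ⟨c, hc⟩ := hB.exists_isDecayingField
  obtain ⟨Θ, θ, hθ⟩ := exists_isMollifier
  -- The field decays with exponent `p = β + 1`; the potential loses one power, and `1 - p = -β`.
  have hp : 3 < β + 1 := by linarith
  refine ⟨rayPotential θ B, contDiff_rayPotential hθ hc hp,
    curl_rayPotential hθ hc hB.divergence_eq_zero hp, ?_⟩
  have h := decaysLike_rayPotential hθ hc hp
  rwa [show 1 - (β + 1) = -β by ring] at h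

end MagneticSchrodinger
end

open MagneticSchrodinger in
theorem corollary5p6 (β : ℝ) (hβ : 2 < β) (V : E3 → ℝ) (hV : IsElectricPotential β V)
    (hV0 : ∀ x, 0 ≤ V x) (B : E3 → E3) (hB : IsMagneticField β B) :
    (∃ A : E3 → E3, IsVectorPotential β B A) ∧
    ∀ A : E3 → E3, IsVectorPotential β B A →
      (∀ C D : Fin 3 → E3 → ℝ, IsFactorization β A C D →
        ∃ M₀ : KSpace →L[ℂ] KSpace, IsMZero β V A C D M₀ ∧ LinearMap.ker M₀.toLinearMap = ⊥) ∧
      (∀ s : ℝ, 1 / 2 < s → s ≤ 3 / 2 → zeroEnergySolutions A V s = {0}) ∧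
      nullSpace A V = {0} := by
  have h0 : 0 ≤ β := by linarith
  refine ⟨exists_isVectorPotential hβ hB, fun A hA =>
    ⟨fun C D hCD => exists_isMZero hβ hV hV0 hA hCD, fun s _ hs =>
      zeroEnergySolutions_eq (hA.memLp_top h0) (hV.memLp_top h0) hV0 hs,
      nullSpace_eq (hA.memLp_top h0) (hV.memLp_top h0) hV0⟩⟩
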